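/- **Setting.** Let $n\ge 2$, let $\Gamma$ be an additive commutative semigroup, and let $T$ be an $n$-ary $\Gamma$-semiring: a commutative monoid with a map $T^n\times\Gamma^{n-1}\to T$, $(x,\gamma)\mapsto[x_1,\dots,x_n]_{\gamma_1,\dots,\gamma_{n-1}}$, additive in every variable, zero if some $x_i=0$ or some $\gamma_q$ is a zero of $\Gamma$, and positionally associative: for a word $x_1\gamma_1x_2\gamma_2\cdots\gamma_{2n-2}x_{2n-1}$ the value obtained by first multiplying $n$ consecutive entries (with the parameters between them) does not depend on the place of this bracket. Fix a set $\Lambda\subseteq\{1,\dots,n\}$ of slots. Let $\mathcal C$ be the category of bi-$\Gamma$-modules with positional actions in the slots of $\Lambda$: abelian groups $M$ with operations $[t_1,\dots,t_{j-1},w,t_j,\dots,t_{n-1}]_\gamma\in M$ for $w\in M$, $t_i\in T$, $j\in\Lambda$, additive in every variable, such that any two bracketings of a word with exactly one entry in $M$ agree whenever both only use slots of $\Lambda$; morphisms are the additive maps that respect all these actions. (For $\Lambda=\{j,k\}$ these are modules with compatible actions in the slots $j$ and $k$.) The admissible short exact sequences are the kernel–cokernel pairs. Projectives, injectives and resolutions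 in $\mathcal C$ are taken with respect to them. For $j,k\in\Lambda$ let $M\otimes^{(j,k)}_\Gamma N$ be the quotient of $M\otimes_{\mathbb Z}N$ by all $[..,a,..]_\gamma\otimes b-a\otimes[..,b,..]_\gamma$, with $a\in M$ in slot $k$, $b\in N$ in slot $j$, and the same $t$, $\gamma$ in both terms. A cohomological $\delta$-functor is a sequence $(R^r)_{r\ge0}$ of additive functors with natural connecting morphisms $\delta:R^r(X_3)\to R^{r+1}(X_1)$ for admissible sequences $0\to X_1\to X_2\to X_3\to0$, consecutive maps in the long sequences composing to zero. It is universal if every natural transformation from $R^0$ to the degree-$0$ term of any $\delta$-functor extends uniquely to a morphism of $\delta$-functors. Homological $\delta$-functors are defined dually. For a bifunctor, a $\delta$-functor in one variable is one with values in the category of functors of the other variable. In a contravariant variable, $\mathcal C$ is replaced by $\mathcal C^{\mathrm{op}}$, so that injective resolutions there are projective resolutions in $\mathcal C$. **Theorem.** Let $F:\mathcal A\times\mathcal C\to\mathbf{Ab}$, where $\mathcal A$ is $\mathcal C$ or $\mathcal C^{\mathrm{op}}$, be an additive bifunctor which is left exact (resp. right exact) in each variable. Every object has injective (resp. projective) resolutions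 in each of the two variables, and the following hold. 1. *Derived $\delta$-functors in each variable.* For each of the two variables there is a $\delta$-functor $(R^rF)_{r\ge0}$ (resp. $(L_rF)_{r\ge 0}$) in this variable, consisting of additive bifunctors, such that: (i) $R^0F\cong F$ (resp. $L_0F\cong F$); (ii) every admissible short exact sequence in this variable induces a long exact sequence, natural in the other variable; (iii) it is universal: every natural transformation from $R^0F$ to the degree-$0$ term of a $\delta$-functor (resp. to $L_0F$ from such a term) extends uniquely to a morphism of $\delta$-functors. Moreover $R^rF$ (resp. $L_rF$) is the cohomology (resp. homology) of $F$ applied to an arbitrary injective (resp. projective) resolution in this variable, naturally with respect to all lifts of morphisms to resolutions. 2. *Total derived bifunctors.* There are bifunctors $\mathbf R^rF$ (resp. $\mathbf L_rF$) with $\mathbf R^0F\cong F$ (resp. $\mathbf L_0F\cong F$), for which admissible short exact sequences in either variable induce natural long exact sequences, and with $\mathbf R^rF(A,B)\cong H^r(\mathrm{Tot}\,F(I^\bullet,J^\bullet))$ for arbitrary injective resolutions $A\to I^\bullet$, $B\to J^\bullet$ (resp. $\mathbf L_rF(A,B)\cong H_r(\mathrm{Tot}\,F(P_\bullet,Q_\bullet))$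 for arbitrary projective resolutions), naturally with respect to all lifts of morphisms to resolutions. They form a universal $\delta$-functor in the first variable if $F(I,-)$ is exact for all injective (resp. projective) $I$, and in the second variable if $F(-,J)$ is exact for all injective (resp. projective) $J$. In particular, $\mathrm{Ext}_\Gamma^r$, the right derived bifunctors of $\mathrm{Hom}_{\mathcal C}:\mathcal C^{\mathrm{op}}\times\mathcal C\to\mathbf{Ab}$, exist: one family $(\mathrm{Ext}^r_\Gamma)$ has all the properties of part 1 in both variables and all the properties of part 2, so that it is computed by projective resolutions of the first argument, by injective resolutions of the second, or by both, independently of their choice, and it is universal in each variable. Likewise, for all $j,k\in\Lambda$, the left derived bifunctors $\mathrm{Tor}^\Gamma_r$ of $\otimes^{(j,k)}_\Gamma:\mathcal C\times\mathcal C\to\mathbf{Ab}$, with respect to the first variable, with respect to the second variable, and total, exist with the properties of parts 1 and 2; they are independent of the chosen resolutions, and those with respect to one variable are universal in it. -/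

import Mathlib

open CategoryTheory Limits

universe u

noncomputable section

/-! ## `n`-ary `Γ`-semirings, with `n = m + 1`

A word of length `2 m + 1 = 2 n - 1` with entries `x 0, x 1, …, x (2m)` is written with a parameter
between any two consecutive entries, `x 0, γ 0, x 1, γ 1, …, γ (2m-1), x (2m)`.  Bracketing the
`n` consecutive entries that start at `x i` (together with the `m` parameters between them) leaves
an outer word of length `n`, whose `i`-th entry is the bracket. -/

namespace NaryGamma

section Words

variable {m : ℕ} {T Γ : Type u}

/-- The entries `x i, …, x (i + m)`. -/
def innerWord (i : Fin (m + 1)) (x : Fin (2 * m + 1) → T) : Fin (m + 1) → T :=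
  fun r => x ⟨i + r, by omega⟩

/-- The parameters `γ i, …, γ (i + m - 1)` between the entries `x i, …, x (i + m)`. -/
def innerParams (i : Fin (m + 1)) (γ : Fin (2 * m) → Γ) : Fin m → Γ :=
  fun r => γ ⟨i + r, by omega⟩

/-- The word `x 0, …, x (i - 1), y, x (i + m + 1), …, x (2m)`. -/
def outerWord (i : Fin (m + 1)) (x : Fin (2 * m + 1) → T) (y : T) : Fin (m + 1) → T :=
  fun p => if (p : ℕ) < i then x ⟨p, by omega⟩ else if p = i then y else x ⟨p + m, by omega⟩

/-- The parameters that remain outside the bracket. -/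
def outerParams (i : Fin (m + 1)) (γ : Fin (2 * m) → Γ) : Fin m → Γ :=
  fun q => if (q : ℕ) < i then γ ⟨q, by omega⟩ else γ ⟨q + m, by omega⟩

/-- Position `s` lies in the bracket that starts at `i`. -/
def Inside (i : Fin (m + 1)) (s : Fin (2 * m + 1)) : Prop := (i : ℕ) ≤ s ∧ (s : ℕ) ≤ i + m

instance (i : Fin (m + 1)) (s : Fin (2 * m + 1)) : Decidable (Inside i s) :=
  inferInstanceAs (Decidable (_ ∧ _))

/-- The slot of the bracket in which position `s` lies. -/
def innerSlot (i : Fin (m + 1)) (s : Fin (2 * m + 1)) (h : Inside i s) : Fin (m + 1) :=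
  ⟨s - i, by have := h.1; have := h.2; omega⟩

/-- The slot of the outer word in which position `s` lies; it is `i` if `s` is in the bracket. -/
def outerSlot (i : Fin (m + 1)) (s : Fin (2 * m + 1)) : Fin (m + 1) :=
  if h : (s : ℕ) < i then ⟨s, by omega⟩ else if (s : ℕ) ≤ i + m then i else ⟨s - m, by omega⟩

end Words

/-- An `n`-ary `Γ`-semiring, `n = m + 1`: a multiplication `[x₁, …, xₙ]_{γ₁, …, γₙ₋₁}` on `T`. -/
structure NaryGammaSemiring (m : ℕ) (T Γ : Type u) [AddCommMonoid T] [AddCommSemigroup Γ] where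
  mul : (Fin (m + 1) → T) → (Fin m → Γ) → T
  mul_add : ∀ (x : Fin (m + 1) → T) (γ : Fin m → Γ) (p : Fin (m + 1)) (a b : T),
    mul (Function.update x p (a + b)) γ =
      mul (Function.update x p a) γ + mul (Function.update x p b) γ
  mul_add_param : ∀ (x : Fin (m + 1) → T) (γ : Fin m → Γ) (q : Fin m) (α β : Γ),
    mul x (Function.update γ q (α + β)) =
      mul x (Function.update γ q α) + mul x (Function.update γ q β)
  assoc : ∀ (x : Fin (2 * m + 1) → T) (γ : Fin (2 * m) → Γ) (i i' : Fin (m + 1)),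
    mul (outerWord i x (mul (innerWord i x) (innerParams i γ))) (outerParams i γ) =
      mul (outerWord i' x (mul (innerWord i' x) (innerParams i' γ))) (outerParams i' γ)
  mul_eq_zero : ∀ (x : Fin (m + 1) → T) (γ : Fin m → Γ) (p : Fin (m + 1)), x p = 0 → mul x γ = 0
  mul_eq_zero_param : ∀ z : Γ, (∀ α : Γ, α + z = α) →
    ∀ (x : Fin (m + 1) → T) (γ : Fin m → Γ) (q : Fin m), γ q = z → mul x γ = 0

variable {m : ℕ} {T Γ : Type u} [AddCommMonoid T] [AddCommSemigroup Γ]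

/-- The value of the word `x 0, …, w, …, x (2m)` with the module element `w` in position `s` (the
entry `x s` is not used), bracketed at `i`.  Here `act j t γ w` stands for
`[t₁, …, t_{j-1}, w, t_j, …, t_m]_γ`, the module element `w` being inserted in slot `j`. -/
def bracketAct (A : NaryGammaSemiring m T Γ) {M : Type u} [AddCommGroup M]
    (act : Fin (m + 1) → (Fin m → T) → (Fin m → Γ) → (M →+ M))
    (i : Fin (m + 1)) (s : Fin (2 * m + 1)) (x : Fin (2 * m + 1) → T) (γ : Fin (2 * m) → Γ)
    (w : M) : M :=
  act (outerSlot i s)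
    ((outerSlot i s).removeNth (outerWord i x (A.mul (innerWord i x) (innerParams i γ))))
    (outerParams i γ)
    (if h : Inside i s then
      act (innerSlot i s h) ((innerSlot i s h).removeNth (innerWord i x)) (innerParams i γ) w
    else w)

/-- Bracketing at `i`, with a module element in position `s`, only uses positional actions in slots
that belong to `Λ`. -/
def SlotsIn (Λ : Set (Fin (m + 1))) (i : Fin (m + 1)) (s : Fin (2 * m + 1)) : Prop :=
  outerSlot i s ∈ Λ ∧ ∀ h : Inside i s, innerSlot i s h ∈ Λ

/-- A bi-`Γ`-module with positional actions in the slots of `Λ`: an abelian group `M` with an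
action `[t₁, …, t_{j-1}, w, t_j, …, t_m]_γ` for each slot `j ∈ Λ`, additive in every variable, such
that any two bracketings of a word with one entry in `M` agree, as far as both of them only use
slots of `Λ`.  (As `M` is a group, additivity gives that a zero entry or zero parameter acts
as `0`.  For `j ∉ Λ` there is no action; `act j` is then `0` by convention.) -/
structure BiModule (A : NaryGammaSemiring m T Γ) (Λ : Set (Fin (m + 1))) where
  carrier : Type u
  [addCommGroup : AddCommGroup carrier]
  act : Fin (m + 1) → (Fin m → T) → (Fin m → Γ) → (carrier →+ carrier)
  act_of_notMem : ∀ j, j ∉ Λ → ∀ t γ, act j t γ = 0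
  act_add : ∀ (j : Fin (m + 1)) (t : Fin m → T) (γ : Fin m → Γ) (p : Fin m) (a b : T),
    act j (Function.update t p (a + b)) γ =
      act j (Function.update t p a) γ + act j (Function.update t p b) γ
  act_add_param : ∀ (j : Fin (m + 1)) (t : Fin m → T) (γ : Fin m → Γ) (q : Fin m) (α β : Γ),
    act j t (Function.update γ q (α + β)) =
      act j t (Function.update γ q α) + act j t (Function.update γ q β)
  assoc : ∀ (s : Fin (2 * m + 1)) (i i' : Fin (m + 1)), SlotsIn Λ i s → SlotsIn Λ i' s →
    ∀ (x : Fin (2 * m + 1) → T) (γ : Fin (2 * m) → Γ) (w : carrier),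
      bracketAct A act i s x γ w = bracketAct A act i' s x γ w

attribute [instance] BiModule.addCommGroup

namespace BiModule

variable {A : NaryGammaSemiring m T Γ} {Λ : Set (Fin (m + 1))}

/-- Morphisms of bi-`Γ`-modules: additive maps that respect the action in each slot. -/
@[ext]
structure Hom (M N : BiModule A Λ) where
  toAddMonoidHom : M.carrier →+ N.carrier
  map_act : ∀ j t γ w, toAddMonoidHom (M.act j t γ w) = N.act j t γ (toAddMonoidHom w)

instance : Category (BiModule A Λ) where
  Hom := Hom
  id M := ⟨AddMonoidHom.id _, fun _ _ _ _ => rfl⟩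
  comp f g := ⟨g.toAddMonoidHom.comp f.toAddMonoidHom, fun j t γ w => by
    simp [f.map_act, g.map_act]⟩

@[ext]
theorem hom_ext {M N : BiModule A Λ} {f g : M ⟶ N}
    (h : f.toAddMonoidHom = g.toAddMonoidHom) : f = g := Hom.ext h

variable (M N : BiModule A Λ)

instance : Zero (M ⟶ N) := ⟨⟨0, fun _ _ _ _ => by simp⟩⟩

instance : Add (M ⟶ N) := ⟨fun f g => ⟨f.toAddMonoidHom + g.toAddMonoidHom, fun j t γ w => by
  simp [f.map_act, g.map_act]⟩⟩

instance : Neg (M ⟶ N) := ⟨fun f => ⟨-f.toAddMonoidHom, fun j t γ w => by simp [f.map_act]⟩⟩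

instance : Sub (M ⟶ N) := ⟨fun f g => ⟨f.toAddMonoidHom - g.toAddMonoidHom, fun j t γ w => by
  simp [f.map_act, g.map_act]⟩⟩

instance : SMul ℕ (M ⟶ N) := ⟨fun n f => ⟨n • f.toAddMonoidHom, fun j t γ w => by
  simp [f.map_act]⟩⟩

instance : SMul ℤ (M ⟶ N) := ⟨fun n f => ⟨n • f.toAddMonoidHom, fun j t γ w => by
  simp [f.map_act]⟩⟩

theorem toAddMonoidHom_injective :
    Function.Injective (fun f : M ⟶ N => f.toAddMonoidHom) := fun _ _ h => hom_ext h

instance : AddCommGroup (M ⟶ N) :=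
  (toAddMonoidHom_injective M N).addCommGroup _ rfl (fun _ _ => rfl) (fun _ => rfl)
    (fun _ _ => rfl) (fun _ _ => rfl) (fun _ _ => rfl)

instance : Preadditive (BiModule A Λ) where
  add_comp P Q R f f' g := hom_ext (AddMonoidHom.comp_add g.toAddMonoidHom _ _)
  comp_add P Q R f g g' := hom_ext (AddMonoidHom.add_comp g.toAddMonoidHom _ _)

/-! ### The positional tensor product -/

open TensorProduct

variable (j k : Fin (m + 1))

/-- The subgroup of `M ⊗ N` that is generated by the elements
`[.., a, ..]_γ ⊗ b - a ⊗ [.., b, ..]_γ`, with `a` in slot `k` and `b` in slot `j`. -/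
def tensorRel : AddSubgroup (M.carrier ⊗[ℤ] N.carrier) :=
  AddSubgroup.closure {z | ∃ t γ a b, z = M.act k t γ a ⊗ₜ b - a ⊗ₜ N.act j t γ b}

/-- The coequalizer of the two positional actions, of slot `k` on the right module `M` and of
slot `j` on the left module `N`. -/
abbrev TensorObj : Type u := (M.carrier ⊗[ℤ] N.carrier) ⧸ tensorRel M N j k

variable {M N}

def tensorMap {M' N' : BiModule A Λ} (f : M ⟶ M') (g : N ⟶ N') :
    TensorObj M N j k →+ TensorObj M' N' j k :=
  QuotientAddGroup.map _ _
    (TensorProduct.map f.toAddMonoidHom.toIntLinearMap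
      g.toAddMonoidHom.toIntLinearMap).toAddMonoidHom (by
    refine (AddSubgroup.closure_le _).2 ?_
    rintro _ ⟨t, γ, a, b, rfl⟩
    refine AddSubgroup.subset_closure ⟨t, γ, f.toAddMonoidHom a, g.toAddMonoidHom b, ?_⟩
    simp [f.map_act, g.map_act])

theorem tensorMap_mk {M' N' : BiModule A Λ} (f : M ⟶ M') (g : N ⟶ N')
    (a : M.carrier) (b : N.carrier) :
    tensorMap j k f g (QuotientAddGroup.mk (a ⊗ₜ b)) =
      QuotientAddGroup.mk (f.toAddMonoidHom a ⊗ₜ g.toAddMonoidHom b) := rfl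

theorem tensorObj_hom_ext {G : Type*} [AddCommGroup G] {φ ψ : TensorObj M N j k →+ G}
    (h : ∀ a b, φ (QuotientAddGroup.mk (a ⊗ₜ b)) = ψ (QuotientAddGroup.mk (a ⊗ₜ b))) : φ = ψ := by
  ext z
  induction z using TensorProduct.induction_on with
  | zero => simp
  | tmul a b => exact h a b
  | add x y hx hy => simpa using congrArg₂ (· + ·) hx hy

/-- The positional tensor product `M ⊗ N` of the right module (in slot `k`) `M` and the left
module (in slot `j`) `N`, as a bifunctor to abelian groups. -/
def tensor : BiModule A Λ ⥤ BiModule A Λ ⥤ AddCommGrpCat.{u} where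
  obj M :=
    { obj := fun N => AddCommGrpCat.of (TensorObj M N j k)
      map := fun g => AddCommGrpCat.ofHom (tensorMap j k (𝟙 M) g)
      map_id := fun N => by
        ext : 1
        exact tensorObj_hom_ext j k fun a b => rfl
      map_comp := fun g g' => by
        ext : 1
        exact tensorObj_hom_ext j k fun a b => rfl }
  map f :=
    { app := fun N => AddCommGrpCat.ofHom (tensorMap j k f (𝟙 N))
      naturality := fun N N' g => by
        ext : 1
        exact tensorObj_hom_ext j k fun a b => rfl }
  map_id M := by
    ext N : 3
    exact tensorObj_hom_ext j k fun a b => rfl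
  map_comp f f' := by
    ext N : 3
    exact tensorObj_hom_ext j k fun a b => rfl

instance : (tensor (A := A) (Λ := Λ) j k).Additive where
  map_add {M M' f f'} := by
    ext N : 3
    refine tensorObj_hom_ext j k fun a b => ?_
    exact congrArg QuotientAddGroup.mk (TensorProduct.add_tmul
      (f.toAddMonoidHom a) (f'.toAddMonoidHom a) b)

instance (M : BiModule A Λ) : ((tensor (A := A) (Λ := Λ) j k).obj M).Additive where
  map_add {N N' g g'} := by
    ext : 1
    refine tensorObj_hom_ext j k fun a b => ?_
    exact congrArg QuotientAddGroup.mk (TensorProduct.tmul_add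
      a (g.toAddMonoidHom b) (g'.toAddMonoidHom b))

end BiModule

end NaryGamma

/-! ## Derived functors in exact categories -/

namespace NaryGamma

universe v₁ v₂ v₃ u₁ u₂ u₃

section Delta

variable {𝒜 : Type u₁} [Category.{v₁} 𝒜] [Preadditive 𝒜]

/-- Admissible short exact sequences: kernel-cokernel pairs. -/
def Conflation (S : ShortComplex 𝒜) : Prop :=
  Nonempty (IsLimit (KernelFork.ofι S.f S.zero)) ∧
    Nonempty (IsColimit (CokernelCofork.ofπ S.g S.zero))

/-- `I` is injective with respect to admissible monomorphisms. -/
def AdmissibleInjective (I : 𝒜) : Prop :=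
  ∀ S : ShortComplex 𝒜, Conflation S → ∀ g : S.X₁ ⟶ I, ∃ h : S.X₂ ⟶ I, S.f ≫ h = g

/-- `P` is projective with respect to admissible epimorphisms. -/
def AdmissibleProjective (P : 𝒜) : Prop :=
  ∀ S : ShortComplex 𝒜, Conflation S → ∀ g : P ⟶ S.X₃, ∃ h : P ⟶ S.X₂, h ≫ S.g = g

/-- An injective resolution `0 ⟶ A ⟶ I 0 ⟶ I 1 ⟶ ⋯`, spliced from admissible short exact
sequences `0 ⟶ Z n ⟶ I n ⟶ Z (n + 1) ⟶ 0`, where `Z 0 ≅ A`. -/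
structure InjectiveRes (A : 𝒜) where
  I : CochainComplex 𝒜 ℕ
  injective : ∀ n, AdmissibleInjective (I.X n)
  Z : ℕ → 𝒜
  ι : ∀ n, Z n ⟶ I.X n
  π : ∀ n, I.X n ⟶ Z (n + 1)
  zero : ∀ n, ι n ≫ π n = 0
  conflation : ∀ n, Conflation (ShortComplex.mk (ι n) (π n) (zero n))
  d_eq : ∀ n, I.d n (n + 1) = π n ≫ ι (n + 1)
  aug : A ≅ Z 0

/-- A projective resolution `⋯ ⟶ P 1 ⟶ P 0 ⟶ A ⟶ 0`, spliced from admissible short exact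
sequences `0 ⟶ Z (n + 1) ⟶ P n ⟶ Z n ⟶ 0`, where `Z 0 ≅ A`. -/
structure ProjectiveRes (A : 𝒜) where
  P : ChainComplex 𝒜 ℕ
  projective : ∀ n, AdmissibleProjective (P.X n)
  Z : ℕ → 𝒜
  ι : ∀ n, Z (n + 1) ⟶ P.X n
  π : ∀ n, P.X n ⟶ Z n
  zero : ∀ n, ι n ≫ π n = 0
  conflation : ∀ n, Conflation (ShortComplex.mk (ι n) (π n) (zero n))
  d_eq : ∀ n, P.d (n + 1) n = π (n + 1) ≫ ι n
  aug : Z 0 ≅ A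

/-- The chain map `φ` lifts `f : A ⟶ A'` to the resolutions. -/
def InjectiveRes.Lifts {A A' : 𝒜} (f : A ⟶ A') (R : InjectiveRes A) (R' : InjectiveRes A')
    (φ : R.I ⟶ R'.I) : Prop :=
  (R.aug.hom ≫ R.ι 0) ≫ φ.f 0 = f ≫ R'.aug.hom ≫ R'.ι 0

/-- The chain map `φ` lifts `f : A ⟶ A'` to the resolutions. -/
def ProjectiveRes.Lifts {A A' : 𝒜} (f : A ⟶ A') (R : ProjectiveRes A) (R' : ProjectiveRes A')
    (φ : R.P ⟶ R'.P) : Prop :=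
  φ.f 0 ≫ R'.π 0 ≫ R'.aug.hom = (R.π 0 ≫ R.aug.hom) ≫ f

variable {𝒟 : Type u₂} [Category.{v₂} 𝒟] [Abelian 𝒟]

def IsLeftExact (G : 𝒜 ⥤ 𝒟) [G.Additive] : Prop :=
  ∀ S : ShortComplex 𝒜, Conflation S → Mono (G.map S.f) ∧ (S.map G).Exact

def IsRightExact (G : 𝒜 ⥤ 𝒟) [G.Additive] : Prop :=
  ∀ S : ShortComplex 𝒜, Conflation S → (S.map G).Exact ∧ Epi (G.map S.g)

def IsExactFunctor (G : 𝒜 ⥤ 𝒟) [G.Additive] : Prop :=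
  ∀ S : ShortComplex 𝒜, Conflation S → (S.map G).ShortExact

/-- The structure of a cohomological `δ`-functor on a sequence of functors: natural connecting
morphisms which make the long sequences complexes. -/
structure CohomologicalDelta (R : ℕ → 𝒜 ⥤ 𝒟) where
  additive : ∀ n, (R n).Additive
  δ : ∀ (n : ℕ) (S : ShortComplex 𝒜), Conflation S → ((R n).obj S.X₃ ⟶ (R (n + 1)).obj S.X₁)
  δ_naturality : ∀ (n : ℕ) (S S' : ShortComplex 𝒜) (hS : Conflation S) (hS' : Conflation S')
    (φ : S ⟶ S'), δ n S hS ≫ (R (n + 1)).map φ.τ₁ = (R n).map φ.τ₃ ≫ δ n S' hS'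
  map_comp_δ : ∀ (n : ℕ) (S : ShortComplex 𝒜) (hS : Conflation S),
    (R n).map S.g ≫ δ n S hS = 0
  δ_comp_map : ∀ (n : ℕ) (S : ShortComplex 𝒜) (hS : Conflation S),
    δ n S hS ≫ (R (n + 1)).map S.f = 0

/-- Exactness of all the long sequences
`0 ⟶ R⁰X₁ ⟶ R⁰X₂ ⟶ R⁰X₃ ⟶ R¹X₁ ⟶ R¹X₂ ⟶ ⋯`. -/
def CohomologicalDelta.IsExact {R : ℕ → 𝒜 ⥤ 𝒟} (d : CohomologicalDelta R) : Prop :=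
  ∀ (S : ShortComplex 𝒜) (hS : Conflation S),
    Mono ((R 0).map S.f) ∧ ∀ n : ℕ,
      (haveI := d.additive n; S.map (R n)).Exact ∧
      (ShortComplex.mk _ _ (d.map_comp_δ n S hS)).Exact ∧
      (ShortComplex.mk _ _ (d.δ_comp_map n S hS)).Exact

/-- Universality: a natural transformation in degree `0` to any `δ`-functor (exact or not) extends
uniquely to a morphism of `δ`-functors. -/
def CohomologicalDelta.IsUniversal {R : ℕ → 𝒜 ⥤ 𝒟} (d : CohomologicalDelta R) : Prop :=
  ∀ (R' : ℕ → 𝒜 ⥤ 𝒟) (d' : CohomologicalDelta R') (f₀ : R 0 ⟶ R' 0),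
    ∃! f : ∀ n, R n ⟶ R' n, f 0 = f₀ ∧
      ∀ (n : ℕ) (S : ShortComplex 𝒜) (hS : Conflation S),
        d.δ n S hS ≫ (f (n + 1)).app S.X₁ = (f n).app S.X₃ ≫ d'.δ n S hS

/-- The structure of a homological `δ`-functor on a sequence of functors. -/
structure HomologicalDelta (L : ℕ → 𝒜 ⥤ 𝒟) where
  additive : ∀ n, (L n).Additive
  δ : ∀ (n : ℕ) (S : ShortComplex 𝒜), Conflation S → ((L (n + 1)).obj S.X₃ ⟶ (L n).obj S.X₁)
  δ_naturality : ∀ (n : ℕ) (S S' : ShortComplex 𝒜) (hS : Conflation S) (hS' : Conflation S')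
    (φ : S ⟶ S'), δ n S hS ≫ (L n).map φ.τ₁ = (L (n + 1)).map φ.τ₃ ≫ δ n S' hS'
  map_comp_δ : ∀ (n : ℕ) (S : ShortComplex 𝒜) (hS : Conflation S),
    (L (n + 1)).map S.g ≫ δ n S hS = 0
  δ_comp_map : ∀ (n : ℕ) (S : ShortComplex 𝒜) (hS : Conflation S),
    δ n S hS ≫ (L n).map S.f = 0

/-- Exactness of all the long sequences
`⋯ ⟶ L₁X₂ ⟶ L₁X₃ ⟶ L₀X₁ ⟶ L₀X₂ ⟶ L₀X₃ ⟶ 0`. -/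
def HomologicalDelta.IsExact {L : ℕ → 𝒜 ⥤ 𝒟} (d : HomologicalDelta L) : Prop :=
  ∀ (S : ShortComplex 𝒜) (hS : Conflation S),
    Epi ((L 0).map S.g) ∧ ∀ n : ℕ,
      (haveI := d.additive n; S.map (L n)).Exact ∧
      (ShortComplex.mk _ _ (d.map_comp_δ n S hS)).Exact ∧
      (ShortComplex.mk _ _ (d.δ_comp_map n S hS)).Exact

/-- Universality: a natural transformation in degree `0` from any `δ`-functor (exact or not) extends
uniquely to a morphism of `δ`-functors. -/
def HomologicalDelta.IsUniversal {L : ℕ → 𝒜 ⥤ 𝒟} (d : HomologicalDelta L) : Prop :=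
  ∀ (L' : ℕ → 𝒜 ⥤ 𝒟) (d' : HomologicalDelta L') (f₀ : L' 0 ⟶ L 0),
    ∃! f : ∀ n, L' n ⟶ L n, f 0 = f₀ ∧
      ∀ (n : ℕ) (S : ShortComplex 𝒜) (hS : Conflation S),
        d'.δ n S hS ≫ (f n).app S.X₁ = (f (n + 1)).app S.X₃ ≫ d.δ n S hS

/-- `Rʳ` is computed by arbitrary injective resolutions, which exist: `Rʳ(A) ≅ Hʳ(G(I))`, naturally
with respect to all chain maps of resolutions that lift a morphism. -/
def ComputedByInjectives (G : 𝒜 ⥤ 𝒟) [G.Additive] (R : ℕ → 𝒜 ⥤ 𝒟) : Prop :=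
  (∀ A : 𝒜, Nonempty (InjectiveRes A)) ∧
  ∃ e : ∀ (A : 𝒜) (I : InjectiveRes A) (r : ℕ),
      (R r).obj A ≅ ((G.mapHomologicalComplex (ComplexShape.up ℕ)).obj I.I).homology r,
    ∀ (A A' : 𝒜) (f : A ⟶ A') (I : InjectiveRes A) (I' : InjectiveRes A') (φ : I.I ⟶ I'.I),
      I.Lifts f I' φ → ∀ r : ℕ,
        (R r).map f ≫ (e A' I' r).hom = (e A I r).hom ≫
          HomologicalComplex.homologyMap
            ((G.mapHomologicalComplex (ComplexShape.up ℕ)).map φ) r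

/-- `Lᵣ` is computed by arbitrary projective resolutions, which exist: `Lᵣ(A) ≅ Hᵣ(G(P))`, naturally
with respect to all chain maps of resolutions that lift a morphism. -/
def ComputedByProjectives (G : 𝒜 ⥤ 𝒟) [G.Additive] (L : ℕ → 𝒜 ⥤ 𝒟) : Prop :=
  (∀ A : 𝒜, Nonempty (ProjectiveRes A)) ∧
  ∃ e : ∀ (A : 𝒜) (P : ProjectiveRes A) (r : ℕ),
      (L r).obj A ≅ ((G.mapHomologicalComplex (ComplexShape.down ℕ)).obj P.P).homology r,
    ∀ (A A' : 𝒜) (f : A ⟶ A') (P : ProjectiveRes A) (P' : ProjectiveRes A') (φ : P.P ⟶ P'.P),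
      P.Lifts f P' φ → ∀ r : ℕ,
        (L r).map f ≫ (e A' P' r).hom = (e A P r).hom ≫
          HomologicalComplex.homologyMap
            ((G.mapHomologicalComplex (ComplexShape.down ℕ)).map φ) r

/-- `R` is the universal right derived `δ`-functor of `G`. -/
def IsRightDerived (G : 𝒜 ⥤ 𝒟) [G.Additive] (R : ℕ → 𝒜 ⥤ 𝒟) : Prop :=
  Nonempty (R 0 ≅ G) ∧ (∃ d : CohomologicalDelta R, d.IsExact ∧ d.IsUniversal) ∧
    ComputedByInjectives G R

/-- `L` is the universal left derived `δ`-functor of `G`. -/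
def IsLeftDerived (G : 𝒜 ⥤ 𝒟) [G.Additive] (L : ℕ → 𝒜 ⥤ 𝒟) : Prop :=
  Nonempty (L 0 ≅ G) ∧ (∃ d : HomologicalDelta L, d.IsExact ∧ d.IsUniversal) ∧
    ComputedByProjectives G L

end Delta

/-! ### Bifunctors

A bifunctor is a functor `F : 𝒜 ⥤ ℬ ⥤ 𝒟`.  In its first variable it is a functor from `𝒜` to the
abelian category `ℬ ⥤ 𝒟`, in which kernels, cokernels and exactness are pointwise; in its second
variable it is `F.flip : ℬ ⥤ 𝒜 ⥤ 𝒟`.  A contravariant variable is a variable in an opposite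
category: a conflation in `𝒞ᵒᵖ` is a reversed conflation of `𝒞`, and an injective resolution in
`𝒞ᵒᵖ` is a projective resolution in `𝒞`. -/

section Bifunctor

variable {𝒜 : Type u₁} [Category.{v₁} 𝒜] [Preadditive 𝒜]
variable {ℬ : Type u₂} [Category.{v₂} ℬ] [Preadditive ℬ]
variable {𝒟 : Type u₃} [Category.{v₃} 𝒟] [Abelian 𝒟]

instance flip_additive (F : 𝒜 ⥤ ℬ ⥤ 𝒟) [∀ A, (F.obj A).Additive] : F.flip.Additive where
  map_add {_ _ _ _} := by
    ext A
    exact (F.obj A).map_add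

instance flip_obj_additive (F : 𝒜 ⥤ ℬ ⥤ 𝒟) [F.Additive] (B : ℬ) :
    (F.flip.obj B).Additive where
  map_add {_ _ f g} := by
    change (F.map (f + g)).app B = (F.map f).app B + (F.map g).app B
    rw [F.map_add]
    rfl

/-- The bifunctor `(M, N) ↦ Hom(M, N)`, contravariant in `M`. -/
abbrev homBifunctor (𝒞 : Type u₁) [Category.{v₁} 𝒞] [Preadditive 𝒞] :
    𝒞ᵒᵖ ⥤ 𝒞 ⥤ AddCommGrpCat.{v₁} := preadditiveCoyoneda

instance homBifunctor_additive (𝒞 : Type u₁) [Category.{v₁} 𝒞] [Preadditive 𝒞] :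
    (homBifunctor 𝒞).Additive where
  map_add {_ _ _ _} := by
    ext N g
    exact Preadditive.add_comp _ _ _ _ _ _

/-- The signs for total complexes of first quadrant double cochain complexes. -/
instance tensorSignsUp : ComplexShape.TensorSigns (ComplexShape.up ℕ) where
  ε' := MonoidHom.mk' (fun i : ℕ => (-1 : ℤˣ) ^ i) (pow_add (-1 : ℤˣ))
  rel_add p q r (hpq : p + 1 = q) := by
    change p + r + 1 = q + r
    omega
  add_rel p q r (hpq : p + 1 = q) := by
    change r + p + 1 = r + q
    omega
  ε'_succ := by
    rintro p _ rfl
    change (-1 : ℤˣ) ^ (p + 1) = -((-1 : ℤˣ) ^ p)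
    rw [pow_succ, mul_neg, mul_one]

/-- `Rʳ(A, B) ≅ Hʳ(Tot F(I, J))` for arbitrary injective resolutions `I` of `A` and `J` of `B`,
naturally with respect to all chain maps of resolutions that lift morphisms. -/
def ComputedByTotalInjectives (F : 𝒜 ⥤ ℬ ⥤ AddCommGrpCat.{u})
    [F.Additive] [∀ A, (F.obj A).Additive] (R : ℕ → 𝒜 ⥤ ℬ ⥤ AddCommGrpCat.{u}) : Prop :=
  (∀ A : 𝒜, Nonempty (InjectiveRes A)) ∧ (∀ B : ℬ, Nonempty (InjectiveRes B)) ∧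
  ∃ e : ∀ (A : 𝒜) (B : ℬ) (I : InjectiveRes A) (J : InjectiveRes B) (r : ℕ),
      ((R r).obj A).obj B ≅
        (HomologicalComplex.mapBifunctor I.I J.I F (ComplexShape.up ℕ)).homology r,
    ∀ (A A' : 𝒜) (B B' : ℬ) (f : A ⟶ A') (g : B ⟶ B')
      (I : InjectiveRes A) (I' : InjectiveRes A') (J : InjectiveRes B) (J' : InjectiveRes B')
      (φ : I.I ⟶ I'.I) (ψ : J.I ⟶ J'.I), I.Lifts f I' φ → J.Lifts g J' ψ → ∀ r : ℕ,
        (((R r).map f).app B ≫ ((R r).obj A').map g) ≫ (e A' B' I' J' r).hom =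
          (e A B I J r).hom ≫ HomologicalComplex.homologyMap
            (HomologicalComplex.mapBifunctorMap φ ψ F (ComplexShape.up ℕ)) r

/-- `Lᵣ(A, B) ≅ Hᵣ(Tot F(P, Q))` for arbitrary projective resolutions `P` of `A` and `Q` of `B`,
naturally with respect to all chain maps of resolutions that lift morphisms. -/
def ComputedByTotalProjectives (F : 𝒜 ⥤ ℬ ⥤ AddCommGrpCat.{u})
    [F.Additive] [∀ A, (F.obj A).Additive] (L : ℕ → 𝒜 ⥤ ℬ ⥤ AddCommGrpCat.{u}) : Prop :=
  (∀ A : 𝒜, Nonempty (ProjectiveRes A)) ∧ (∀ B : ℬ, Nonempty (ProjectiveRes B)) ∧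
  ∃ e : ∀ (A : 𝒜) (B : ℬ) (P : ProjectiveRes A) (Q : ProjectiveRes B) (r : ℕ),
      ((L r).obj A).obj B ≅
        (HomologicalComplex.mapBifunctor P.P Q.P F (ComplexShape.down ℕ)).homology r,
    ∀ (A A' : 𝒜) (B B' : ℬ) (f : A ⟶ A') (g : B ⟶ B')
      (P : ProjectiveRes A) (P' : ProjectiveRes A') (Q : ProjectiveRes B) (Q' : ProjectiveRes B')
      (φ : P.P ⟶ P'.P) (ψ : Q.P ⟶ Q'.P), P.Lifts f P' φ → Q.Lifts g Q' ψ → ∀ r : ℕ,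
        (((L r).map f).app B ≫ ((L r).obj A').map g) ≫ (e A' B' P' Q' r).hom =
          (e A B P Q r).hom ≫ HomologicalComplex.homologyMap
            (HomologicalComplex.mapBifunctorMap φ ψ F (ComplexShape.down ℕ)) r

/-- `R` is the total right derived bifunctor of `F`: a `δ`-functor with exact long sequences in each
of the two variables, which is universal in a variable as soon as `F` is exact in the other
variable when injective objects are inserted in this one. -/
def IsTotalRightDerived (F : 𝒜 ⥤ ℬ ⥤ AddCommGrpCat.{u})
    [F.Additive] [∀ A, (F.obj A).Additive] (R : ℕ → 𝒜 ⥤ ℬ ⥤ AddCommGrpCat.{u}) : Prop :=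
  Nonempty (R 0 ≅ F) ∧
  (∃ d : CohomologicalDelta R, d.IsExact ∧
    ((∀ I : 𝒜, AdmissibleInjective I → IsExactFunctor (F.obj I)) → d.IsUniversal)) ∧
  (∃ d : CohomologicalDelta (fun r => (R r).flip), d.IsExact ∧
    ((∀ J : ℬ, AdmissibleInjective J → IsExactFunctor (F.flip.obj J)) → d.IsUniversal)) ∧
  ComputedByTotalInjectives F R

/-- `L` is the total left derived bifunctor of `F`: a `δ`-functor with exact long sequences in each
of the two variables, which is universal in a variable as soon as `F` is exact in the other
variable when projective objects are inserted in this one. -/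
def IsTotalLeftDerived (F : 𝒜 ⥤ ℬ ⥤ AddCommGrpCat.{u})
    [F.Additive] [∀ A, (F.obj A).Additive] (L : ℕ → 𝒜 ⥤ ℬ ⥤ AddCommGrpCat.{u}) : Prop :=
  Nonempty (L 0 ≅ F) ∧
  (∃ d : HomologicalDelta L, d.IsExact ∧
    ((∀ P : 𝒜, AdmissibleProjective P → IsExactFunctor (F.obj P)) → d.IsUniversal)) ∧
  (∃ d : HomologicalDelta (fun r => (L r).flip), d.IsExact ∧
    ((∀ Q : ℬ, AdmissibleProjective Q → IsExactFunctor (F.flip.obj Q)) → d.IsUniversal)) ∧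
  ComputedByTotalProjectives F L

/-- The biadditive bifunctor `F` has right derived bifunctors: the universal right derived
`δ`-functor in the first variable, the one in the second variable, and the total one. -/
def HasRightDerivedBifunctors (F : 𝒜 ⥤ ℬ ⥤ AddCommGrpCat.{u})
    [F.Additive] [∀ A, (F.obj A).Additive] : Prop :=
  (∃ R : ℕ → 𝒜 ⥤ ℬ ⥤ AddCommGrpCat.{u},
    IsRightDerived F R ∧ ∀ r A, ((R r).obj A).Additive) ∧
  (∃ R : ℕ → ℬ ⥤ 𝒜 ⥤ AddCommGrpCat.{u},
    IsRightDerived F.flip R ∧ ∀ r B, ((R r).obj B).Additive) ∧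
  (∃ R : ℕ → 𝒜 ⥤ ℬ ⥤ AddCommGrpCat.{u}, IsTotalRightDerived F R)

/-- The biadditive bifunctor `F` has left derived bifunctors: the universal left derived
`δ`-functor in the first variable, the one in the second variable, and the total one. -/
def HasLeftDerivedBifunctors (F : 𝒜 ⥤ ℬ ⥤ AddCommGrpCat.{u})
    [F.Additive] [∀ A, (F.obj A).Additive] : Prop :=
  (∃ L : ℕ → 𝒜 ⥤ ℬ ⥤ AddCommGrpCat.{u},
    IsLeftDerived F L ∧ ∀ r A, ((L r).obj A).Additive) ∧
  (∃ L : ℕ → ℬ ⥤ 𝒜 ⥤ AddCommGrpCat.{u},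
    IsLeftDerived F.flip L ∧ ∀ r B, ((L r).obj B).Additive) ∧
  (∃ L : ℕ → 𝒜 ⥤ ℬ ⥤ AddCommGrpCat.{u}, IsTotalLeftDerived F L)

variable (𝒜 ℬ) in
/-- Existence of derived bifunctors of all additive bifunctors that are left exact in each
variable, and of all those that are right exact in each variable. -/
def DerivedBifunctorsExist : Prop :=
  (∀ (F : 𝒜 ⥤ ℬ ⥤ AddCommGrpCat.{u}) [F.Additive] [∀ A, (F.obj A).Additive],
    IsLeftExact F → IsLeftExact F.flip → HasRightDerivedBifunctors F) ∧
  (∀ (F : 𝒜 ⥤ ℬ ⥤ AddCommGrpCat.{u}) [F.Additive] [∀ A, (F.obj A).Additive],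
    IsRightExact F → IsRightExact F.flip → HasLeftDerivedBifunctors F)

end Bifunctor

end NaryGamma

end

/-!
The category of bi-`Γ`-modules is the category of modules over a ring: the free ring on symbols for
the positional actions, modulo the axioms (`BiModule.EnvelopingRing`, `BiModule.toModule`).  Hence
it is abelian with enough injectives and projectives, the admissible short exact sequences are the
short exact ones, and the theorem reduces to abelian categories
(`NaryGamma.derivedBifunctorsExist`).

A bifunctor `F : 𝒜 ⥤ ℬ ⥤ 𝒟` is treated as a functor from `𝒜` to the abelian category `ℬ ⥤ 𝒟`, so
that its derived functors in one variable are those of Mathlib.  The total derived bifunctors are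
the homology of the total complex of `F(I, J)`, where `I` and `J` are given by the functors of
resolutions with values in the homotopy categories (`totalHomology`, `totalDerived`).  Their
independence of the resolutions and their naturality follow from the invariance of the total complex
under homotopies.

Mathlib's derived functors come without connecting morphisms.  Both kinds of derived functors are
composites of the functor of resolutions with functors `H i` on the homotopy category that have
connecting morphisms for degreewise split sequences of complexes (`SplitDelta`).  For the homology
of `G(I)` and of the total complex these are the usual ones, since degreewise splittings are
preserved (`homologyOfMapDelta`, `totalHomologyDelta`).  The horseshoe lemma represents short exact
sequences by degreewise split sequences of complexes, in such a way that morphisms of sequences lift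
(`SequenceResolution`).  It is proved by resolving a short exact sequence as an object of the
category of short complexes, in which the split sequences of injective objects are injective.

An exact `δ`-functor is universal if it vanishes on injective, or projective, objects in positive
degrees (`CohomologicalDelta.isUniversal`, `HomologicalDelta.isUniversal`).  For total derived
bifunctors the vanishing holds if `F(I, -)` is exact for injective `I`, because `I` is
its own resolution (`isZero_totalRightDerived_left`).  In degree `0`, left exactness in
each variable identifies `F(A, B)` with the cycles of the total complex (`isIso_totalAugmentation`).

`Hom` is left exact in each variable, `Hom(P, -)` is exact for projective `P` and `Hom(-, J)` for
injective `J`; so the total derived bifunctors of `Hom` are universal in each variable and agree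
with the derived functors in one variable (`isRightDerived_totalRightDerived`).  The positional
tensor product is right exact in each variable, since the usual tensor product is and since the
relations by which it is divided lift along surjections (`BiModule.tensorRel_le_map`).
-/

noncomputable section

namespace NaryGamma

/-! ### Exactness in functor categories -/

section FunctorCategory

variable {ℬ : Type*} [Category* ℬ] {𝒟 : Type*} [Category* 𝒟] [Abelian 𝒟]

theorem exact_iff_forall_evaluation (S : ShortComplex (ℬ ⥤ 𝒟)) :
    S.Exact ↔ ∀ B, (S.map ((evaluation ℬ 𝒟).obj B)).Exact := by
  refine ⟨fun h B => h.map _, fun h => ?_⟩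
  rw [S.exact_iff_isZero_homology, Functor.isZero_iff]
  intro B
  exact (((S.map ((evaluation ℬ 𝒟).obj B)).exact_iff_isZero_homology).1 (h B)).of_iso
    (S.mapHomologyIso ((evaluation ℬ 𝒟).obj B)).symm

end FunctorCategory

/-! ### Connecting morphisms for degreewise split sequences of complexes -/

section SplitDelta

variable {𝒜 : Type*} [Category* 𝒜] [Preadditive 𝒜] {𝒟 : Type*} [Category* 𝒟] [Abelian 𝒟]
variable {ι : Type*} {c : ComplexShape ι}

/-- Sequences of complexes that split in each degree. -/
def DegreewiseSplit (T : ShortComplex (HomologicalComplex 𝒜 c)) : Prop :=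
  ∀ i, Nonempty (T.map (HomologicalComplex.eval 𝒜 c i)).Splitting

/-- Connecting morphisms which make a family of functors on the homotopy category of complexes into
an exact `δ`-functor on the degreewise split short exact sequences of complexes.  The degrees are
those of the complex shape, so that this covers both the cohomological and the homological case;
`mono` and `epi` describe the ends of the long exact sequences. -/
structure SplitDelta (H : ι → HomotopyCategory 𝒜 c ⥤ 𝒟) [∀ i, (H i).Additive] where
  δ : ∀ (i j : ι) (_ : c.Rel i j) (T : ShortComplex (HomologicalComplex 𝒜 c))
    (_ : DegreewiseSplit T), (H i).obj ((HomotopyCategory.quotient 𝒜 c).obj T.X₃) ⟶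
      (H j).obj ((HomotopyCategory.quotient 𝒜 c).obj T.X₁)
  naturality : ∀ (i j : ι) (hij : c.Rel i j) (T T' : ShortComplex (HomologicalComplex 𝒜 c))
    (hT : DegreewiseSplit T) (hT' : DegreewiseSplit T') (φ : T ⟶ T'),
    δ i j hij T hT ≫ (H j).map ((HomotopyCategory.quotient 𝒜 c).map φ.τ₁) =
      (H i).map ((HomotopyCategory.quotient 𝒜 c).map φ.τ₃) ≫ δ i j hij T' hT'
  map_comp_δ : ∀ (i j : ι) (hij : c.Rel i j) (T : ShortComplex (HomologicalComplex 𝒜 c))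
    (hT : DegreewiseSplit T),
    (H i).map ((HomotopyCategory.quotient 𝒜 c).map T.g) ≫ δ i j hij T hT = 0
  δ_comp_map : ∀ (i j : ι) (hij : c.Rel i j) (T : ShortComplex (HomologicalComplex 𝒜 c))
    (hT : DegreewiseSplit T),
    δ i j hij T hT ≫ (H j).map ((HomotopyCategory.quotient 𝒜 c).map T.f) = 0
  exact₁ : ∀ (i j : ι) (hij : c.Rel i j) (T : ShortComplex (HomologicalComplex 𝒜 c))
    (hT : DegreewiseSplit T), (ShortComplex.mk _ _ (δ_comp_map i j hij T hT)).Exact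
  exact₂ : ∀ (i : ι) (T : ShortComplex (HomologicalComplex 𝒜 c)), DegreewiseSplit T →
    (T.map (HomotopyCategory.quotient 𝒜 c ⋙ H i)).Exact
  exact₃ : ∀ (i j : ι) (hij : c.Rel i j) (T : ShortComplex (HomologicalComplex 𝒜 c))
    (hT : DegreewiseSplit T), (ShortComplex.mk _ _ (map_comp_δ i j hij T hT)).Exact
  mono : ∀ j : ι, (∀ i, ¬ c.Rel i j) → ∀ T : ShortComplex (HomologicalComplex 𝒜 c),
    DegreewiseSplit T → Mono ((H j).map ((HomotopyCategory.quotient 𝒜 c).map T.f))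
  epi : ∀ i : ι, (∀ j, ¬ c.Rel i j) → ∀ T : ShortComplex (HomologicalComplex 𝒜 c),
    DegreewiseSplit T → Epi ((H i).map ((HomotopyCategory.quotient 𝒜 c).map T.g))

theorem mono_homologyMap_of_shortExact {S : ShortComplex (HomologicalComplex 𝒟 c)}
    (hS : S.ShortExact) (j : ι) (hj : ∀ i, ¬ c.Rel i j) :
    Mono (HomologicalComplex.homologyMap S.f j) := by
  have := hS.mono_f
  have h1 : Mono (HomologicalComplex.cyclesMap S.f j) := inferInstance
  have hz : ∀ K : HomologicalComplex 𝒟 c, IsIso (K.homologyπ j) := fun K =>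
    K.isIso_homologyπ _ j rfl (K.shape _ _ (hj _))
  have := hz S.X₁
  have := hz S.X₂
  have e : HomologicalComplex.homologyMap S.f j =
      inv (S.X₁.homologyπ j) ≫ HomologicalComplex.cyclesMap S.f j ≫ S.X₂.homologyπ j := by
    rw [IsIso.eq_inv_comp, HomologicalComplex.homologyπ_naturality]
  rw [e]
  infer_instance

theorem epi_homologyMap_of_shortExact {S : ShortComplex (HomologicalComplex 𝒟 c)}
    (hS : S.ShortExact) (i : ι) (hi : ∀ j, ¬ c.Rel i j) :
    Epi (HomologicalComplex.homologyMap S.g i) := by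
  have := hS.epi_g
  have h1 : Epi (HomologicalComplex.opcyclesMap S.g i) := inferInstance
  have hz : ∀ K : HomologicalComplex 𝒟 c, IsIso (K.homologyι i) := fun K =>
    K.isIso_homologyι i _ rfl (K.shape _ _ (hi _))
  have := hz S.X₂
  have := hz S.X₃
  have e : HomologicalComplex.homologyMap S.g i =
      S.X₂.homologyι i ≫ HomologicalComplex.opcyclesMap S.g i ≫ inv (S.X₃.homologyι i) := by
    rw [← Category.assoc, IsIso.eq_comp_inv, HomologicalComplex.homologyι_naturality]
  rw [e]
  infer_instance

/-- The homology of complexes `Φ(K)`, for a functor `Φ`, has connecting morphisms if `Φ` sends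
degreewise split sequences to short exact sequences of complexes. -/
def SplitDelta.ofComplexes (H : ι → HomotopyCategory 𝒜 c ⥤ 𝒟) [∀ i, (H i).Additive]
    (Φ : HomologicalComplex 𝒜 c ⥤ HomologicalComplex 𝒟 c) [Φ.PreservesZeroMorphisms]
    (hΦ : ∀ T, DegreewiseSplit T → (T.map Φ).ShortExact)
    (e : ∀ i K, (H i).obj ((HomotopyCategory.quotient 𝒜 c).obj K) ≅ (Φ.obj K).homology i)
    (nat : ∀ i {K L : HomologicalComplex 𝒜 c} (f : K ⟶ L),
      (H i).map ((HomotopyCategory.quotient 𝒜 c).map f) ≫ (e i L).hom =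
        (e i K).hom ≫ HomologicalComplex.homologyMap (Φ.map f) i) : SplitDelta H := by
  have nat' : ∀ i {K L : HomologicalComplex 𝒜 c} (f : K ⟶ L),
      (H i).map ((HomotopyCategory.quotient 𝒜 c).map f) =
        (e i K).hom ≫ HomologicalComplex.homologyMap (Φ.map f) i ≫ (e i L).inv :=
    fun i K L f => by rw [← Category.assoc, ← nat i f, Category.assoc, Iso.hom_inv_id,
      Category.comp_id]
  let d : ∀ (i j : ι) (_ : c.Rel i j) (T : ShortComplex (HomologicalComplex 𝒜 c))
    (_ : DegreewiseSplit T), (Φ.obj T.X₃).homology i ⟶ (Φ.obj T.X₁).homology j :=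
    fun i j hij T hT => (hΦ T hT).δ i j hij
  have hd : ∀ (i j : ι) (hij : c.Rel i j) (T T' : ShortComplex (HomologicalComplex 𝒜 c))
    (hT : DegreewiseSplit T) (hT' : DegreewiseSplit T') (φ : T ⟶ T'),
      d i j hij T hT ≫ HomologicalComplex.homologyMap (Φ.map φ.τ₁) j =
        HomologicalComplex.homologyMap (Φ.map φ.τ₃) i ≫ d i j hij T' hT' :=
    fun i j hij T T' hT hT' φ => HomologicalComplex.HomologySequence.δ_naturality
      (Φ.mapShortComplex.map φ) (hΦ T hT) (hΦ T' hT') i j hij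
  have d₁ : ∀ (i j : ι) (hij : c.Rel i j) (T : ShortComplex (HomologicalComplex 𝒜 c))
    (hT : DegreewiseSplit T), d i j hij T hT ≫ HomologicalComplex.homologyMap (Φ.map T.f) j = 0 :=
    fun i j hij T hT => (hΦ T hT).δ_comp i j hij
  have d₂ : ∀ (i j : ι) (hij : c.Rel i j) (T : ShortComplex (HomologicalComplex 𝒜 c))
    (hT : DegreewiseSplit T), HomologicalComplex.homologyMap (Φ.map T.g) i ≫ d i j hij T hT = 0 :=
    fun i j hij T hT => (hΦ T hT).comp_δ i j hij
  exact
  { δ := fun i j hij T hT => (e i T.X₃).hom ≫ d i j hij T hT ≫ (e j T.X₁).inv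
    naturality := fun i j hij T T' hT hT' φ => by
      rw [nat', nat']
      simp only [Category.assoc, Iso.inv_hom_id_assoc]
      rw [reassoc_of% (hd i j hij T T' hT hT' φ)]
    map_comp_δ := fun i j hij T hT => by
      rw [nat']
      simp only [Category.assoc, Iso.inv_hom_id_assoc]
      rw [reassoc_of% (d₂ i j hij T hT), zero_comp, comp_zero]
    δ_comp_map := fun i j hij T hT => by
      rw [nat']
      simp only [Category.assoc, Iso.inv_hom_id_assoc]
      rw [reassoc_of% (d₁ i j hij T hT), zero_comp, comp_zero]
    exact₁ := fun i j hij T hT => by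
      refine ShortComplex.exact_of_iso ?_ ((hΦ T hT).homology_exact₁ i j hij)
      refine ShortComplex.isoMk (e i T.X₃).symm (e j T.X₁).symm (e j T.X₂).symm ?_ ?_
      · exact Iso.inv_hom_id_assoc _ _
      · refine ((e j _).inv_comp_eq.2 ?_)
        exact nat' j T.f
    exact₂ := fun i T hT => by
      refine ShortComplex.exact_of_iso ?_ ((hΦ T hT).homology_exact₂ i)
      refine ShortComplex.isoMk (e i T.X₁).symm (e i T.X₂).symm (e i T.X₃).symm ?_ ?_
      · exact ((e i _).inv_comp_eq.2 (nat' i T.f))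
      · exact ((e i _).inv_comp_eq.2 (nat' i T.g))
    exact₃ := fun i j hij T hT => by
      refine ShortComplex.exact_of_iso ?_ ((hΦ T hT).homology_exact₃ i j hij)
      refine ShortComplex.isoMk (e i T.X₂).symm (e i T.X₃).symm (e j T.X₁).symm ?_ ?_
      · exact ((e i _).inv_comp_eq.2 (nat' i T.g))
      · exact Iso.inv_hom_id_assoc _ _
    mono := fun j hj T hT => by
      have : Mono (HomologicalComplex.homologyMap (Φ.map T.f) j) :=
        mono_homologyMap_of_shortExact (hΦ T hT) j hj
      rw [nat']
      infer_instance
    epi := fun i hi T hT => by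
      have : Epi (HomologicalComplex.homologyMap (Φ.map T.g) i) :=
        epi_homologyMap_of_shortExact (hΦ T hT) i hi
      rw [nat']
      infer_instance }

/-- Connecting morphisms may be composed with an exact functor. -/
def SplitDelta.comp {H : ι → HomotopyCategory 𝒜 c ⥤ 𝒟} [∀ i, (H i).Additive] (D : SplitDelta H)
    {ℰ : Type*} [Category* ℰ] [Abelian ℰ] (E : 𝒟 ⥤ ℰ) [E.Additive] [PreservesFiniteLimits E]
    [PreservesFiniteColimits E] : SplitDelta (fun i => H i ⋙ E) where
  δ i j hij T hT := E.map (D.δ i j hij T hT)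
  naturality i j hij T T' hT hT' φ := (E.map_comp _ _).symm.trans
    ((congrArg E.map (D.naturality i j hij T T' hT hT' φ)).trans (E.map_comp _ _))
  map_comp_δ i j hij T hT := (E.map_comp _ _).symm.trans
    ((congrArg E.map (D.map_comp_δ i j hij T hT)).trans (E.map_zero _ _))
  δ_comp_map i j hij T hT := (E.map_comp _ _).symm.trans
    ((congrArg E.map (D.δ_comp_map i j hij T hT)).trans (E.map_zero _ _))
  exact₁ i j hij T hT := (D.exact₁ i j hij T hT).map E
  exact₂ i T hT := (D.exact₂ i T hT).map E
  exact₃ i j hij T hT := (D.exact₃ i j hij T hT).map E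
  mono j hj T hT := by
    have := D.mono j hj T hT
    exact inferInstanceAs (Mono (E.map _))
  epi i hi T hT := by
    have := D.epi i hi T hT
    exact inferInstanceAs (Epi (E.map _))

/-- Connecting morphisms of functors with values in a functor category may be given pointwise. -/
def SplitDelta.ofPointwise {𝒬 : Type*} [Category* 𝒬] (H : ι → HomotopyCategory 𝒜 c ⥤ 𝒬 ⥤ 𝒟)
    [∀ i, (H i).Additive] (D : ∀ p, SplitDelta (fun i => H i ⋙ (evaluation 𝒬 𝒟).obj p))
    (nat : ∀ {p q : 𝒬} (f : p ⟶ q) (i j : ι) (hij : c.Rel i j)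
      (T : ShortComplex (HomologicalComplex 𝒜 c)) (hT : DegreewiseSplit T),
      (((H i).obj ((HomotopyCategory.quotient 𝒜 c).obj T.X₃)).map f) ≫ (D q).δ i j hij T hT =
        (D p).δ i j hij T hT ≫ (((H j).obj ((HomotopyCategory.quotient 𝒜 c).obj T.X₁)).map f)) :
    SplitDelta H where
  δ i j hij T hT :=
    { app := fun p => (D p).δ i j hij T hT
      naturality := fun _ _ f => nat f i j hij T hT }
  naturality i j hij T T' hT hT' φ := by
    ext p
    exact (D p).naturality i j hij T T' hT hT' φ
  map_comp_δ i j hij T hT := by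
    ext p
    exact (D p).map_comp_δ i j hij T hT
  δ_comp_map i j hij T hT := by
    ext p
    exact (D p).δ_comp_map i j hij T hT
  exact₁ i j hij T hT :=
    (exact_iff_forall_evaluation _).2 fun p => (D p).exact₁ i j hij T hT
  exact₂ i T hT := (exact_iff_forall_evaluation _).2 fun p => (D p).exact₂ i T hT
  exact₃ i j hij T hT :=
    (exact_iff_forall_evaluation _).2 fun p => (D p).exact₃ i j hij T hT
  mono j hj T hT := (NatTrans.mono_iff_mono_app _).2 fun p => (D p).mono j hj T hT
  epi i hi T hT := (NatTrans.epi_iff_epi_app _).2 fun p => (D p).epi i hi T hT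

end SplitDelta

/-! ### Connecting morphisms of derived functors -/

section ResolvedDelta

variable {𝒜 : Type*} [Category* 𝒜] [Preadditive 𝒜] {𝒟 : Type*} [Category* 𝒟] [Abelian 𝒟]
variable {ι : Type*} {c : ComplexShape ι}

/-- A functor `r` to the homotopy category of complexes, together with a simultaneous choice of
degreewise split sequences of complexes that represent `r` on the admissible short exact
sequences, such that morphisms of sequences lift. -/
structure SequenceResolution (r : 𝒜 ⥤ HomotopyCategory 𝒜 c) [r.Additive] where
  res : ∀ S : ShortComplex 𝒜, Conflation S → ShortComplex (HomologicalComplex 𝒜 c)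
  split : ∀ S hS, DegreewiseSplit (res S hS)
  e : ∀ S hS, S.map r ≅ (res S hS).map (HomotopyCategory.quotient 𝒜 c)
  lift : ∀ (S S' : ShortComplex 𝒜) (hS : Conflation S) (hS' : Conflation S') (φ : S ⟶ S'),
    ∃ ψ : res S hS ⟶ res S' hS', r.mapShortComplex.map φ ≫ (e S' hS').hom =
      (e S hS).hom ≫ (HomotopyCategory.quotient 𝒜 c).mapShortComplex.map ψ

namespace SequenceResolution

variable {r : 𝒜 ⥤ HomotopyCategory 𝒜 c} [r.Additive] (ρ : SequenceResolution r)
variable {H : ι → HomotopyCategory 𝒜 c ⥤ 𝒟} [∀ i, (H i).Additive] (D : SplitDelta H)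
variable (S : ShortComplex 𝒜) (hS : Conflation S)

/-- The first component of the isomorphism of sequences `ρ.e S hS`. -/
def e₁ : r.obj S.X₁ ≅ (HomotopyCategory.quotient 𝒜 c).obj (ρ.res S hS).X₁ :=
  ShortComplex.π₁.mapIso (ρ.e S hS)

/-- The middle component of the isomorphism of sequences `ρ.e S hS`. -/
def e₂ : r.obj S.X₂ ≅ (HomotopyCategory.quotient 𝒜 c).obj (ρ.res S hS).X₂ :=
  ShortComplex.π₂.mapIso (ρ.e S hS)

/-- The third component of the isomorphism of sequences `ρ.e S hS`. -/
def e₃ : r.obj S.X₃ ≅ (HomotopyCategory.quotient 𝒜 c).obj (ρ.res S hS).X₃ :=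
  ShortComplex.π₃.mapIso (ρ.e S hS)

theorem map_f : r.map S.f ≫ (ρ.e₂ S hS).hom =
    (ρ.e₁ S hS).hom ≫ (HomotopyCategory.quotient 𝒜 c).map (ρ.res S hS).f :=
  (ρ.e S hS).hom.comm₁₂.symm

theorem map_g : r.map S.g ≫ (ρ.e₃ S hS).hom =
    (ρ.e₂ S hS).hom ≫ (HomotopyCategory.quotient 𝒜 c).map (ρ.res S hS).g :=
  (ρ.e S hS).hom.comm₂₃.symm

/-- The connecting morphism of the functors `r ⋙ H i`. -/
def δ (i j : ι) (hij : c.Rel i j) : (r ⋙ H i).obj S.X₃ ⟶ (r ⋙ H j).obj S.X₁ :=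
  (H i).map (ρ.e₃ S hS).hom ≫ D.δ i j hij _ (ρ.split S hS) ≫ (H j).map (ρ.e₁ S hS).inv

theorem δ_naturality {S' : ShortComplex 𝒜} (hS' : Conflation S') (φ : S ⟶ S') (i j : ι)
    (hij : c.Rel i j) : ρ.δ D S hS i j hij ≫ (r ⋙ H j).map φ.τ₁ =
      (r ⋙ H i).map φ.τ₃ ≫ ρ.δ D S' hS' i j hij := by
  obtain ⟨ψ, hψ⟩ := ρ.lift S S' hS hS' φ
  have h₁ : r.map φ.τ₁ ≫ (ρ.e₁ S' hS').hom =
      (ρ.e₁ S hS).hom ≫ (HomotopyCategory.quotient 𝒜 c).map ψ.τ₁ :=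
    congrArg ShortComplex.Hom.τ₁ hψ
  have h₃ : r.map φ.τ₃ ≫ (ρ.e₃ S' hS').hom =
      (ρ.e₃ S hS).hom ≫ (HomotopyCategory.quotient 𝒜 c).map ψ.τ₃ :=
    congrArg ShortComplex.Hom.τ₃ hψ
  have h₁' : (ρ.e₁ S hS).inv ≫ r.map φ.τ₁ =
      (HomotopyCategory.quotient 𝒜 c).map ψ.τ₁ ≫ (ρ.e₁ S' hS').inv := by
    rw [Iso.inv_comp_eq, ← Category.assoc, Iso.eq_comp_inv, h₁]
  have h := D.naturality i j hij _ _ (ρ.split S hS) (ρ.split S' hS') ψ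
  simp only [δ, Functor.comp_map, Category.assoc]
  rw [← (H j).map_comp, h₁', (H j).map_comp, reassoc_of% h, ← (H i).map_comp_assoc (r.map φ.τ₃), h₃,
    (H i).map_comp_assoc]

theorem map_comp_δ (i j : ι) (hij : c.Rel i j) :
    (r ⋙ H i).map S.g ≫ ρ.δ D S hS i j hij = 0 := by
  simp only [δ, Functor.comp_map]
  rw [← (H i).map_comp_assoc (r.map S.g), map_g, (H i).map_comp_assoc,
    ← Category.assoc ((H i).map ((HomotopyCategory.quotient 𝒜 c).map _)),
    D.map_comp_δ i j hij _ (ρ.split S hS), zero_comp, comp_zero]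

theorem inv_comp_map_f : (ρ.e₁ S hS).inv ≫ r.map S.f =
    (HomotopyCategory.quotient 𝒜 c).map (ρ.res S hS).f ≫ (ρ.e₂ S hS).inv := by
  rw [Iso.inv_comp_eq, ← Category.assoc, Iso.eq_comp_inv, map_f]

theorem δ_comp_map (i j : ι) (hij : c.Rel i j) :
    ρ.δ D S hS i j hij ≫ (r ⋙ H j).map S.f = 0 := by
  simp only [δ, Functor.comp_map, Category.assoc]
  rw [← (H j).map_comp, inv_comp_map_f, (H j).map_comp,
    ← Category.assoc (D.δ i j hij _ (ρ.split S hS)),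
    D.δ_comp_map i j hij _ (ρ.split S hS), zero_comp, comp_zero]

theorem exact₁ (i j : ι) (hij : c.Rel i j) :
    (ShortComplex.mk _ _ (ρ.δ_comp_map D S hS i j hij)).Exact := by
  refine ShortComplex.exact_of_iso ?_ (D.exact₁ i j hij _ (ρ.split S hS))
  refine ShortComplex.isoMk ((H i).mapIso (ρ.e₃ S hS)).symm ((H j).mapIso (ρ.e₁ S hS)).symm
    ((H j).mapIso (ρ.e₂ S hS)).symm ?_ ?_
  · exact ((H i).mapIso (ρ.e₃ S hS)).inv_hom_id_assoc _
  · exact ((H j).map_comp _ _).symm.trans ((congrArg (H j).map (ρ.inv_comp_map_f S hS)).trans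
      ((H j).map_comp _ _))

theorem exact₂ (ρ : SequenceResolution r) (D : SplitDelta H)
    (S : ShortComplex 𝒜) (hS : Conflation S) (i : ι) : (S.map (r ⋙ H i)).Exact :=
  ShortComplex.exact_of_iso ((H i).mapShortComplex.mapIso (ρ.e S hS).symm)
    (D.exact₂ i _ (ρ.split S hS))

theorem exact₃ (i j : ι) (hij : c.Rel i j) :
    (ShortComplex.mk _ _ (ρ.map_comp_δ D S hS i j hij)).Exact := by
  refine ShortComplex.exact_of_iso ?_ (D.exact₃ i j hij _ (ρ.split S hS))
  refine ShortComplex.isoMk ((H i).mapIso (ρ.e₂ S hS)).symm ((H i).mapIso (ρ.e₃ S hS)).symm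
    ((H j).mapIso (ρ.e₁ S hS)).symm ?_ ?_
  · refine ((H i).map_comp _ _).symm.trans (Eq.trans (congrArg (H i).map ?_) ((H i).map_comp _ _))
    exact (Iso.inv_comp_eq _).2 (by rw [← Category.assoc, Iso.eq_comp_inv, map_g])
  · exact ((H i).mapIso (ρ.e₃ S hS)).inv_hom_id_assoc _

theorem mono (ρ : SequenceResolution r) (D : SplitDelta H)
    (S : ShortComplex 𝒜) (hS : Conflation S) (j : ι) (hj : ∀ i, ¬ c.Rel i j) :
    Mono ((r ⋙ H j).map S.f) := by
  have := D.mono j hj _ (ρ.split S hS)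
  have h : (r ⋙ H j).map S.f = (H j).map (ρ.e₁ S hS).hom ≫
      (H j).map ((HomotopyCategory.quotient 𝒜 c).map (ρ.res S hS).f) ≫
        (H j).map (ρ.e₂ S hS).inv := by
    rw [← (H j).map_comp, ← (H j).map_comp, ← ρ.inv_comp_map_f, Iso.hom_inv_id_assoc]
    rfl
  rw [h]
  infer_instance

theorem epi (ρ : SequenceResolution r) (D : SplitDelta H)
    (S : ShortComplex 𝒜) (hS : Conflation S) (i : ι) (hi : ∀ j, ¬ c.Rel i j) :
    Epi ((r ⋙ H i).map S.g) := by
  have := D.epi i hi _ (ρ.split S hS)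
  have h : (r ⋙ H i).map S.g = (H i).map (ρ.e₂ S hS).hom ≫
      (H i).map ((HomotopyCategory.quotient 𝒜 c).map (ρ.res S hS).g) ≫
        (H i).map (ρ.e₃ S hS).inv := by
    rw [← Category.assoc, ← (H i).map_comp, ← ρ.map_g, ← (H i).map_comp, Category.assoc,
      Iso.hom_inv_id, Category.comp_id]
    rfl
  rw [h]
  infer_instance

end SequenceResolution

/-- The cohomological `δ`-functor of the functors `r ⋙ H n`. -/
def SequenceResolution.cohomologicalDelta {r : 𝒜 ⥤ HomotopyCategory 𝒜 (ComplexShape.up ℕ)}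
    [r.Additive] (ρ : SequenceResolution r) {H : ℕ → HomotopyCategory 𝒜 (ComplexShape.up ℕ) ⥤ 𝒟}
    [∀ i, (H i).Additive] (D : SplitDelta H) : CohomologicalDelta (fun n => r ⋙ H n) where
  additive _ := inferInstance
  δ n S hS := ρ.δ D S hS n (n + 1) rfl
  δ_naturality n S _ hS hS' φ := ρ.δ_naturality D S hS hS' φ n (n + 1) rfl
  map_comp_δ n S hS := ρ.map_comp_δ D S hS n (n + 1) rfl
  δ_comp_map n S hS := ρ.δ_comp_map D S hS n (n + 1) rfl

theorem SequenceResolution.cohomologicalDelta_isExact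
    {r : 𝒜 ⥤ HomotopyCategory 𝒜 (ComplexShape.up ℕ)}
    [r.Additive] (ρ : SequenceResolution r) {H : ℕ → HomotopyCategory 𝒜 (ComplexShape.up ℕ) ⥤ 𝒟}
    [∀ i, (H i).Additive] (D : SplitDelta H) : (ρ.cohomologicalDelta D).IsExact := fun S hS =>
  ⟨ρ.mono D S hS 0 (fun i => Nat.succ_ne_zero i), fun n => ⟨ρ.exact₂ D S hS n,
    ρ.exact₃ D S hS n (n + 1) rfl, ρ.exact₁ D S hS n (n + 1) rfl⟩⟩

/-- The homological `δ`-functor of the functors `r ⋙ H n`. -/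
def SequenceResolution.homologicalDelta {r : 𝒜 ⥤ HomotopyCategory 𝒜 (ComplexShape.down ℕ)}
    [r.Additive] (ρ : SequenceResolution r) {H : ℕ → HomotopyCategory 𝒜 (ComplexShape.down ℕ) ⥤ 𝒟}
    [∀ i, (H i).Additive] (D : SplitDelta H) : HomologicalDelta (fun n => r ⋙ H n) where
  additive _ := inferInstance
  δ n S hS := ρ.δ D S hS (n + 1) n rfl
  δ_naturality n S _ hS hS' φ := ρ.δ_naturality D S hS hS' φ (n + 1) n rfl
  map_comp_δ n S hS := ρ.map_comp_δ D S hS (n + 1) n rfl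
  δ_comp_map n S hS := ρ.δ_comp_map D S hS (n + 1) n rfl

theorem SequenceResolution.homologicalDelta_isExact
    {r : 𝒜 ⥤ HomotopyCategory 𝒜 (ComplexShape.down ℕ)}
    [r.Additive] (ρ : SequenceResolution r) {H : ℕ → HomotopyCategory 𝒜 (ComplexShape.down ℕ) ⥤ 𝒟}
    [∀ i, (H i).Additive] (D : SplitDelta H) : (ρ.homologicalDelta D).IsExact := fun S hS =>
  ⟨ρ.epi D S hS 0 (fun j => Nat.succ_ne_zero j), fun n => ⟨ρ.exact₂ D S hS n,
    ρ.exact₃ D S hS (n + 1) n rfl, ρ.exact₁ D S hS (n + 1) n rfl⟩⟩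

end ResolvedDelta

/-! ### Admissible sequences and resolutions in abelian categories -/

section Resolutions

variable {𝒜 : Type*} [Category* 𝒜] [Abelian 𝒜]

theorem conflation_iff_shortExact (S : ShortComplex 𝒜) : Conflation S ↔ S.ShortExact := by
  constructor
  · rintro ⟨⟨h₁⟩, ⟨h₂⟩⟩
    exact .mk' (S.exact_of_f_is_kernel h₁) (mono_of_isLimit_fork h₁)
      (epi_of_isColimit_cofork h₂)
  · intro h
    exact ⟨⟨h.fIsKernel⟩, ⟨h.gIsCokernel⟩⟩

theorem conflation_cokernel {X Y : 𝒜} (f : X ⟶ Y) [Mono f] :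
    Conflation (ShortComplex.mk f (cokernel.π f) (cokernel.condition f)) :=
  (conflation_iff_shortExact _).2 (.mk' (ShortComplex.exact_cokernel f) ‹_› inferInstance)

theorem conflation_kernel {X Y : 𝒜} (f : X ⟶ Y) [Epi f] :
    Conflation (ShortComplex.mk (kernel.ι f) f (kernel.condition f)) :=
  (conflation_iff_shortExact _).2 (.mk' (ShortComplex.exact_kernel f) inferInstance ‹_›)

theorem admissibleInjective_iff (I : 𝒜) : AdmissibleInjective I ↔ Injective I := by
  constructor
  · exact fun h => ⟨fun g f _ => h _ (conflation_cokernel f) g⟩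
  · intro h S hS g
    have := ((conflation_iff_shortExact S).1 hS).mono_f
    exact ⟨Injective.factorThru g S.f, Injective.comp_factorThru _ _⟩

theorem admissibleProjective_iff (P : 𝒜) : AdmissibleProjective P ↔ Projective P := by
  constructor
  · exact fun h => ⟨fun g f _ => h _ (conflation_kernel f) g⟩
  · intro h S hS g
    have := ((conflation_iff_shortExact S).1 hS).epi_g
    exact ⟨Projective.factorThru g S.g, Projective.factorThru_comp _ _⟩

theorem Conflation.map {S : ShortComplex 𝒜} (hS : Conflation S) {ℬ : Type*} [Category* ℬ]
    [Abelian ℬ] (E : 𝒜 ⥤ ℬ) [E.Additive] [PreservesFiniteLimits E] [PreservesFiniteColimits E] :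
    Conflation (S.map E) :=
  (conflation_iff_shortExact _).2 (((conflation_iff_shortExact S).1 hS).map_of_exact E)

namespace InjectiveRes

variable {A : 𝒜} (R : InjectiveRes A)

theorem mono_ι (n : ℕ) : Mono (R.ι n) := ((conflation_iff_shortExact _).1 (R.conflation n)).mono_f

theorem epi_π (n : ℕ) : Epi (R.π n) := ((conflation_iff_shortExact _).1 (R.conflation n)).epi_g

/-- The augmentation `A ⟶ I 0`. -/
def η : A ⟶ R.I.X 0 := R.aug.hom ≫ R.ι 0

instance : Mono R.η :=
  have := R.mono_ι 0
  mono_comp _ _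

theorem η_d : R.η ≫ R.I.d 0 1 = 0 := by
  rw [η, R.d_eq 0, Category.assoc, reassoc_of% (R.zero 0), zero_comp, comp_zero]

theorem exact_η : (ShortComplex.mk R.η (R.I.d 0 1) R.η_d).Exact := by
  have := R.mono_ι 1
  let φ : ShortComplex.mk (R.ι 0) (R.π 0) (R.zero 0) ⟶
      ShortComplex.mk R.η (R.I.d 0 1) R.η_d :=
    { τ₁ := R.aug.inv
      τ₂ := 𝟙 _
      τ₃ := R.ι 1
      comm₁₂ := by simp [η]
      comm₂₃ := by simp [R.d_eq 0] }
  have : Mono φ.τ₃ := this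
  have : Epi φ.τ₁ := inferInstanceAs (Epi R.aug.inv)
  have : IsIso φ.τ₂ := inferInstanceAs (IsIso (𝟙 _))
  exact (ShortComplex.exact_iff_of_epi_of_isIso_of_mono φ).1
    ((conflation_iff_shortExact _).1 (R.conflation 0)).exact

theorem exact_d (n : ℕ) : (ShortComplex.mk (R.I.d n (n + 1)) (R.I.d (n + 1) (n + 2))
    (R.I.d_comp_d _ _ _)).Exact := by
  let S' := ShortComplex.mk (R.ι (n + 1)) (R.I.d (n + 1) (n + 2)) (by
    rw [R.d_eq (n + 1), reassoc_of% (R.zero (n + 1)), zero_comp])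
  let φ : ShortComplex.mk (R.ι (n + 1)) (R.π (n + 1)) (R.zero (n + 1)) ⟶ S' :=
    { τ₁ := 𝟙 _
      τ₂ := 𝟙 _
      τ₃ := R.ι (n + 2)
      comm₁₂ := by simp [S']
      comm₂₃ := by simp [S', R.d_eq (n + 1)] }
  let ψ : ShortComplex.mk (R.I.d n (n + 1)) (R.I.d (n + 1) (n + 2))
      (R.I.d_comp_d _ _ _) ⟶ S' :=
    { τ₁ := R.π n
      τ₂ := 𝟙 _
      τ₃ := 𝟙 _
      comm₁₂ := by simp [S', R.d_eq n]
      comm₂₃ := by simp [S'] }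
  have : Mono φ.τ₃ := R.mono_ι (n + 2)
  have : Epi φ.τ₁ := inferInstanceAs (Epi (𝟙 _))
  have : IsIso φ.τ₂ := inferInstanceAs (IsIso (𝟙 _))
  have : Mono ψ.τ₃ := inferInstanceAs (Mono (𝟙 _))
  have : Epi ψ.τ₁ := R.epi_π n
  have : IsIso ψ.τ₂ := inferInstanceAs (IsIso (𝟙 _))
  rw [ShortComplex.exact_iff_of_epi_of_isIso_of_mono ψ,
    ← ShortComplex.exact_iff_of_epi_of_isIso_of_mono φ]
  exact ((conflation_iff_shortExact _).1 (R.conflation (n + 1))).exact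

/-- A spliced injective resolution, as an injective resolution in the sense of a quasi-isomorphism
from the complex concentrated in degree `0`. -/
def toInjectiveResolution : InjectiveResolution A where
  cocomplex := R.I
  injective n := (admissibleInjective_iff _).1 (R.injective n)
  ι := (CochainComplex.fromSingle₀Equiv _ _).symm ⟨R.η, R.η_d⟩
  quasiIso := ⟨fun n => by
    cases n
    · rw [CochainComplex.quasiIsoAt₀_iff, ShortComplex.quasiIso_iff_of_zeros]
      · refine (ShortComplex.exact_and_mono_f_iff_of_iso ?_).2
          ⟨R.exact_η, inferInstanceAs (Mono R.η)⟩
        refine ShortComplex.isoMk (Iso.refl _) (Iso.refl _) (Iso.refl _) ?_ ?_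
        · exact (Category.id_comp _).trans (Eq.trans (by simp; rfl) (Category.comp_id _).symm)
        · exact (Category.id_comp _).trans (Category.comp_id _).symm
      · rfl
      · rfl
      · exact R.I.shape _ _ (by simp)
    · rw [quasiIsoAt_iff_exactAt]
      · rw [HomologicalComplex.exactAt_iff' _ _ _ _ (by simp; rfl) (by simp; rfl)]
        exact R.exact_d _
      · apply CochainComplex.exactAt_succ_single_obj⟩

theorem toInjectiveResolution_ι_f_zero : R.toInjectiveResolution.ι.f 0 = R.η := by
  simp [toInjectiveResolution]

/-- The image of an injective resolution under an exact functor that maps its terms to injective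
objects. -/
def map {ℬ : Type*} [Category* ℬ] [Abelian ℬ] (E : 𝒜 ⥤ ℬ) [E.Additive] [PreservesFiniteLimits E]
    [PreservesFiniteColimits E] (hE : ∀ n, Injective (E.obj (R.I.X n))) :
    InjectiveRes (E.obj A) where
  I := (E.mapHomologicalComplex _).obj R.I
  injective n := (admissibleInjective_iff _).2 (hE n)
  Z n := E.obj (R.Z n)
  ι n := E.map (R.ι n)
  π n := E.map (R.π n)
  zero n :=
    (E.map_comp _ _).symm.trans ((congrArg E.map (R.zero n)).trans (E.map_zero _ _))
  conflation n := (R.conflation n).map E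
  d_eq n := (congrArg E.map (R.d_eq n)).trans (E.map_comp _ _)
  aug := E.mapIso R.aug

/-- Splicing: if every object with the property `P` embeds into an injective object with the
property `Q` such that the cokernel again has the property `P`, then every object with the
property `P` has an injective resolution whose terms have the property `Q`. -/
theorem exists_of_embeddings (P Q : 𝒜 → Prop) (h : ∀ Z, P Z → ∃ (I : 𝒜) (i : Z ⟶ I),
    Mono i ∧ Injective I ∧ Q I ∧ P (cokernel i)) (A : 𝒜) (hA : P A) :
    ∃ R : InjectiveRes A, ∀ n, Q (R.I.X n) := by
  choose I i h₁ h₂ h₃ h₄ using h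
  let Z : ℕ → {Z : 𝒜 // P Z} := fun n => Nat.rec ⟨A, hA⟩ (fun _ Z => ⟨_, h₄ Z.1 Z.2⟩) n
  let ι : ∀ n, (Z n).1 ⟶ I (Z n).1 (Z n).2 := fun n => i _ _
  have : ∀ n, Mono (ι n) := fun n => h₁ _ _
  let π : ∀ n, I (Z n).1 (Z n).2 ⟶ (Z (n + 1)).1 := fun n => cokernel.π (ι n)
  have w : ∀ n, ι n ≫ π n = 0 := fun n => cokernel.condition (ι n)
  have sq : ∀ n, (π n ≫ ι (n + 1)) ≫ π (n + 1) ≫ ι (n + 2) = 0 := fun n => by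
    rw [Category.assoc, reassoc_of% (w (n + 1)), zero_comp, comp_zero]
  exact ⟨{
    I := CochainComplex.of (fun n => I (Z n).1 (Z n).2) (fun n => π n ≫ ι (n + 1)) sq
    injective := fun n => (admissibleInjective_iff _).2 (h₂ _ _)
    Z := fun n => (Z n).1
    ι := ι
    π := π
    zero := w
    conflation := fun n => conflation_cokernel (ι n)
    d_eq := fun n => CochainComplex.of_d _ (fun n => π n ≫ ι (n + 1)) n
    aug := Iso.refl _ }, fun n => h₃ _ _⟩

theorem nonempty [EnoughInjectives 𝒜] (A : 𝒜) : Nonempty (InjectiveRes A) := by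
  obtain ⟨R, -⟩ := exists_of_embeddings (fun _ : 𝒜 => True) (fun _ => True) (fun Z _ =>
    ⟨Injective.under Z, Injective.ι Z, inferInstance, inferInstance, trivial, trivial⟩) A trivial
  exact ⟨R⟩

/-- The chosen injective resolution of `A` is homotopy equivalent to any other one. -/
def iso [EnoughInjectives 𝒜] : (injectiveResolutions 𝒜).obj A ≅
    (HomotopyCategory.quotient 𝒜 (ComplexShape.up ℕ)).obj R.I :=
  R.toInjectiveResolution.iso

theorem iso_hom_naturality [EnoughInjectives 𝒜] {A' : 𝒜} (f : A ⟶ A') (R' : InjectiveRes A')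
    (φ : R.I ⟶ R'.I) (h : R.η ≫ φ.f 0 = f ≫ R'.η) :
    (injectiveResolutions 𝒜).map f ≫ R'.iso.hom =
      R.iso.hom ≫ (HomotopyCategory.quotient 𝒜 (ComplexShape.up ℕ)).map φ := by
  refine InjectiveResolution.iso_hom_naturality f R.toInjectiveResolution
    R'.toInjectiveResolution φ ?_
  rw [toInjectiveResolution_ι_f_zero, toInjectiveResolution_ι_f_zero]
  exact h

theorem exists_lift {A' : 𝒜} (f : A ⟶ A') (R' : InjectiveRes A') :
    ∃ φ : R.I ⟶ R'.I, R.η ≫ φ.f 0 = f ≫ R'.η := by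
  refine ⟨InjectiveResolution.desc f R'.toInjectiveResolution R.toInjectiveResolution, ?_⟩
  have h := InjectiveResolution.desc_commutes_zero f R'.toInjectiveResolution
    R.toInjectiveResolution
  rwa [toInjectiveResolution_ι_f_zero, toInjectiveResolution_ι_f_zero] at h

end InjectiveRes

/-! ### Simultaneous injective resolutions of short exact sequences -/

section Horseshoe

/-- The split short exact sequence with outer terms `I` and `J`. -/
def splitSequence (I J : 𝒜) : ShortComplex 𝒜 :=
  ShortComplex.mk (biprod.inl : I ⟶ I ⊞ J) biprod.snd biprod.inl_snd

/-- The standard splitting of `splitSequence I J`. -/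
def splitSequenceSplitting (I J : 𝒜) : (splitSequence I J).Splitting where
  r := biprod.fst
  s := biprod.inr
  f_r := biprod.inl_fst
  s_g := biprod.inr_snd
  id := biprod.total

/-- A split sequence of injective objects is injective in the category of all short complexes. -/
instance injective_splitSequence (I J : 𝒜) [Injective I] [Injective J] :
    Injective (splitSequence I J) where
  factors {S S'} g f _ := by
    have : Mono f.τ₂ := inferInstanceAs (Mono (ShortComplex.π₂.map f))
    have : Mono f.τ₃ := inferInstanceAs (Mono (ShortComplex.π₃.map f))
    let g₂ : S.X₂ ⟶ I ⊞ J := g.τ₂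
    let g₁ : S.X₁ ⟶ I := g.τ₁
    let g₃ : S.X₃ ⟶ J := g.τ₃
    have w₁ : g₁ ≫ biprod.inl = S.f ≫ g₂ := g.comm₁₂
    have w₂ : g₂ ≫ biprod.snd = S.g ≫ g₃ := g.comm₂₃
    let a : S'.X₂ ⟶ I := Injective.factorThru (g₂ ≫ biprod.fst) f.τ₂
    let b : S'.X₃ ⟶ J := Injective.factorThru g₃ f.τ₃
    have ha : f.τ₂ ≫ a = g₂ ≫ biprod.fst := Injective.comp_factorThru _ _
    have hb : f.τ₃ ≫ b = g₃ := Injective.comp_factorThru _ _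
    refine ⟨{ τ₁ := S'.f ≫ a
              τ₂ := biprod.lift a (S'.g ≫ b)
              τ₃ := b
              comm₁₂ := ?_
              comm₂₃ := ?_ }, ?_⟩
    · change (S'.f ≫ a) ≫ (biprod.inl : I ⟶ I ⊞ J) = S'.f ≫ biprod.lift a (S'.g ≫ b)
      ext <;> simp
    · change biprod.lift a (S'.g ≫ b) ≫ (biprod.snd : I ⊞ J ⟶ J) = S'.g ≫ b
      simp
    · refine ShortComplex.hom_ext _ _ ?_ ?_ ?_
      · change f.τ₁ ≫ S'.f ≫ a = g₁
        rw [f.comm₁₂_assoc, ha, ← Category.assoc, ← w₁, Category.assoc, biprod.inl_fst,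
          Category.comp_id]
      · change f.τ₂ ≫ biprod.lift a (S'.g ≫ b) = g₂
        ext
        · simpa using ha
        · simp only [Category.assoc, biprod.lift_snd]
          rw [f.comm₂₃_assoc, hb, w₂]
      · exact hb

/-- The nine lemma: the cokernel of a monomorphism of short exact sequences is short exact. -/
theorem shortExact_cokernel {S J : ShortComplex 𝒜} (hS : S.ShortExact) (hJ : J.ShortExact)
    (i : S ⟶ J) [Mono i] : (cokernel i).ShortExact := by
  have := hS.epi_g
  have := hJ.mono_f
  let sn : ShortComplex.SnakeInput 𝒜 :=
    { L₀ := kernel i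
      L₁ := S
      L₂ := J
      L₃ := cokernel i
      v₀₁ := kernel.ι i
      v₁₂ := i
      v₂₃ := cokernel.π i
      w₀₂ := kernel.condition i
      w₁₃ := cokernel.condition i
      h₀ := kernelIsKernel i
      h₃ := cokernelIsCokernel i
      L₁_exact := hS.exact
      epi_L₁_g := ‹_›
      L₂_exact := hJ.exact
      mono_L₂_f := ‹_› }
  -- The snake morphism vanishes because its source is a component of the kernel of a monomorphism.
  have h₀ : sn.δ = 0 := by
    have : IsZero (kernel i).X₃ := by
      refine (ShortComplex.π₃ (C := 𝒜)).map_isZero ?_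
      rw [IsZero.iff_id_eq_zero, ← cancel_mono (kernel.ι i)]
      simp [kernel.ι_of_mono]
    exact this.eq_of_src _ _
  have h₁ : Mono (cokernel i).f :=
    (ShortComplex.exact_iff_mono _ h₀).1 sn.L₂'_exact
  have : Epi sn.L₂.g := hJ.epi_g
  have h₂ : Epi (cokernel i).g := sn.epi_L₃_g
  exact .mk' sn.L₃_exact h₁ h₂

/-- A short exact sequence embeds into a split sequence of injective objects `I` and `J` that
contain its outer terms; on the middle term, the components of the embedding are an extension of
`X₁ ⟶ I` to `X₂` and the composite `X₂ ⟶ X₃ ⟶ J`. -/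
theorem exists_embedding_splitSequence [EnoughInjectives 𝒜] (S : ShortComplex 𝒜)
    (hS : S.ShortExact) : ∃ i : S ⟶ splitSequence (Injective.under S.X₁) (Injective.under S.X₃),
      Mono i := by
  have := hS.mono_f
  let a : S.X₂ ⟶ Injective.under S.X₁ := Injective.factorThru (Injective.ι _) S.f
  have ha : S.f ≫ a = Injective.ι _ := Injective.comp_factorThru _ _
  let i : S ⟶ splitSequence (Injective.under S.X₁) (Injective.under S.X₃) :=
    { τ₁ := Injective.ι _
      τ₂ := biprod.lift a (S.g ≫ Injective.ι _)
      τ₃ := Injective.ι _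
      comm₁₂ := by
        change Injective.ι _ ≫ (biprod.inl : _ ⟶ _ ⊞ _) =
          S.f ≫ biprod.lift a (S.g ≫ Injective.ι _)
        ext <;> simp [ha]
      comm₂₃ := by
        change biprod.lift a (S.g ≫ Injective.ι _) ≫ (biprod.snd : _ ⊞ _ ⟶ _) =
          S.g ≫ Injective.ι _
        simp }
  have h₁ : Mono i.τ₁ := inferInstanceAs (Mono (Injective.ι _))
  have h₃ : Mono i.τ₃ := inferInstanceAs (Mono (Injective.ι _))
  have := (splitSequenceSplitting (Injective.under S.X₁) (Injective.under S.X₃)).shortExact.mono_f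
  have h₂ : Mono i.τ₂ := ShortComplex.mono_τ₂_of_exact_of_mono i hS.exact
  refine ⟨i, ⟨fun f g h => ShortComplex.hom_ext _ _ ?_ ?_ ?_⟩⟩
  · exact (cancel_mono i.τ₁).1 (congrArg ShortComplex.Hom.τ₁ h)
  · exact (cancel_mono i.τ₂).1 (congrArg ShortComplex.Hom.τ₂ h)
  · exact (cancel_mono i.τ₃).1 (congrArg ShortComplex.Hom.τ₃ h)

/-- The horseshoe lemma: a short exact sequence has an injective resolution in the category of short
complexes whose terms are split exact sequences of injective objects. -/
theorem exists_injectiveRes_shortComplex [EnoughInjectives 𝒜] (S : ShortComplex 𝒜)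
    (hS : S.ShortExact) : ∃ R : InjectiveRes S, ∀ n, Nonempty (R.I.X n).Splitting ∧
      Injective (R.I.X n).X₁ ∧ Injective (R.I.X n).X₂ ∧ Injective (R.I.X n).X₃ := by
  refine InjectiveRes.exists_of_embeddings (fun S : ShortComplex 𝒜 => S.ShortExact)
    (fun J => Nonempty J.Splitting ∧ Injective J.X₁ ∧ Injective J.X₂ ∧ Injective J.X₃) ?_ S hS
  intro S hS
  obtain ⟨i, hi⟩ := exists_embedding_splitSequence S hS
  refine ⟨_, i, hi, inferInstance, ⟨⟨splitSequenceSplitting _ _⟩, ?_, ?_, ?_⟩,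
    shortExact_cokernel hS (splitSequenceSplitting _ _).shortExact i⟩
  · exact inferInstanceAs (Injective (Injective.under _))
  · exact inferInstanceAs (Injective (Injective.under _ ⊞ Injective.under _))
  · exact inferInstanceAs (Injective (Injective.under _))

instance : (ShortComplex.π₁ (C := 𝒜)).Additive where

instance : (ShortComplex.π₂ (C := 𝒜)).Additive where

instance : (ShortComplex.π₃ (C := 𝒜)).Additive where

/-- The three complexes of a complex of short complexes. -/
def complexSequence {ι : Type*} {c : ComplexShape ι} (K : HomologicalComplex (ShortComplex 𝒜) c) :
    ShortComplex (HomologicalComplex 𝒜 c) where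
  X₁ := (ShortComplex.π₁.mapHomologicalComplex c).obj K
  X₂ := (ShortComplex.π₂.mapHomologicalComplex c).obj K
  X₃ := (ShortComplex.π₃.mapHomologicalComplex c).obj K
  f := { f := fun i => (K.X i).f, comm' := fun i j _ => (K.d i j).comm₁₂.symm }
  g := { f := fun i => (K.X i).g, comm' := fun i j _ => (K.d i j).comm₂₃.symm }
  zero := by ext i; exact (K.X i).zero

/-- A morphism of complexes of short complexes, as a morphism of sequences of complexes. -/
def complexSequenceMap {ι : Type*} {c : ComplexShape ι}
    {K L : HomologicalComplex (ShortComplex 𝒜) c} (φ : K ⟶ L) :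
    complexSequence K ⟶ complexSequence L where
  τ₁ := (ShortComplex.π₁.mapHomologicalComplex c).map φ
  τ₂ := (ShortComplex.π₂.mapHomologicalComplex c).map φ
  τ₃ := (ShortComplex.π₃.mapHomologicalComplex c).map φ
  comm₁₂ := by ext i; exact (φ.f i).comm₁₂
  comm₂₃ := by ext i; exact (φ.f i).comm₂₃

theorem degreewiseSplit_complexSequence {ι : Type*} {c : ComplexShape ι}
    (K : HomologicalComplex (ShortComplex 𝒜) c) (h : ∀ i, Nonempty (K.X i).Splitting) :
    DegreewiseSplit (complexSequence K) := h

variable [EnoughInjectives 𝒜]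

instance : (injectiveResolutions 𝒜).Additive where
  map_add {X Y f g} := by
    refine (HomotopyCategory.eq_of_homotopy _ (_ + _)
      (InjectiveResolution.descHomotopy (f + g) _ _ ?_ ?_)).trans
        ((HomotopyCategory.quotient 𝒜 (ComplexShape.up ℕ)).map_add)
    · simp
    · simp [Preadditive.comp_add, Preadditive.add_comp]

variable (𝒜) in
/-- The functor of injective resolutions represents short exact sequences by the degreewise split
sequences of complexes of the horseshoe lemma. -/
def injectiveSequenceResolution : SequenceResolution (injectiveResolutions 𝒜) := by
  have h := fun (S : ShortComplex 𝒜) (hS : Conflation S) =>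
    exists_injectiveRes_shortComplex S ((conflation_iff_shortExact S).1 hS)
  choose R hR using h
  let R₁ := fun S hS => ((R S hS).map ShortComplex.π₁ fun n => (hR S hS n).2.1)
  let R₂ := fun S hS => ((R S hS).map ShortComplex.π₂ fun n => (hR S hS n).2.2.1)
  let R₃ := fun S hS => ((R S hS).map ShortComplex.π₃ fun n => (hR S hS n).2.2.2)
  refine
    { res := fun S hS => complexSequence (R S hS).I
      split := fun S hS => degreewiseSplit_complexSequence _ fun n => (hR S hS n).1
      e := fun S hS => ShortComplex.isoMk (R₁ S hS).iso
        (R₂ S hS).iso (R₃ S hS).iso ?_ ?_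
      lift := fun S S' hS hS' φ => ?_ }
  · refine ((R₁ S hS).iso_hom_naturality S.f (R₂ S hS) (complexSequence (R S hS).I).f ?_).symm
    exact (R S hS).η.comm₁₂
  · refine ((R₂ S hS).iso_hom_naturality S.g (R₃ S hS) (complexSequence (R S hS).I).g ?_).symm
    exact (R S hS).η.comm₂₃
  · obtain ⟨ψ, hψ⟩ := (R S hS).exists_lift φ (R S' hS')
    refine ⟨complexSequenceMap ψ, ShortComplex.hom_ext _ _ ?_ ?_ ?_⟩
    · refine (R₁ S hS).iso_hom_naturality φ.τ₁ (R₁ S' hS') (complexSequenceMap ψ).τ₁ ?_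
      exact congrArg ShortComplex.Hom.τ₁ hψ
    · refine (R₂ S hS).iso_hom_naturality φ.τ₂ (R₂ S' hS') (complexSequenceMap ψ).τ₂ ?_
      exact congrArg ShortComplex.Hom.τ₂ hψ
    · refine (R₃ S hS).iso_hom_naturality φ.τ₃ (R₃ S' hS') (complexSequenceMap ψ).τ₃ ?_
      exact congrArg ShortComplex.Hom.τ₃ hψ

end Horseshoe

end Resolutions

/-! ### Projective resolutions and simultaneous projective resolutions -/

section ProjectiveResolutions

variable {𝒜 : Type*} [Category* 𝒜] [Abelian 𝒜]

namespace ProjectiveRes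

variable {A : 𝒜} (R : ProjectiveRes A)

theorem mono_ι (n : ℕ) : Mono (R.ι n) := ((conflation_iff_shortExact _).1 (R.conflation n)).mono_f

theorem epi_π (n : ℕ) : Epi (R.π n) := ((conflation_iff_shortExact _).1 (R.conflation n)).epi_g

/-- The augmentation `P 0 ⟶ A`. -/
def ε : R.P.X 0 ⟶ A := R.π 0 ≫ R.aug.hom

instance : Epi R.ε :=
  have := R.epi_π 0
  epi_comp _ _

theorem d_ε : R.P.d 1 0 ≫ R.ε = 0 := by
  rw [ε, R.d_eq 0, Category.assoc, reassoc_of% (R.zero 0), zero_comp, comp_zero]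

theorem exact_ε : (ShortComplex.mk (R.P.d 1 0) R.ε R.d_ε).Exact := by
  let φ : ShortComplex.mk (R.P.d 1 0) R.ε R.d_ε ⟶
      ShortComplex.mk (R.ι 0) (R.π 0) (R.zero 0) :=
    { τ₁ := R.π 1
      τ₂ := 𝟙 _
      τ₃ := R.aug.inv
      comm₁₂ := by simp [R.d_eq 0]
      comm₂₃ := by simp [ε] }
  have : Epi φ.τ₁ := R.epi_π 1
  have : Mono φ.τ₃ := inferInstanceAs (Mono R.aug.inv)
  have : IsIso φ.τ₂ := inferInstanceAs (IsIso (𝟙 _))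
  exact (ShortComplex.exact_iff_of_epi_of_isIso_of_mono φ).2
    ((conflation_iff_shortExact _).1 (R.conflation 0)).exact

theorem exact_d (n : ℕ) : (ShortComplex.mk (R.P.d (n + 2) (n + 1)) (R.P.d (n + 1) n)
    (R.P.d_comp_d _ _ _)).Exact := by
  let S' := ShortComplex.mk (R.P.d (n + 2) (n + 1)) (R.π (n + 1)) (by
    rw [R.d_eq (n + 1), Category.assoc, R.zero (n + 1), comp_zero])
  let φ : S' ⟶ ShortComplex.mk (R.ι (n + 1)) (R.π (n + 1)) (R.zero (n + 1)) :=
    { τ₁ := R.π (n + 2)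
      τ₂ := 𝟙 _
      τ₃ := 𝟙 _
      comm₁₂ := by simp [S', R.d_eq (n + 1)]
      comm₂₃ := by simp [S'] }
  let ψ : S' ⟶ ShortComplex.mk (R.P.d (n + 2) (n + 1)) (R.P.d (n + 1) n)
      (R.P.d_comp_d _ _ _) :=
    { τ₁ := 𝟙 _
      τ₂ := 𝟙 _
      τ₃ := R.ι n
      comm₁₂ := by simp [S']
      comm₂₃ := by simp [S', R.d_eq n] }
  have : Mono φ.τ₃ := inferInstanceAs (Mono (𝟙 _))
  have : Epi φ.τ₁ := R.epi_π (n + 2)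
  have : IsIso φ.τ₂ := inferInstanceAs (IsIso (𝟙 _))
  have : Mono ψ.τ₃ := R.mono_ι n
  have : Epi ψ.τ₁ := inferInstanceAs (Epi (𝟙 _))
  have : IsIso ψ.τ₂ := inferInstanceAs (IsIso (𝟙 _))
  rw [← ShortComplex.exact_iff_of_epi_of_isIso_of_mono ψ,
    ShortComplex.exact_iff_of_epi_of_isIso_of_mono φ]
  exact ((conflation_iff_shortExact _).1 (R.conflation (n + 1))).exact

/-- A spliced projective resolution, as a projective resolution in the sense of a quasi-isomorphism
to the complex concentrated in degree `0`. -/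
def toProjectiveResolution : ProjectiveResolution A where
  complex := R.P
  projective n := (admissibleProjective_iff _).1 (R.projective n)
  π := (ChainComplex.toSingle₀Equiv _ _).symm ⟨R.ε, R.d_ε⟩
  quasiIso := ⟨fun n => by
    cases n
    · rw [ChainComplex.quasiIsoAt₀_iff, ShortComplex.quasiIso_iff_of_zeros']
      · refine (ShortComplex.exact_and_epi_g_iff_of_iso ?_).2 ⟨R.exact_ε, inferInstanceAs (Epi R.ε)⟩
        refine ShortComplex.isoMk (Iso.refl _) (Iso.refl _) (Iso.refl _) ?_ ?_
        · exact (Category.id_comp _).trans (Category.comp_id _).symm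
        · exact (Category.id_comp _).trans (Eq.trans (by simp; rfl) (Category.comp_id _).symm)
      · exact R.P.shape _ _ (by simp)
      · rfl
      · rfl
    · rw [quasiIsoAt_iff_exactAt']
      · rw [HomologicalComplex.exactAt_iff' _ _ _ _ (by simp; rfl) (by simp; rfl)]
        exact R.exact_d _
      · apply ChainComplex.exactAt_succ_single_obj⟩

theorem toProjectiveResolution_π_f_zero : R.toProjectiveResolution.π.f 0 = R.ε := by
  simp [toProjectiveResolution]

/-- The image of a projective resolution under an exact functor that maps its terms to projective
objects. -/
def map {ℬ : Type*} [Category* ℬ] [Abelian ℬ] (E : 𝒜 ⥤ ℬ) [E.Additive] [PreservesFiniteLimits E]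
    [PreservesFiniteColimits E] (hE : ∀ n, Projective (E.obj (R.P.X n))) :
    ProjectiveRes (E.obj A) where
  P := (E.mapHomologicalComplex _).obj R.P
  projective n := (admissibleProjective_iff _).2 (hE n)
  Z n := E.obj (R.Z n)
  ι n := E.map (R.ι n)
  π n := E.map (R.π n)
  zero n :=
    (E.map_comp _ _).symm.trans ((congrArg E.map (R.zero n)).trans (E.map_zero _ _))
  conflation n := (R.conflation n).map E
  d_eq n := (congrArg E.map (R.d_eq n)).trans (E.map_comp _ _)
  aug := E.mapIso R.aug

/-- Splicing: if every object with the property `P` is a quotient of a projective object with the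
property `Q` such that the kernel again has the property `P`, then every object with the
property `P` has a projective resolution whose terms have the property `Q`. -/
theorem exists_of_covers (P Q : 𝒜 → Prop) (h : ∀ Z, P Z → ∃ (I : 𝒜) (i : I ⟶ Z),
    Epi i ∧ Projective I ∧ Q I ∧ P (kernel i)) (A : 𝒜) (hA : P A) :
    ∃ R : ProjectiveRes A, ∀ n, Q (R.P.X n) := by
  choose I i h₁ h₂ h₃ h₄ using h
  let Z : ℕ → {Z : 𝒜 // P Z} := fun n => Nat.rec ⟨A, hA⟩ (fun _ Z => ⟨_, h₄ Z.1 Z.2⟩) n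
  let π : ∀ n, I (Z n).1 (Z n).2 ⟶ (Z n).1 := fun n => i _ _
  have : ∀ n, Epi (π n) := fun n => h₁ _ _
  let ι : ∀ n, (Z (n + 1)).1 ⟶ I (Z n).1 (Z n).2 := fun n => kernel.ι (π n)
  have w : ∀ n, ι n ≫ π n = 0 := fun n => kernel.condition (π n)
  have sq : ∀ n, (π (n + 2) ≫ ι (n + 1)) ≫ π (n + 1) ≫ ι n = 0 := fun n => by
    rw [Category.assoc, reassoc_of% (w (n + 1)), zero_comp, comp_zero]
  exact ⟨{
    P := ChainComplex.of (fun n => I (Z n).1 (Z n).2) (fun n => π (n + 1) ≫ ι n) sq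
    projective := fun n => (admissibleProjective_iff _).2 (h₂ _ _)
    Z := fun n => (Z n).1
    ι := ι
    π := π
    zero := w
    conflation := fun n => conflation_kernel (π n)
    d_eq := fun n => ChainComplex.of_d _ (fun n => π (n + 1) ≫ ι n) n
    aug := Iso.refl _ }, fun n => h₃ _ _⟩

theorem nonempty [EnoughProjectives 𝒜] (A : 𝒜) : Nonempty (ProjectiveRes A) := by
  obtain ⟨R, -⟩ := exists_of_covers (fun _ : 𝒜 => True) (fun _ => True) (fun Z _ =>
    ⟨Projective.over Z, Projective.π Z, inferInstance, inferInstance, trivial, trivial⟩) A trivial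
  exact ⟨R⟩

/-- The chosen projective resolution of `A` is homotopy equivalent to any other one. -/
def iso [EnoughProjectives 𝒜] : (projectiveResolutions 𝒜).obj A ≅
    (HomotopyCategory.quotient 𝒜 (ComplexShape.down ℕ)).obj R.P :=
  R.toProjectiveResolution.iso

theorem iso_hom_naturality [EnoughProjectives 𝒜] {A' : 𝒜} (f : A ⟶ A') (R' : ProjectiveRes A')
    (φ : R.P ⟶ R'.P) (h : φ.f 0 ≫ R'.ε = R.ε ≫ f) :
    (projectiveResolutions 𝒜).map f ≫ R'.iso.hom =
      R.iso.hom ≫ (HomotopyCategory.quotient 𝒜 (ComplexShape.down ℕ)).map φ := by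
  refine ProjectiveResolution.iso_hom_naturality f R.toProjectiveResolution
    R'.toProjectiveResolution φ ?_
  rw [toProjectiveResolution_π_f_zero, toProjectiveResolution_π_f_zero]
  exact h

theorem exists_lift {A' : 𝒜} (f : A ⟶ A') (R' : ProjectiveRes A') :
    ∃ φ : R.P ⟶ R'.P, φ.f 0 ≫ R'.ε = R.ε ≫ f := by
  refine ⟨ProjectiveResolution.lift f R.toProjectiveResolution R'.toProjectiveResolution, ?_⟩
  have h := ProjectiveResolution.lift_commutes_zero f R.toProjectiveResolution
    R'.toProjectiveResolution
  rwa [toProjectiveResolution_π_f_zero, toProjectiveResolution_π_f_zero] at h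

end ProjectiveRes

/-- A split sequence of projective objects is projective in the category of all short complexes. -/
instance projective_splitSequence (P Q : 𝒜) [Projective P] [Projective Q] :
    Projective (splitSequence P Q) where
  factors {S S'} g f _ := by
    have : Epi f.τ₁ := inferInstanceAs (Epi (ShortComplex.π₁.map f))
    have : Epi f.τ₂ := inferInstanceAs (Epi (ShortComplex.π₂.map f))
    let g₂ : P ⊞ Q ⟶ S'.X₂ := g.τ₂
    let g₁ : P ⟶ S'.X₁ := g.τ₁
    let g₃ : Q ⟶ S'.X₃ := g.τ₃
    have w₁ : g₁ ≫ S'.f = biprod.inl ≫ g₂ := g.comm₁₂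
    have w₂ : g₂ ≫ S'.g = biprod.snd ≫ g₃ := g.comm₂₃
    let a : P ⟶ S.X₁ := Projective.factorThru g₁ f.τ₁
    let b : Q ⟶ S.X₂ := Projective.factorThru (biprod.inr ≫ g₂) f.τ₂
    have ha : a ≫ f.τ₁ = g₁ := Projective.factorThru_comp _ _
    have hb : b ≫ f.τ₂ = biprod.inr ≫ g₂ := Projective.factorThru_comp _ _
    refine ⟨{ τ₁ := a
              τ₂ := biprod.desc (a ≫ S.f) b
              τ₃ := b ≫ S.g
              comm₁₂ := ?_
              comm₂₃ := ?_ }, ?_⟩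
    · change a ≫ S.f = (biprod.inl : P ⟶ P ⊞ Q) ≫ biprod.desc (a ≫ S.f) b
      simp
    · change biprod.desc (a ≫ S.f) b ≫ S.g = (biprod.snd : P ⊞ Q ⟶ Q) ≫ b ≫ S.g
      ext <;> simp
    · refine ShortComplex.hom_ext _ _ ?_ ?_ ?_
      · exact ha
      · change biprod.desc (a ≫ S.f) b ≫ f.τ₂ = g₂
        ext
        · simp only [← Category.assoc, biprod.inl_desc]
          rw [Category.assoc, ← f.comm₁₂, ← Category.assoc, ha, w₁]
        · simpa using hb
      · change (b ≫ S.g) ≫ f.τ₃ = g₃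
        rw [Category.assoc, ← f.comm₂₃, ← Category.assoc, hb, Category.assoc, w₂,
          biprod.inr_snd_assoc]

/-- The nine lemma: the kernel of an epimorphism of short exact sequences is short exact. -/
theorem shortExact_kernel {S J : ShortComplex 𝒜} (hS : S.ShortExact) (hJ : J.ShortExact)
    (i : S ⟶ J) [Epi i] : (kernel i).ShortExact := by
  have := hS.epi_g
  have := hJ.mono_f
  let sn : ShortComplex.SnakeInput 𝒜 :=
    { L₀ := kernel i
      L₁ := S
      L₂ := J
      L₃ := cokernel i
      v₀₁ := kernel.ι i
      v₁₂ := i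
      v₂₃ := cokernel.π i
      w₀₂ := kernel.condition i
      w₁₃ := cokernel.condition i
      h₀ := kernelIsKernel i
      h₃ := cokernelIsCokernel i
      L₁_exact := hS.exact
      epi_L₁_g := ‹_›
      L₂_exact := hJ.exact
      mono_L₂_f := ‹_› }
  -- The snake morphism vanishes because its target is a component of the cokernel of an
  -- epimorphism.
  have h₀ : sn.δ = 0 := by
    have : IsZero (cokernel i).X₁ := by
      refine (ShortComplex.π₁ (C := 𝒜)).map_isZero ?_
      rw [IsZero.iff_id_eq_zero, ← cancel_epi (cokernel.π i)]
      simp [cokernel.π_of_epi]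
    exact this.eq_of_tgt _ _
  have h₁ : Epi (kernel i).g :=
    (ShortComplex.exact_iff_epi _ h₀).1 sn.L₁'_exact
  have : Mono sn.L₁.f := hS.mono_f
  have h₂ : Mono (kernel i).f := sn.mono_L₀_f
  exact .mk' sn.L₀_exact h₂ h₁

/-- A short exact sequence is a quotient of a split sequence of projective objects `P` and `Q` that
cover its outer terms; on the middle term, the components of the epimorphism are the composite
`P ⟶ X₁ ⟶ X₂` and a lift of `Q ⟶ X₃` to `X₂`. -/
theorem exists_cover_splitSequence [EnoughProjectives 𝒜] (S : ShortComplex 𝒜)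
    (hS : S.ShortExact) : ∃ p : splitSequence (Projective.over S.X₁) (Projective.over S.X₃) ⟶ S,
      Epi p := by
  have := hS.epi_g
  let a : Projective.over S.X₃ ⟶ S.X₂ := Projective.factorThru (Projective.π _) S.g
  have ha : a ≫ S.g = Projective.π _ := Projective.factorThru_comp _ _
  let p : splitSequence (Projective.over S.X₁) (Projective.over S.X₃) ⟶ S :=
    { τ₁ := Projective.π _
      τ₂ := biprod.desc (Projective.π _ ≫ S.f) a
      τ₃ := Projective.π _
      comm₁₂ := by
        change Projective.π _ ≫ S.f = (biprod.inl : _ ⟶ _ ⊞ _) ≫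
          biprod.desc (Projective.π _ ≫ S.f) a
        simp
      comm₂₃ := by
        change biprod.desc (Projective.π _ ≫ S.f) a ≫ S.g = (biprod.snd : _ ⊞ _ ⟶ _) ≫
          Projective.π _
        ext <;> simp [ha] }
  have h₁ : Epi p.τ₁ := inferInstanceAs (Epi (Projective.π _))
  have h₃ : Epi p.τ₃ := inferInstanceAs (Epi (Projective.π _))
  have := (splitSequenceSplitting (Projective.over S.X₁) (Projective.over S.X₃)).shortExact.epi_g
  have h₂ : Epi p.τ₂ := ShortComplex.epi_τ₂_of_exact_of_epi p hS.exact
  refine ⟨p, ⟨fun f g h => ShortComplex.hom_ext _ _ ?_ ?_ ?_⟩⟩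
  · exact (cancel_epi p.τ₁).1 (congrArg ShortComplex.Hom.τ₁ h)
  · exact (cancel_epi p.τ₂).1 (congrArg ShortComplex.Hom.τ₂ h)
  · exact (cancel_epi p.τ₃).1 (congrArg ShortComplex.Hom.τ₃ h)

/-- The horseshoe lemma: a short exact sequence has a projective resolution in the category of
short complexes whose terms are split exact sequences of projective objects. -/
theorem exists_projectiveRes_shortComplex [EnoughProjectives 𝒜] (S : ShortComplex 𝒜)
    (hS : S.ShortExact) : ∃ R : ProjectiveRes S, ∀ n, Nonempty (R.P.X n).Splitting ∧
      Projective (R.P.X n).X₁ ∧ Projective (R.P.X n).X₂ ∧ Projective (R.P.X n).X₃ := by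
  refine ProjectiveRes.exists_of_covers (fun S : ShortComplex 𝒜 => S.ShortExact)
    (fun J => Nonempty J.Splitting ∧ Projective J.X₁ ∧ Projective J.X₂ ∧ Projective J.X₃) ?_ S hS
  intro S hS
  obtain ⟨p, hp⟩ := exists_cover_splitSequence S hS
  refine ⟨_, p, hp, inferInstance, ⟨⟨splitSequenceSplitting _ _⟩, ?_, ?_, ?_⟩,
    shortExact_kernel (splitSequenceSplitting _ _).shortExact hS p⟩
  · exact inferInstanceAs (Projective (Projective.over _))
  · exact inferInstanceAs (Projective (Projective.over _ ⊞ Projective.over _))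
  · exact inferInstanceAs (Projective (Projective.over _))

variable [EnoughProjectives 𝒜]

instance : (projectiveResolutions 𝒜).Additive where
  map_add {X Y f g} := by
    refine (HomotopyCategory.eq_of_homotopy _ (_ + _)
      (ProjectiveResolution.liftHomotopy (f + g) _ _ ?_ ?_)).trans
        ((HomotopyCategory.quotient 𝒜 (ComplexShape.down ℕ)).map_add)
    · simp
    · simp [Preadditive.comp_add, Preadditive.add_comp]

variable (𝒜) in
/-- The functor of projective resolutions represents short exact sequences by the degreewise split
sequences of complexes of the horseshoe lemma. -/
def projectiveSequenceResolution : SequenceResolution (projectiveResolutions 𝒜) := by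
  have h := fun (S : ShortComplex 𝒜) (hS : Conflation S) =>
    exists_projectiveRes_shortComplex S ((conflation_iff_shortExact S).1 hS)
  choose R hR using h
  let R₁ := fun S hS => ((R S hS).map ShortComplex.π₁ fun n => (hR S hS n).2.1)
  let R₂ := fun S hS => ((R S hS).map ShortComplex.π₂ fun n => (hR S hS n).2.2.1)
  let R₃ := fun S hS => ((R S hS).map ShortComplex.π₃ fun n => (hR S hS n).2.2.2)
  refine
    { res := fun S hS => complexSequence (R S hS).P
      split := fun S hS => degreewiseSplit_complexSequence _ fun n => (hR S hS n).1
      e := fun S hS => ShortComplex.isoMk (R₁ S hS).iso (R₂ S hS).iso (R₃ S hS).iso ?_ ?_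
      lift := fun S S' hS hS' φ => ?_ }
  · refine ((R₁ S hS).iso_hom_naturality S.f (R₂ S hS) (complexSequence (R S hS).P).f ?_).symm
    exact (R S hS).ε.comm₁₂.symm
  · refine ((R₂ S hS).iso_hom_naturality S.g (R₃ S hS) (complexSequence (R S hS).P).g ?_).symm
    exact (R S hS).ε.comm₂₃.symm
  · obtain ⟨ψ, hψ⟩ := (R S hS).exists_lift φ (R S' hS')
    refine ⟨complexSequenceMap ψ, ShortComplex.hom_ext _ _ ?_ ?_ ?_⟩
    · refine (R₁ S hS).iso_hom_naturality φ.τ₁ (R₁ S' hS') (complexSequenceMap ψ).τ₁ ?_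
      exact congrArg ShortComplex.Hom.τ₁ hψ
    · refine (R₂ S hS).iso_hom_naturality φ.τ₂ (R₂ S' hS') (complexSequenceMap ψ).τ₂ ?_
      exact congrArg ShortComplex.Hom.τ₂ hψ
    · refine (R₃ S hS).iso_hom_naturality φ.τ₃ (R₃ S' hS') (complexSequenceMap ψ).τ₃ ?_
      exact congrArg ShortComplex.Hom.τ₃ hψ

end ProjectiveResolutions

/-! ### Universality of effaceable `δ`-functors -/

section Universality

variable {𝒜 : Type*} [Category* 𝒜] {𝒟 : Type*} [Category* 𝒟] [Abelian 𝒟]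

/-- Extension of a sequence step by step: if each term determines the next one uniquely by a
relation, then there is exactly one sequence with given initial term. -/
theorem existsUnique_sequence {X : ℕ → Type*} (P : ∀ n, X n → X (n + 1) → Prop)
    (h : ∀ n x, ∃! y, P n x y) (x₀ : X 0) :
    ∃! f : ∀ n, X n, f 0 = x₀ ∧ ∀ n, P n (f n) (f (n + 1)) := by
  choose s hs hu using fun n x => h n x
  refine ⟨fun n => Nat.rec x₀ (fun k x => s k x) n, ⟨rfl, fun n => hs n _⟩, ?_⟩
  rintro g ⟨hg₀, hg⟩
  funext n
  induction n with
  | zero => exact hg₀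
  | succ k ih => exact (hu k (g k) _ (hg k)).trans (congrArg (s k) ih)

section Cohomological

variable [Abelian 𝒜] {R R' : ℕ → 𝒜 ⥤ 𝒟}

theorem CohomologicalDelta.epi_δ {d : CohomologicalDelta R} (hd : d.IsExact)
    {n : ℕ} (S : ShortComplex 𝒜) (hS : Conflation S)
    (hz : IsZero ((R (n + 1)).obj S.X₂)) : Epi (d.δ n S hS) :=
  ((hd S hS).2 n).2.2.epi_f (hz.eq_zero_of_tgt _)

/-- The connecting morphism `Rⁿ(I / A) ⟶ Rⁿ⁺¹(A)` is an epimorphism with kernel the image of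
`Rⁿ(I)`, so that a natural transformation on `Rⁿ` induces one on `Rⁿ⁺¹`. -/
theorem CohomologicalDelta.existsUnique_succ [EnoughInjectives 𝒜] {d : CohomologicalDelta R}
    (hd : d.IsExact) (hv : ∀ n I, Injective I → IsZero ((R (n + 1)).obj I))
    (d' : CohomologicalDelta R') (n : ℕ) (f : R n ⟶ R' n) :
    ∃! f' : R (n + 1) ⟶ R' (n + 1), ∀ (S : ShortComplex 𝒜) (hS : Conflation S),
      d.δ n S hS ≫ f'.app S.X₁ = f.app S.X₃ ≫ d'.δ n S hS := by
  let σ : 𝒜 → ShortComplex 𝒜 := fun A =>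
    ShortComplex.mk (Injective.ι A) (cokernel.π (Injective.ι A)) (cokernel.condition _)
  have hσ : ∀ A, Conflation (σ A) := fun A => conflation_cokernel (Injective.ι A)
  have hepi : ∀ A, Epi (d.δ n (σ A) (hσ A)) := fun A =>
    d.epi_δ hd (σ A) (hσ A) (hv n _ inferInstance)
  -- Every morphism `X₁ ⟶ B` extends to a morphism to the chosen sequence of `B`; this gives both
  -- the naturality of the extension and its compatibility with all connecting morphisms.
  have hext : ∀ (S : ShortComplex 𝒜) (_ : Conflation S) (B : 𝒜) (a : S.X₁ ⟶ B),
      ∃ φ : S ⟶ σ B, φ.τ₁ = a := by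
    intro S hS B a
    have hS' := (conflation_iff_shortExact S).1 hS
    have := hS'.mono_f
    let b : S.X₂ ⟶ Injective.under B := Injective.factorThru (a ≫ Injective.ι B) S.f
    have hb : S.f ≫ b = a ≫ Injective.ι B := Injective.comp_factorThru _ _
    have hc : S.f ≫ b ≫ cokernel.π (Injective.ι B) = 0 := by
      rw [← Category.assoc, hb, Category.assoc, cokernel.condition, comp_zero]
    have := hS'.epi_g
    exact ⟨⟨a, b, hS'.exact.desc _ hc, hb.symm, (hS'.exact.g_desc _ hc).symm⟩, rfl⟩
  have hdesc : ∀ A, ∃ t : (R (n + 1)).obj A ⟶ (R' (n + 1)).obj A,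
      d.δ n (σ A) (hσ A) ≫ t = f.app (σ A).X₃ ≫ d'.δ n (σ A) (hσ A) := by
    intro A
    have := hepi A
    have hex := ((hd (σ A) (hσ A)).2 n).2.1
    have : Epi (ShortComplex.mk _ _ (d.map_comp_δ n (σ A) (hσ A))).g := hepi A
    have hc : (R n).map (σ A).g ≫ f.app (σ A).X₃ ≫ d'.δ n (σ A) (hσ A) = 0 := by
      rw [← Category.assoc, f.naturality, Category.assoc, d'.map_comp_δ, comp_zero]
    exact ⟨hex.desc _ hc, hex.g_desc _ hc⟩
  choose t ht using hdesc
  have hcomm : ∀ (S : ShortComplex 𝒜) (hS : Conflation S) (B : 𝒜) (a : S.X₁ ⟶ B),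
      d.δ n S hS ≫ (R (n + 1)).map a ≫ t B = f.app S.X₃ ≫ d'.δ n S hS ≫ (R' (n + 1)).map a := by
    intro S hS B a
    obtain ⟨φ, rfl⟩ := hext S hS B a
    rw [← Category.assoc]
    refine (congrArg (· ≫ t B) (d.δ_naturality n S (σ B) hS (hσ B) φ)).trans ?_
    refine Eq.trans ?_ (congrArg (f.app S.X₃ ≫ ·) (d'.δ_naturality n S (σ B) hS (hσ B) φ)).symm
    refine (Category.assoc _ _ _).trans ?_
    rw [ht B]
    exact f.naturality_assoc φ.τ₃ _
  refine ⟨⟨t, fun A B a => ?_⟩, fun S hS => ?_, fun f' hf' => ?_⟩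
  · have := hepi A
    rw [← cancel_epi (d.δ n (σ A) (hσ A))]
    refine (hcomm (σ A) (hσ A) B a).trans ?_
    rw [← Category.assoc, ← Category.assoc, ht A]
  · have := hcomm S hS S.X₁ (𝟙 _)
    rwa [CategoryTheory.Functor.map_id, CategoryTheory.Functor.map_id, Category.id_comp,
      Category.comp_id] at this
  · ext A
    have := hepi A
    rw [← cancel_epi (d.δ n (σ A) (hσ A))]
    exact (hf' (σ A) (hσ A)).trans (ht A).symm

/-- An exact `δ`-functor that vanishes on injective objects in positive degrees is universal. -/
theorem CohomologicalDelta.isUniversal [EnoughInjectives 𝒜] {d : CohomologicalDelta R}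
    (hd : d.IsExact) (hv : ∀ n I, Injective I → IsZero ((R (n + 1)).obj I)) : d.IsUniversal :=
  fun _ d' f₀ => existsUnique_sequence _ (d.existsUnique_succ hd hv d') f₀

end Cohomological

section Homological

variable [Abelian 𝒜] {L L' : ℕ → 𝒜 ⥤ 𝒟}

theorem HomologicalDelta.mono_δ {d : HomologicalDelta L} (hd : d.IsExact)
    {n : ℕ} (S : ShortComplex 𝒜) (hS : Conflation S)
    (hz : IsZero ((L (n + 1)).obj S.X₂)) : Mono (d.δ n S hS) :=
  ((hd S hS).2 n).2.1.mono_g (hz.eq_zero_of_src _)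

/-- The connecting morphism `Lₙ₊₁(A) ⟶ Lₙ(Z)`, where `Z` is the kernel of `P ⟶ A`, is a
monomorphism with image the kernel of `Lₙ(Z) ⟶ Lₙ(P)`, so that a natural transformation to `Lₙ`
induces one to `Lₙ₊₁`. -/
theorem HomologicalDelta.existsUnique_succ [EnoughProjectives 𝒜] {d : HomologicalDelta L}
    (hd : d.IsExact) (hv : ∀ n P, Projective P → IsZero ((L (n + 1)).obj P))
    (d' : HomologicalDelta L') (n : ℕ) (f : L' n ⟶ L n) :
    ∃! f' : L' (n + 1) ⟶ L (n + 1), ∀ (S : ShortComplex 𝒜) (hS : Conflation S),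
      d'.δ n S hS ≫ f.app S.X₁ = f'.app S.X₃ ≫ d.δ n S hS := by
  let σ : 𝒜 → ShortComplex 𝒜 := fun A =>
    ShortComplex.mk (kernel.ι (Projective.π A)) (Projective.π A) (kernel.condition _)
  have hσ : ∀ A, Conflation (σ A) := fun A => conflation_kernel (Projective.π A)
  have hmono : ∀ A, Mono (d.δ n (σ A) (hσ A)) := fun A =>
    d.mono_δ hd (σ A) (hσ A) (hv n _ inferInstance)
  -- Every morphism `B ⟶ X₃` lifts to a morphism from the chosen sequence of `B`; this gives both
  -- the naturality of the extension and its compatibility with all connecting morphisms.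
  have hext : ∀ (S : ShortComplex 𝒜) (_ : Conflation S) (B : 𝒜) (a : B ⟶ S.X₃),
      ∃ φ : σ B ⟶ S, φ.τ₃ = a := by
    intro S hS B a
    have hS' := (conflation_iff_shortExact S).1 hS
    have := hS'.epi_g
    let b : Projective.over B ⟶ S.X₂ := Projective.factorThru (Projective.π B ≫ a) S.g
    have hb : b ≫ S.g = Projective.π B ≫ a := Projective.factorThru_comp _ _
    have hc : (kernel.ι (Projective.π B) ≫ b) ≫ S.g = 0 := by
      rw [Category.assoc, hb, kernel.condition_assoc, zero_comp]
    have := hS'.mono_f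
    exact ⟨⟨hS'.exact.lift _ hc, b, a, hS'.exact.lift_f _ hc, hb⟩, rfl⟩
  have hlift : ∀ A, ∃ t : (L' (n + 1)).obj A ⟶ (L (n + 1)).obj A,
      t ≫ d.δ n (σ A) (hσ A) = d'.δ n (σ A) (hσ A) ≫ f.app (σ A).X₁ := by
    intro A
    have hex := ((hd (σ A) (hσ A)).2 n).2.2
    have : Mono (ShortComplex.mk _ _ (d.δ_comp_map n (σ A) (hσ A))).f := hmono A
    have hc : (d'.δ n (σ A) (hσ A) ≫ f.app (σ A).X₁) ≫ (L n).map (σ A).f = 0 := by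
      rw [Category.assoc, ← f.naturality, ← Category.assoc, d'.δ_comp_map, zero_comp]
    exact ⟨hex.lift _ hc, hex.lift_f _ hc⟩
  choose t ht using hlift
  have hcomm : ∀ (S : ShortComplex 𝒜) (hS : Conflation S) (B : 𝒜) (a : B ⟶ S.X₃),
      (t B ≫ (L (n + 1)).map a) ≫ d.δ n S hS =
        ((L' (n + 1)).map a ≫ d'.δ n S hS) ≫ f.app S.X₁ := by
    intro S hS B a
    obtain ⟨φ, rfl⟩ := hext S hS B a
    rw [Category.assoc]
    refine (congrArg (t B ≫ ·) (d.δ_naturality n (σ B) S (hσ B) hS φ)).symm.trans ?_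
    refine Eq.trans ?_ (congrArg (· ≫ f.app S.X₁) (d'.δ_naturality n (σ B) S (hσ B) hS φ))
    rw [← Category.assoc, ht B, Category.assoc, Category.assoc, f.naturality]
  refine ⟨⟨t, fun A B a => ?_⟩, fun S hS => ?_, fun f' hf' => ?_⟩
  · have := hmono B
    rw [← cancel_mono (d.δ n (σ B) (hσ B))]
    refine Eq.trans ?_ (hcomm (σ B) (hσ B) A a).symm
    rw [Category.assoc, Category.assoc]
    exact congrArg ((L' (n + 1)).map a ≫ ·) (ht B)
  · have := hcomm S hS S.X₃ (𝟙 _)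
    rw [CategoryTheory.Functor.map_id, CategoryTheory.Functor.map_id, Category.id_comp,
      Category.comp_id] at this
    exact this.symm
  · ext A
    have := hmono A
    rw [← cancel_mono (d.δ n (σ A) (hσ A))]
    exact (hf' (σ A) (hσ A)).symm.trans (ht A).symm

/-- An exact `δ`-functor that vanishes on projective objects in positive degrees is universal. -/
theorem HomologicalDelta.isUniversal [EnoughProjectives 𝒜] {d : HomologicalDelta L}
    (hd : d.IsExact) (hv : ∀ n P, Projective P → IsZero ((L (n + 1)).obj P)) : d.IsUniversal :=
  fun _ d' f₀ => existsUnique_sequence _ (d.existsUnique_succ hd hv d') f₀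

end Homological

section Uniqueness

variable [Preadditive 𝒜] {R R' : ℕ → 𝒜 ⥤ 𝒟}

/-- An endomorphism of a universal `δ`-functor is determined by its term in degree `0`. -/
theorem CohomologicalDelta.IsUniversal.comp_eq_id {d : CohomologicalDelta R}
    (h : d.IsUniversal) {d' : CohomologicalDelta R'} {f : ∀ n, R n ⟶ R' n} {g : ∀ n, R' n ⟶ R n}
    (hf : ∀ (n : ℕ) (S : ShortComplex 𝒜) (hS : Conflation S),
      d.δ n S hS ≫ (f (n + 1)).app S.X₁ = (f n).app S.X₃ ≫ d'.δ n S hS)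
    (hg : ∀ (n : ℕ) (S : ShortComplex 𝒜) (hS : Conflation S),
      d'.δ n S hS ≫ (g (n + 1)).app S.X₁ = (g n).app S.X₃ ≫ d.δ n S hS)
    (h₀ : f 0 ≫ g 0 = 𝟙 _) (n : ℕ) : f n ≫ g n = 𝟙 _ := by
  refine congrFun ((h R d (𝟙 _)).unique (y₁ := fun n => f n ≫ g n) (y₂ := fun n => 𝟙 _)
    ⟨h₀, fun n S hS => ?_⟩ ⟨rfl, fun n S hS => ?_⟩) n
  · rw [NatTrans.comp_app, NatTrans.comp_app, ← Category.assoc, hf, Category.assoc, hg,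
      Category.assoc]
  · rw [NatTrans.id_app, NatTrans.id_app, Category.comp_id, Category.id_comp]

/-- Universal `δ`-functors with isomorphic terms in degree `0` are isomorphic. -/
theorem CohomologicalDelta.IsUniversal.nonempty_iso {d : CohomologicalDelta R}
    (h : d.IsUniversal) {d' : CohomologicalDelta R'} (h' : d'.IsUniversal) (e : R 0 ≅ R' 0)
    (n : ℕ) : Nonempty (R n ≅ R' n) := by
  obtain ⟨f, ⟨hf₀, hf⟩, -⟩ := h R' d' e.hom
  obtain ⟨g, ⟨hg₀, hg⟩, -⟩ := h' R d e.inv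
  exact ⟨⟨f n, g n, h.comp_eq_id hf hg (by rw [hf₀, hg₀, e.hom_inv_id]) n,
    h'.comp_eq_id hg hf (by rw [hf₀, hg₀, e.inv_hom_id]) n⟩⟩

theorem ComputedByInjectives.of_iso {G : 𝒜 ⥤ 𝒟} [G.Additive] (h : ComputedByInjectives G R)
    (i : ∀ n, R' n ≅ R n) : ComputedByInjectives G R' := by
  obtain ⟨h₁, e, he⟩ := h
  refine ⟨h₁, fun A I r => (i r).app A ≪≫ e A I r, fun A A' f I I' φ hφ r => ?_⟩
  have := he A A' f I I' φ hφ r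
  rw [Iso.trans_hom, Iso.trans_hom, Iso.app_hom, Iso.app_hom, ← Category.assoc,
    (i r).hom.naturality, Category.assoc, this, Category.assoc]

end Uniqueness

end Universality

/-! ### Derived functors in one variable -/

section DerivedFunctors

variable {𝒜 : Type*} [Category* 𝒜] {𝒟 : Type*} [Category* 𝒟] [Abelian 𝒟]

section HomotopyCategory

variable [Preadditive 𝒜] {ι : Type*} (c : ComplexShape ι)

/-- The homology of `G(K)` as a functor of `K` in the homotopy category. -/
abbrev homologyOfMap (G : 𝒜 ⥤ 𝒟) [G.Additive] (i : ι) : HomotopyCategory 𝒜 c ⥤ 𝒟 :=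
  G.mapHomotopyCategory c ⋙ HomotopyCategory.homologyFunctor 𝒟 c i

/-- The homology of `G(K)` has connecting morphisms. -/
def homologyOfMapDelta (G : 𝒜 ⥤ 𝒟) [G.Additive] : SplitDelta (homologyOfMap c G) :=
  SplitDelta.ofComplexes _ (G.mapHomologicalComplex c)
    (fun _ hT => HomologicalComplex.shortExact_of_degreewise_shortExact _ fun i =>
      ((hT i).some.map G).shortExact)
    (fun i K => (HomotopyCategory.homologyFunctorFactors 𝒟 c i).app
      ((G.mapHomologicalComplex c).obj K))
    (fun i _ _ f => (HomotopyCategory.homologyFunctorFactors 𝒟 c i).hom.naturality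
      ((G.mapHomologicalComplex c).map f))

end HomotopyCategory

section Exactness

variable [Abelian 𝒜] {G : 𝒜 ⥤ 𝒟} [G.Additive]

theorem IsLeftExact.preservesFiniteLimits (hG : IsLeftExact G) : PreservesFiniteLimits G :=
  (G.preservesFiniteLimits_tfae.out 0 3).1
    fun S hS => (hG S ((conflation_iff_shortExact S).2 hS)).symm

theorem IsRightExact.preservesFiniteColimits (hG : IsRightExact G) : PreservesFiniteColimits G :=
  (G.preservesFiniteColimits_tfae.out 0 3).1
    fun S hS => hG S ((conflation_iff_shortExact S).2 hS)

end Exactness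

section RightDerived

variable [Abelian 𝒜] [EnoughInjectives 𝒜] (G : 𝒜 ⥤ 𝒟) [G.Additive]

theorem computedByInjectives_rightDerived : ComputedByInjectives G G.rightDerived := by
  refine ⟨InjectiveRes.nonempty, fun A I r => I.toInjectiveResolution.isoRightDerivedObj G r,
    fun A A' f I I' φ hφ r => ?_⟩
  refine InjectiveResolution.isoRightDerivedObj_hom_naturality f I.toInjectiveResolution
    I'.toInjectiveResolution φ ?_ G r
  rw [I.toInjectiveResolution_ι_f_zero, I'.toInjectiveResolution_ι_f_zero]
  exact hφ

variable {G} in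
theorem isRightDerived_rightDerived (hG : IsLeftExact G) : IsRightDerived G G.rightDerived := by
  have := hG.preservesFiniteLimits
  have hd := (injectiveSequenceResolution 𝒜).cohomologicalDelta_isExact
    (homologyOfMapDelta (ComplexShape.up ℕ) G)
  exact ⟨⟨G.rightDerivedZeroIsoSelf⟩, ⟨_, hd, CohomologicalDelta.isUniversal hd
    fun n I _ => G.isZero_rightDerived_obj_injective_succ n I⟩, computedByInjectives_rightDerived G⟩

end RightDerived

section LeftDerived

variable [Abelian 𝒜] [EnoughProjectives 𝒜] (G : 𝒜 ⥤ 𝒟) [G.Additive]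

theorem computedByProjectives_leftDerived : ComputedByProjectives G G.leftDerived := by
  refine ⟨ProjectiveRes.nonempty, fun A P r => P.toProjectiveResolution.isoLeftDerivedObj G r,
    fun A A' f P P' φ hφ r => ?_⟩
  refine ProjectiveResolution.isoLeftDerivedObj_hom_naturality f P.toProjectiveResolution
    P'.toProjectiveResolution φ ?_ G r
  rw [P.toProjectiveResolution_π_f_zero, P'.toProjectiveResolution_π_f_zero]
  exact hφ

variable {G} in
theorem isLeftDerived_leftDerived (hG : IsRightExact G) : IsLeftDerived G G.leftDerived := by
  have := hG.preservesFiniteColimits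
  have hd := (projectiveSequenceResolution 𝒜).homologicalDelta_isExact
    (homologyOfMapDelta (ComplexShape.down ℕ) G)
  exact ⟨⟨G.leftDerivedZeroIsoSelf⟩, ⟨_, hd, HomologicalDelta.isUniversal hd
    fun n P _ => G.isZero_leftDerived_obj_projective_succ n P⟩, computedByProjectives_leftDerived G⟩

end LeftDerived

section Additivity

variable {ℬ : Type*} [Category* ℬ] [Preadditive ℬ]

theorem additive_of_mono {F G : ℬ ⥤ 𝒟} (α : F ⟶ G) [Mono α] [G.Additive] : F.Additive where
  map_add {X Y f g} := by
    have : Mono (α.app Y) := (NatTrans.mono_iff_mono_app α).1 inferInstance Y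
    rw [← cancel_mono (α.app Y), Preadditive.add_comp]
    simp only [α.naturality, G.map_add, Preadditive.comp_add]

theorem additive_of_epi {F G : ℬ ⥤ 𝒟} (α : F ⟶ G) [Epi α] [F.Additive] : G.Additive where
  map_add {X Y f g} := by
    have : Epi (α.app X) := (NatTrans.epi_iff_epi_app α).1 inferInstance X
    rw [← cancel_epi (α.app X), Preadditive.comp_add]
    simp only [← α.naturality, F.map_add, Preadditive.add_comp]

/-- Additive functors are closed under subobjects and quotients, hence under homology. -/
theorem additive_homology {ι : Type*} {c : ComplexShape ι} (K : HomologicalComplex (ℬ ⥤ 𝒟) c)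
    (h : ∀ i, (K.X i).Additive) (i : ι) : (K.homology i).Additive := by
  have := h i
  have : (K.cycles i).Additive := additive_of_mono (K.iCycles i)
  exact additive_of_epi (K.homologyπ i)

variable [Abelian 𝒜] (G : 𝒜 ⥤ ℬ ⥤ 𝒟) [G.Additive] [∀ A, (G.obj A).Additive]

theorem additive_rightDerived_obj [EnoughInjectives 𝒜] (r : ℕ) (A : 𝒜) :
    ((G.rightDerived r).obj A).Additive := by
  have h := additive_homology ((G.mapHomologicalComplex (ComplexShape.up ℕ)).obj
    (injectiveResolution A).cocomplex) (fun i => inferInstanceAs (G.obj _).Additive) r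
  exact @Functor.additive_of_iso _ _ _ _ _ _ _ h _
    ((injectiveResolution A).isoRightDerivedObj G r).symm

theorem additive_leftDerived_obj [EnoughProjectives 𝒜] (r : ℕ) (A : 𝒜) :
    ((G.leftDerived r).obj A).Additive := by
  have h := additive_homology ((G.mapHomologicalComplex (ComplexShape.down ℕ)).obj
    (projectiveResolution A).complex) (fun i => inferInstanceAs (G.obj _).Additive) r
  exact @Functor.additive_of_iso _ _ _ _ _ _ _ h _
    ((projectiveResolution A).isoLeftDerivedObj G r).symm

end Additivity

end DerivedFunctors

/-! ### The homology of total complexes -/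

section Total

open HomologicalComplex

variable {𝒜 : Type*} [Category* 𝒜] [Preadditive 𝒜] {ℬ : Type*} [Category* ℬ] [Preadditive ℬ]
variable {𝒟 : Type*} [Category* 𝒟]
variable {ι : Type*} {c : ComplexShape ι}

/-- A bifunctor on complexes that is invariant under homotopies in both variables, as a bifunctor on
homotopy categories. -/
def liftHomotopy (B : HomologicalComplex 𝒜 c ⥤ HomologicalComplex ℬ c ⥤ 𝒟)
    (h₁ : ∀ {K K' : HomologicalComplex 𝒜 c} (f g : K ⟶ K'), Homotopy f g → ∀ L,
      (B.map f).app L = (B.map g).app L)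
    (h₂ : ∀ (K : HomologicalComplex 𝒜 c) {L L' : HomologicalComplex ℬ c} (f g : L ⟶ L'),
      Homotopy f g → (B.obj K).map f = (B.obj K).map g) :
    HomotopyCategory 𝒜 c ⥤ HomotopyCategory ℬ c ⥤ 𝒟 :=
  CategoryTheory.Quotient.lift _
    { obj := fun K => CategoryTheory.Quotient.lift _ (B.obj K) fun _ _ f g ⟨h⟩ => h₂ K f g h
      map := fun f => CategoryTheory.Quotient.natTransLift _ (B.map f)
      map_id := fun K => CategoryTheory.Quotient.natTrans_ext _ _ (B.map_id K)
      map_comp := fun f g => CategoryTheory.Quotient.natTrans_ext _ _ (B.map_comp f g) }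
    fun _ _ f g ⟨h⟩ => CategoryTheory.Quotient.natTrans_ext _ _
      (NatTrans.ext (funext fun L => h₁ f g h L))

variable [Abelian 𝒟] [DecidableEq ι] [TotalComplexShape c c c]
variable (F : 𝒜 ⥤ ℬ ⥤ 𝒟) [F.Additive] [∀ A, (F.obj A).Additive]
variable [∀ (K : HomologicalComplex 𝒜 c) (L : HomologicalComplex ℬ c), HasMapBifunctor K L F c]

variable (c) in
/-- The homology of the total complex of `F(K, L)`, as a bifunctor on homotopy categories. -/
def totalHomology (n : ι) : HomotopyCategory 𝒜 c ⥤ HomotopyCategory ℬ c ⥤ 𝒟 :=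
  liftHomotopy (F.map₂HomologicalComplex c c c ⋙
      (Functor.whiskeringRight _ _ _).obj (homologyFunctor 𝒟 c n))
    (fun _ _ h L => (mapBifunctorMapHomotopy₁ h (𝟙 L) F c).homologyMap_eq n)
    (fun K _ _ _ _ h => (mapBifunctorMapHomotopy₂ (𝟙 K) h F c).homologyMap_eq n)

theorem totalHomology_map_app (n : ι) {K K' : HomologicalComplex 𝒜 c} (f : K ⟶ K')
    {L L' : HomologicalComplex ℬ c} (g : L ⟶ L') :
    ((totalHomology c F n).map ((HomotopyCategory.quotient 𝒜 c).map f)).app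
        ((HomotopyCategory.quotient ℬ c).obj L) ≫
      ((totalHomology c F n).obj ((HomotopyCategory.quotient 𝒜 c).obj K')).map
        ((HomotopyCategory.quotient ℬ c).map g) =
      homologyMap (mapBifunctorMap f g F c) n := by
  refine (homologyMap_comp (mapBifunctorMap f (𝟙 L) F c)
    (mapBifunctorMap (𝟙 K') g F c) n).symm.trans (congrArg (homologyMap · n) ?_)
  ext
  simp

section Graded

variable {K K' K'' : HomologicalComplex 𝒜 c} {L L' L'' : HomologicalComplex ℬ c}

/-- The morphism in degree `n` of total complexes that is induced by morphisms of graded objects.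
As these need not commute with the differentials, it applies to degreewise splittings. -/
def totalMap (a : ∀ i, K.X i ⟶ K'.X i) (b : ∀ i, L.X i ⟶ L'.X i) (n : ι) :
    (mapBifunctor K L F c).X n ⟶ (mapBifunctor K' L' F c).X n :=
  mapBifunctorDesc fun i j h => (F.map (a i)).app _ ≫ (F.obj _).map (b j) ≫
    ιMapBifunctor K' L' F c i j n h

theorem ι_totalMap (a : ∀ i, K.X i ⟶ K'.X i) (b : ∀ i, L.X i ⟶ L'.X i) (n i j : ι)
    (h : ComplexShape.π c c c (i, j) = n) :
    ιMapBifunctor K L F c i j n h ≫ totalMap F a b n = (F.map (a i)).app _ ≫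
      (F.obj _).map (b j) ≫ ιMapBifunctor K' L' F c i j n h :=
  ι_mapBifunctorDesc _ _ _ _

theorem mapBifunctorMap_f (a : K ⟶ K') (b : L ⟶ L') (n : ι) :
    (mapBifunctorMap a b F c).f n = totalMap F a.f b.f n :=
  mapBifunctor.hom_ext fun _ _ _ => (ι_mapBifunctorMap _ _ _ _ _ _ _ _).trans
    (ι_totalMap F _ _ _ _ _ _).symm

theorem totalMap_comp (a : ∀ i, K.X i ⟶ K'.X i) (b : ∀ i, L.X i ⟶ L'.X i)
    (a' : ∀ i, K'.X i ⟶ K''.X i) (b' : ∀ i, L'.X i ⟶ L''.X i) (n : ι) :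
    totalMap F a b n ≫ totalMap F a' b' n =
      totalMap F (fun i => a i ≫ a' i) (fun i => b i ≫ b' i) n :=
  mapBifunctor.hom_ext fun i j h => by
    rw [← Category.assoc, ι_totalMap, ι_totalMap, Category.assoc, Category.assoc, ι_totalMap]
    simp

theorem totalMap_id (n : ι) :
    totalMap F (fun i => 𝟙 (K.X i)) (fun i => 𝟙 (L.X i)) n = 𝟙 _ :=
  mapBifunctor.hom_ext fun i j h => by
    rw [ι_totalMap]
    simp

theorem totalMap_add_left (a a' : ∀ i, K.X i ⟶ K'.X i) (b : ∀ i, L.X i ⟶ L'.X i) (n : ι) :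
    totalMap F (fun i => a i + a' i) b n = totalMap F a b n + totalMap F a' b n :=
  mapBifunctor.hom_ext fun i j h => by
    rw [Preadditive.comp_add, ι_totalMap, ι_totalMap, ι_totalMap, F.map_add, NatTrans.app_add,
      Preadditive.add_comp]

theorem totalMap_add_right (a : ∀ i, K.X i ⟶ K'.X i) (b b' : ∀ i, L.X i ⟶ L'.X i) (n : ι) :
    totalMap F a (fun i => b i + b' i) n = totalMap F a b n + totalMap F a b' n :=
  mapBifunctor.hom_ext fun i j h => by
    rw [Preadditive.comp_add, ι_totalMap, ι_totalMap, ι_totalMap, (F.obj _).map_add,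
      Preadditive.add_comp, Preadditive.comp_add]

end Graded

instance map₂HomologicalComplex_obj_additive (K : HomologicalComplex 𝒜 c) :
    ((F.map₂HomologicalComplex c c c).obj K).Additive where
  map_add {L L' f g} := by
    ext n : 1
    exact (mapBifunctorMap_f F (𝟙 K) (f + g) n).trans ((totalMap_add_right F _ _ _ n).trans
      (congrArg₂ (· + ·) (mapBifunctorMap_f F (𝟙 K) f n) (mapBifunctorMap_f F (𝟙 K) g n)).symm)

instance map₂HomologicalComplex_flip_obj_additive (L : HomologicalComplex ℬ c) :
    ((F.map₂HomologicalComplex c c c).flip.obj L).Additive where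
  map_add {K K' f g} := by
    ext n : 1
    exact (mapBifunctorMap_f F (f + g) (𝟙 L) n).trans ((totalMap_add_left F _ _ _ n).trans
      (congrArg₂ (· + ·) (mapBifunctorMap_f F f (𝟙 L) n) (mapBifunctorMap_f F g (𝟙 L) n)).symm)

/-- Splittings in each degree of `T` induce splittings in each degree of the total complexes. -/
theorem shortExact_total_left (T : ShortComplex (HomologicalComplex 𝒜 c)) (hT : DegreewiseSplit T)
    (L : HomologicalComplex ℬ c) :
    (T.map ((F.map₂HomologicalComplex c c c).flip.obj L)).ShortExact := by
  refine shortExact_of_degreewise_shortExact _ fun n => ?_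
  have hf : (mapBifunctorMap T.f (𝟙 L) F c).f n = totalMap F T.f.f (fun i => 𝟙 (L.X i)) n :=
    mapBifunctorMap_f F T.f (𝟙 L) n
  have hg : (mapBifunctorMap T.g (𝟙 L) F c).f n = totalMap F T.g.f (fun i => 𝟙 (L.X i)) n :=
    mapBifunctorMap_f F T.g (𝟙 L) n
  have s := fun i => (hT i).some
  refine ShortComplex.Splitting.shortExact
    { r := totalMap F (fun i => (s i).r) (fun i => 𝟙 (L.X i)) n
      s := totalMap F (fun i => (s i).s) (fun i => 𝟙 (L.X i)) n
      f_r := ?_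
      s_g := ?_
      id := ?_ }
  · refine (congrArg (· ≫ _) hf).trans ((totalMap_comp F _ _ _ _ n).trans ?_)
    refine Eq.trans ?_ (totalMap_id F n)
    congr 1 <;> funext i
    · exact (s i).f_r
    · exact Category.id_comp _
  · refine (congrArg (_ ≫ ·) hg).trans ((totalMap_comp F _ _ _ _ n).trans ?_)
    refine Eq.trans ?_ (totalMap_id F n)
    congr 1 <;> funext i
    · exact (s i).s_g
    · exact Category.id_comp _
  · refine Eq.trans (congrArg₂ (· + ·) ((congrArg (_ ≫ ·) hf).trans (totalMap_comp F _ _ _ _ n))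
      ((congrArg (· ≫ _) hg).trans (totalMap_comp F _ _ _ _ n))) ?_
    refine (totalMap_add_left F _ _ _ n).symm.trans (Eq.trans ?_ (totalMap_id F n))
    congr 1 <;> funext i
    · exact (s i).id
    · exact Category.id_comp _

/-- Splittings in each degree of `T` induce splittings in each degree of the total complexes. -/
theorem shortExact_total_right (K : HomologicalComplex 𝒜 c)
    (T : ShortComplex (HomologicalComplex ℬ c)) (hT : DegreewiseSplit T) :
    (T.map ((F.map₂HomologicalComplex c c c).obj K)).ShortExact := by
  refine shortExact_of_degreewise_shortExact _ fun n => ?_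
  have hf : (mapBifunctorMap (𝟙 K) T.f F c).f n = totalMap F (fun i => 𝟙 (K.X i)) T.f.f n :=
    mapBifunctorMap_f F (𝟙 K) T.f n
  have hg : (mapBifunctorMap (𝟙 K) T.g F c).f n = totalMap F (fun i => 𝟙 (K.X i)) T.g.f n :=
    mapBifunctorMap_f F (𝟙 K) T.g n
  have s := fun i => (hT i).some
  refine ShortComplex.Splitting.shortExact
    { r := totalMap F (fun i => 𝟙 (K.X i)) (fun i => (s i).r) n
      s := totalMap F (fun i => 𝟙 (K.X i)) (fun i => (s i).s) n
      f_r := ?_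
      s_g := ?_
      id := ?_ }
  · refine (congrArg (· ≫ _) hf).trans ((totalMap_comp F _ _ _ _ n).trans ?_)
    refine Eq.trans ?_ (totalMap_id F n)
    congr 1 <;> funext i
    · exact Category.id_comp _
    · exact (s i).f_r
  · refine (congrArg (_ ≫ ·) hg).trans ((totalMap_comp F _ _ _ _ n).trans ?_)
    refine Eq.trans ?_ (totalMap_id F n)
    congr 1 <;> funext i
    · exact Category.id_comp _
    · exact (s i).s_g
  · refine Eq.trans (congrArg₂ (· + ·) ((congrArg (_ ≫ ·) hf).trans (totalMap_comp F _ _ _ _ n))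
      ((congrArg (· ≫ _) hg).trans (totalMap_comp F _ _ _ _ n))) ?_
    have hid : (fun i => 𝟙 (K.X i) ≫ 𝟙 (K.X i)) = fun i => 𝟙 (K.X i) :=
      funext fun i => Category.id_comp _
    rw [hid]
    refine (totalMap_add_right F _ _ _ n).symm.trans (Eq.trans ?_ (totalMap_id F n))
    congr 1
    funext i
    exact (s i).id

instance totalHomology_obj_additive (n : ι) (K : HomotopyCategory 𝒜 c) :
    ((totalHomology c F n).obj K).Additive where
  map_add {L L' f g} := by
    obtain ⟨f, rfl⟩ := (HomotopyCategory.quotient ℬ c).map_surjective f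
    obtain ⟨g, rfl⟩ := (HomotopyCategory.quotient ℬ c).map_surjective g
    exact ((F.map₂HomologicalComplex c c c).obj K.as ⋙ homologyFunctor 𝒟 c n).map_add

instance totalHomology_additive (n : ι) : (totalHomology c F n).Additive where
  map_add {K K' f g} := by
    obtain ⟨f, rfl⟩ := (HomotopyCategory.quotient 𝒜 c).map_surjective f
    obtain ⟨g, rfl⟩ := (HomotopyCategory.quotient 𝒜 c).map_surjective g
    ext L
    exact ((F.map₂HomologicalComplex c c c).flip.obj L.as ⋙ homologyFunctor 𝒟 c n).map_add

/-- The connecting morphisms of the homology of total complexes in the first variable. -/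
def totalHomologyDelta : SplitDelta (totalHomology c F) :=
  SplitDelta.ofPointwise _
    (fun L => SplitDelta.ofComplexes _ ((F.map₂HomologicalComplex c c c).flip.obj L.as)
      (fun T hT => shortExact_total_left F T hT L.as) (fun _ _ => Iso.refl _)
      (fun _ _ _ _ => (Category.comp_id _).trans (Category.id_comp _).symm))
    (by
      intro L L' g i j hij T hT
      obtain ⟨g, rfl⟩ := (HomotopyCategory.quotient ℬ c).map_surjective g
      have h := HomologySequence.δ_naturality (ShortComplex.Hom.mk
        (((F.map₂HomologicalComplex c c c).obj T.X₁).map g)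
        (((F.map₂HomologicalComplex c c c).obj T.X₂).map g)
        (((F.map₂HomologicalComplex c c c).obj T.X₃).map g)
        (((F.map₂HomologicalComplex c c c).map T.f).naturality g)
        (((F.map₂HomologicalComplex c c c).map T.g).naturality g))
        (shortExact_total_left F T hT L.as) (shortExact_total_left F T hT L'.as) i j hij
      have e : ∀ (L : HomologicalComplex ℬ c),
          𝟙 _ ≫ (shortExact_total_left F T hT L).δ i j hij ≫ 𝟙 _ =
            (shortExact_total_left F T hT L).δ i j hij :=
        fun L => (Category.id_comp _).trans (Category.comp_id _)
      exact (congrArg (_ ≫ ·) (e L'.as)).trans (h.symm.trans (congrArg (· ≫ _) (e L.as)).symm))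

/-- The connecting morphisms of the homology of total complexes in the second variable. -/
def totalHomologyFlipDelta : SplitDelta (fun n => (totalHomology c F n).flip) :=
  SplitDelta.ofPointwise _
    (fun K => SplitDelta.ofComplexes _ ((F.map₂HomologicalComplex c c c).obj K.as)
      (fun T hT => shortExact_total_right F K.as T hT) (fun _ _ => Iso.refl _)
      (fun _ _ _ _ => (Category.comp_id _).trans (Category.id_comp _).symm))
    (by
      intro K K' f i j hij T hT
      obtain ⟨f, rfl⟩ := (HomotopyCategory.quotient 𝒜 c).map_surjective f
      have h := HomologySequence.δ_naturality (ShortComplex.Hom.mk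
        (((F.map₂HomologicalComplex c c c).map f).app T.X₁)
        (((F.map₂HomologicalComplex c c c).map f).app T.X₂)
        (((F.map₂HomologicalComplex c c c).map f).app T.X₃)
        (((F.map₂HomologicalComplex c c c).map f).naturality T.f).symm
        (((F.map₂HomologicalComplex c c c).map f).naturality T.g).symm)
        (shortExact_total_right F K.as T hT) (shortExact_total_right F K'.as T hT) i j hij
      have e : ∀ (K : HomologicalComplex 𝒜 c),
          𝟙 _ ≫ (shortExact_total_right F K T hT).δ i j hij ≫ 𝟙 _ =
            (shortExact_total_right F K T hT).δ i j hij :=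
        fun K => (Category.id_comp _).trans (Category.comp_id _)
      exact (congrArg (_ ≫ ·) (e K'.as)).trans (h.symm.trans (congrArg (· ≫ _) (e K.as)).symm))

end Total

/-! ### Total complexes in low degrees and of concentrated complexes -/

section Bimap

variable {𝒜 ℬ 𝒟 : Type*} [Category* 𝒜] [Category* ℬ] [Category* 𝒟] (F : 𝒜 ⥤ ℬ ⥤ 𝒟)
variable {A A' A'' : 𝒜} {B B' B'' : ℬ}

/-- The action of a bifunctor on a pair of morphisms. -/
def bimap (f : A ⟶ A') (g : B ⟶ B') : (F.obj A).obj B ⟶ (F.obj A').obj B' :=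
  (F.map f).app B ≫ (F.obj A').map g

theorem bimap_comp_bimap (f : A ⟶ A') (f' : A' ⟶ A'') (g : B ⟶ B') (g' : B' ⟶ B'') :
    bimap F f g ≫ bimap F f' g' = bimap F (f ≫ f') (g ≫ g') := by
  simp [bimap]

theorem bimap_id_right (f : A ⟶ A') : bimap F f (𝟙 B) = (F.map f).app B := by
  simp [bimap]

theorem bimap_id_left (g : B ⟶ B') : bimap F (𝟙 A) g = (F.obj A).map g := by
  simp [bimap]

/-- Isomorphisms in both variables induce an isomorphism. -/
def bimapIso (e : A ≅ A') (e' : B ≅ B') : (F.obj A).obj B ≅ (F.obj A').obj B' where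
  hom := bimap F e.hom e'.hom
  inv := bimap F e.inv e'.inv
  hom_inv_id := by
    rw [bimap_comp_bimap, e.hom_inv_id, e'.hom_inv_id, bimap_id_left,
      CategoryTheory.Functor.map_id]
  inv_hom_id := by
    rw [bimap_comp_bimap, e.inv_hom_id, e'.inv_hom_id, bimap_id_left,
      CategoryTheory.Functor.map_id]

/-- An isomorphism of bifunctors from isomorphisms that are natural in pairs of morphisms. -/
def bifunctorIso {F G : 𝒜 ⥤ ℬ ⥤ 𝒟} (e : ∀ A B, (F.obj A).obj B ≅ (G.obj A).obj B)
    (h : ∀ {A A' B B'} (f : A ⟶ A') (g : B ⟶ B'),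
      bimap F f g ≫ (e A' B').hom = (e A B).hom ≫ bimap G f g) : F ≅ G :=
  NatIso.ofComponents (fun A => NatIso.ofComponents (e A) fun {B B'} g => by
      simpa only [bimap_id_left] using h (𝟙 A) g)
    fun {A A'} f => by
      ext B
      have := h f (𝟙 B)
      rw [bimap_id_right, bimap_id_right] at this
      exact this

end Bimap

section Total

open HomologicalComplex

variable {𝒜 : Type*} [Category* 𝒜] [Preadditive 𝒜] {ℬ : Type*} [Category* ℬ] [Preadditive ℬ]
variable {𝒟 : Type*} [Category* 𝒟] [Abelian 𝒟]
variable (F : 𝒜 ⥤ ℬ ⥤ 𝒟) [F.Additive] [∀ A, (F.obj A).Additive]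

section Shape

variable {c : ComplexShape ℕ} [c.TensorSigns]
variable [∀ (K : HomologicalComplex 𝒜 c) (L : HomologicalComplex ℬ c), HasMapBifunctor K L F c]
variable (K : HomologicalComplex 𝒜 c) (L : HomologicalComplex ℬ c)

/-- If only one summand in degree `n` is nonzero, its inclusion is an isomorphism. -/
theorem isIso_ιMapBifunctor (a b n : ℕ) (h : ComplexShape.π c c c (a, b) = n)
    (hz : ∀ i j, ComplexShape.π c c c (i, j) = n → (i, j) ≠ (a, b) →
      IsZero ((F.obj (K.X i)).obj (L.X j))) : IsIso (ιMapBifunctor K L F c a b n h) := by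
  let r : (mapBifunctor K L F c).X n ⟶ (F.obj (K.X a)).obj (L.X b) :=
    mapBifunctorDesc fun i j _ => if e : (i, j) = (a, b) then
      eqToHom (congrArg (fun p : ℕ × ℕ => (F.obj (K.X p.1)).obj (L.X p.2)) e) else 0
  have hr : ιMapBifunctor K L F c a b n h ≫ r = 𝟙 _ :=
    (ι_mapBifunctorDesc _ a b h).trans (dif_pos rfl)
  refine ⟨r, hr, mapBifunctor.hom_ext fun i j h' => ?_⟩
  by_cases e : (i, j) = (a, b)
  · obtain ⟨rfl, rfl⟩ := Prod.mk.inj e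
    rw [reassoc_of% hr, Category.comp_id]
  · exact (hz i j h' e).eq_of_src _ _

/-- The differential of the total complex on a summand. -/
theorem ι_mapBifunctor_d (i j n n' : ℕ) (h : ComplexShape.π c c c (i, j) = n) :
    ιMapBifunctor K L F c i j n h ≫ (mapBifunctor K L F c).d n n' =
      mapBifunctor.d₁ K L F c i j n' + mapBifunctor.d₂ K L F c i j n' := by
  rw [mapBifunctor.d_eq, Preadditive.comp_add, mapBifunctor.ι_D₁, mapBifunctor.ι_D₂]

theorem ι_zero_left_d (hd : ∀ i, K.d 0 i = 0) (n n' : ℕ) (hn : c.Rel n n') :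
    ιMapBifunctor K L F c 0 n n (zero_add n) ≫ (mapBifunctor K L F c).d n n' =
      (F.obj (K.X 0)).map (L.d n n') ≫ ιMapBifunctor K L F c 0 n' n' (zero_add n') := by
  have h₁ : mapBifunctor.d₁ K L F c 0 n n' = 0 := by
    by_cases hr : c.Rel 0 (c.next 0)
    · rw [mapBifunctor.d₁_eq' K L F c hr, hd, F.map_zero, zero_app, zero_comp, smul_zero]
    · exact mapBifunctor.d₁_eq_zero _ _ _ _ _ _ _ hr
  have hε : ComplexShape.ε₂ c c c (0, n) = 1 := c.ε_zero
  rw [ι_mapBifunctor_d, h₁, zero_add, mapBifunctor.d₂_eq K L F c 0 hn n' (zero_add n'), hε,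
    one_smul]

theorem ι_zero_right_d (hd : ∀ i, L.d 0 i = 0) (n n' : ℕ) (hn : c.Rel n n') :
    ιMapBifunctor K L F c n 0 n (add_zero n) ≫ (mapBifunctor K L F c).d n n' =
      (F.map (K.d n n')).app (L.X 0) ≫ ιMapBifunctor K L F c n' 0 n' (add_zero n') := by
  have h₂ : mapBifunctor.d₂ K L F c n 0 n' = 0 := by
    by_cases hr : c.Rel 0 (c.next 0)
    · rw [mapBifunctor.d₂_eq' K L F c n hr, hd, CategoryTheory.Functor.map_zero, zero_comp,
        smul_zero]
    · exact mapBifunctor.d₂_eq_zero _ _ _ _ _ _ _ hr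
  have hε : ComplexShape.ε₁ c c c (n, 0) = 1 := rfl
  rw [ι_mapBifunctor_d, h₂, add_zero, mapBifunctor.d₁_eq K L F c hn 0 n' (add_zero n'), hε,
    one_smul]

/-- If `K` is concentrated in degree `0`, then the total complex of `F(K, L)` is `F(K⁰, L)`. -/
def totalIsoLeft (hK : ∀ i, i ≠ 0 → IsZero (K.X i)) (hd : ∀ i, K.d 0 i = 0) :
    ((F.obj (K.X 0)).mapHomologicalComplex c).obj L ≅ mapBifunctor K L F c :=
  have hi : ∀ n, IsIso (ιMapBifunctor K L F c 0 n n (zero_add n)) := fun n =>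
    isIso_ιMapBifunctor F K L 0 n n (zero_add n) fun i j (h : i + j = n) hij =>
      (Functor.isZero_iff _).1 (F.map_isZero (hK i (by rintro rfl; simp_all))) _
  Hom.isoOfComponents (fun n => @asIso _ _ _ _ (ιMapBifunctor K L F c 0 n n (zero_add n)) (hi n))
    fun n n' hn => ι_zero_left_d F K L hd n n' hn

/-- If `L` is concentrated in degree `0`, then the total complex of `F(K, L)` is `F(K, L⁰)`. -/
def totalIsoRight (hL : ∀ i, i ≠ 0 → IsZero (L.X i)) (hd : ∀ i, L.d 0 i = 0) :
    ((F.flip.obj (L.X 0)).mapHomologicalComplex c).obj K ≅ mapBifunctor K L F c :=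
  have hi : ∀ n, IsIso (ιMapBifunctor K L F c n 0 n (add_zero n)) := fun n =>
    isIso_ιMapBifunctor F K L n 0 n (add_zero n) fun i j (h : i + j = n) hij =>
      (F.obj _).map_isZero (hL j (by rintro rfl; simp_all))
  Hom.isoOfComponents (fun n => @asIso _ _ _ _ (ιMapBifunctor K L F c n 0 n (add_zero n)) (hi n))
    fun n n' hn => ι_zero_right_d F K L hd n n' hn

end Shape

section Exact

variable {𝒞 : Type*} [Category* 𝒞] [Abelian 𝒞] {G : 𝒞 ⥤ 𝒟} [G.Additive]

theorem IsExactFunctor.exact (hG : IsExactFunctor G) {S : ShortComplex 𝒞} (hS : S.Exact) :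
    (S.map G).Exact :=
  have h : ∀ S : ShortComplex 𝒞, S.Exact → (S.map G).Exact :=
    (G.exact_tfae.out 0 1).1 fun S hS => hG S ((conflation_iff_shortExact S).2 hS)
  h S hS

theorem IsExactFunctor.exactAt (hG : IsExactFunctor G) {ι : Type*} {c : ComplexShape ι}
    {K : HomologicalComplex 𝒞 c} {i : ι} (hK : K.ExactAt i) :
    ((G.mapHomologicalComplex c).obj K).ExactAt i :=
  hG.exact hK

end Exact

section CochainZero

variable [∀ (K : CochainComplex 𝒜 ℕ) (L : CochainComplex ℬ ℕ),
  HasMapBifunctor K L F (ComplexShape.up ℕ)]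
variable {A A' : 𝒜} {B B' : ℬ} {K K' : CochainComplex 𝒜 ℕ} {L L' : CochainComplex ℬ ℕ}

/-- The inclusion of `F(K⁰, L⁰)` in the total complex. -/
abbrev ιZero (K : CochainComplex 𝒜 ℕ) (L : CochainComplex ℬ ℕ) :
    (F.obj (K.X 0)).obj (L.X 0) ⟶ (mapBifunctor K L F (ComplexShape.up ℕ)).X 0 :=
  ιMapBifunctor K L F (ComplexShape.up ℕ) 0 0 0 rfl

instance isIso_ιZero : IsIso (ιZero F K L) :=
  isIso_ιMapBifunctor F K L 0 0 0 rfl fun i j (h : i + j = 0) hij =>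
    (hij (by obtain ⟨rfl, rfl⟩ := Nat.add_eq_zero_iff.1 h; rfl)).elim

theorem ιZero_d : ιZero F K L ≫ (mapBifunctor K L F (ComplexShape.up ℕ)).d 0 1 =
    (F.map (K.d 0 1)).app (L.X 0) ≫ ιMapBifunctor K L F (ComplexShape.up ℕ) 1 0 1 rfl +
      (F.obj (K.X 0)).map (L.d 0 1) ≫ ιMapBifunctor K L F (ComplexShape.up ℕ) 0 1 1 rfl := by
  have h₁ : ComplexShape.ε₁ (ComplexShape.up ℕ) (ComplexShape.up ℕ) (ComplexShape.up ℕ)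
    (0, 0) = 1 := rfl
  have h₂ : ComplexShape.ε₂ (ComplexShape.up ℕ) (ComplexShape.up ℕ) (ComplexShape.up ℕ)
    (0, 0) = 1 := rfl
  rw [ι_mapBifunctor_d, mapBifunctor.d₁_eq K L F _ (i₁ := 0) (i₁' := 1) rfl 0 1 rfl,
    mapBifunctor.d₂_eq K L F _ 0 (i₂ := 0) (i₂' := 1) rfl 1 rfl, h₁, h₂, one_smul, one_smul]

/-- The two components of the differential of the total complex in degree `0`. -/
theorem comp_ιZero_d_eq_zero_iff {W : 𝒟} (x : W ⟶ (F.obj (K.X 0)).obj (L.X 0)) :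
    x ≫ ιZero F K L ≫ (mapBifunctor K L F (ComplexShape.up ℕ)).d 0 1 = 0 ↔
      x ≫ (F.map (K.d 0 1)).app (L.X 0) = 0 ∧ x ≫ (F.obj (K.X 0)).map (L.d 0 1) = 0 := by
  rw [ιZero_d]
  constructor
  · intro h
    let p : (mapBifunctor K L F (ComplexShape.up ℕ)).X 1 ⟶ (F.obj (K.X 1)).obj (L.X 0) :=
      mapBifunctorDesc fun i j _ => if e : (i, j) = (1, 0) then
        eqToHom (congrArg (fun p : ℕ × ℕ => (F.obj (K.X p.1)).obj (L.X p.2)) e) else 0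
    let q : (mapBifunctor K L F (ComplexShape.up ℕ)).X 1 ⟶ (F.obj (K.X 0)).obj (L.X 1) :=
      mapBifunctorDesc fun i j _ => if e : (i, j) = (0, 1) then
        eqToHom (congrArg (fun p : ℕ × ℕ => (F.obj (K.X p.1)).obj (L.X p.2)) e) else 0
    have p₁ : ιMapBifunctor K L F (ComplexShape.up ℕ) 1 0 1 rfl ≫ p = 𝟙 _ :=
      (ι_mapBifunctorDesc _ 1 0 rfl).trans (dif_pos rfl)
    have p₂ : ιMapBifunctor K L F (ComplexShape.up ℕ) 0 1 1 rfl ≫ p = 0 :=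
      (ι_mapBifunctorDesc _ 0 1 rfl).trans (dif_neg (by simp))
    have q₁ : ιMapBifunctor K L F (ComplexShape.up ℕ) 1 0 1 rfl ≫ q = 0 :=
      (ι_mapBifunctorDesc _ 1 0 rfl).trans (dif_neg (by simp))
    have q₂ : ιMapBifunctor K L F (ComplexShape.up ℕ) 0 1 1 rfl ≫ q = 𝟙 _ :=
      (ι_mapBifunctorDesc _ 0 1 rfl).trans (dif_pos rfl)
    have hp := congrArg (· ≫ p) h
    have hq := congrArg (· ≫ q) h
    simp only [Preadditive.comp_add, Preadditive.add_comp, Category.assoc, p₁, p₂, q₁, q₂,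
      Category.comp_id, comp_zero, add_zero, zero_add, zero_comp] at hp hq
    exact ⟨hp, hq⟩
  · rintro ⟨h₁, h₂⟩
    rw [Preadditive.comp_add, reassoc_of% h₁, reassoc_of% h₂, zero_comp, zero_comp, add_zero]

/-- Augmentations `a : A ⟶ K⁰` and `b : B ⟶ L⁰` induce a map from `F(A, B)` to the cycles of degree
`0` of the total complex of `F(K, L)`. -/
def totalAugmentation (a : A ⟶ K.X 0) (ha : a ≫ K.d 0 1 = 0) (b : B ⟶ L.X 0)
    (hb : b ≫ L.d 0 1 = 0) :
    (F.obj A).obj B ⟶ (mapBifunctor K L F (ComplexShape.up ℕ)).cycles 0 :=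
  liftCycles _ (bimap F a b ≫ ιZero F K L) 1
    (CochainComplex.next ℕ 0) (by
      rw [Category.assoc, comp_ιZero_d_eq_zero_iff, ← bimap_id_right, ← bimap_id_left,
        bimap_comp_bimap, bimap_comp_bimap, ha, hb]
      simp [bimap])

theorem totalAugmentation_iCycles (a : A ⟶ K.X 0) (ha : a ≫ K.d 0 1 = 0) (b : B ⟶ L.X 0)
    (hb : b ≫ L.d 0 1 = 0) :
    totalAugmentation F a ha b hb ≫ iCycles _ 0 = bimap F a b ≫ ιZero F K L :=
  liftCycles_i _ _ _ _ _

theorem totalAugmentation_naturality {a : A ⟶ K.X 0} {ha : a ≫ K.d 0 1 = 0} {b : B ⟶ L.X 0}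
    {hb : b ≫ L.d 0 1 = 0} {a' : A' ⟶ K'.X 0} {ha' : a' ≫ K'.d 0 1 = 0} {b' : B' ⟶ L'.X 0}
    {hb' : b' ≫ L'.d 0 1 = 0} (f : A ⟶ A') (g : B ⟶ B') (φ : K ⟶ K') (ψ : L ⟶ L')
    (hφ : a ≫ φ.f 0 = f ≫ a') (hψ : b ≫ ψ.f 0 = g ≫ b') :
    bimap F f g ≫ totalAugmentation F a' ha' b' hb' =
      totalAugmentation F a ha b hb ≫
        cyclesMap (mapBifunctorMap φ ψ F (ComplexShape.up ℕ)) 0 := by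
  have h : ιZero F K L ≫ (mapBifunctorMap φ ψ F (ComplexShape.up ℕ)).f 0 =
      bimap F (φ.f 0) (ψ.f 0) ≫ ιZero F K' L' :=
    (ι_mapBifunctorMap _ _ _ _ _ _ _ _).trans (Category.assoc _ _ _).symm
  rw [← cancel_mono (iCycles _ 0), Category.assoc, Category.assoc, totalAugmentation_iCycles,
    cyclesMap_i]
  rw [← Category.assoc (totalAugmentation F a ha b hb), totalAugmentation_iCycles, Category.assoc,
    h, ← Category.assoc, ← Category.assoc, bimap_comp_bimap, bimap_comp_bimap, hφ, hψ]

end CochainZero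

section ChainZero

variable [∀ (K : ChainComplex 𝒜 ℕ) (L : ChainComplex ℬ ℕ),
  HasMapBifunctor K L F (ComplexShape.down ℕ)]
variable {A A' : 𝒜} {B B' : ℬ} {K K' : ChainComplex 𝒜 ℕ} {L L' : ChainComplex ℬ ℕ}

/-- The inclusion of `F(K₀, L₀)` in the total complex. -/
abbrev ιZeroDown (K : ChainComplex 𝒜 ℕ) (L : ChainComplex ℬ ℕ) :
    (F.obj (K.X 0)).obj (L.X 0) ⟶ (mapBifunctor K L F (ComplexShape.down ℕ)).X 0 :=
  ιMapBifunctor K L F (ComplexShape.down ℕ) 0 0 0 rfl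

instance isIso_ιZeroDown : IsIso (ιZeroDown F K L) :=
  isIso_ιMapBifunctor F K L 0 0 0 rfl fun i j (h : i + j = 0) hij =>
    (hij (by obtain ⟨rfl, rfl⟩ := Nat.add_eq_zero_iff.1 h; rfl)).elim

theorem ι_one_zero_d : ιMapBifunctor K L F (ComplexShape.down ℕ) 1 0 1 rfl ≫
    (mapBifunctor K L F (ComplexShape.down ℕ)).d 1 0 =
      (F.map (K.d 1 0)).app (L.X 0) ≫ ιZeroDown F K L := by
  have h₁ : ComplexShape.ε₁ (ComplexShape.down ℕ) (ComplexShape.down ℕ) (ComplexShape.down ℕ)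
    (1, 0) = 1 := rfl
  rw [ι_mapBifunctor_d, mapBifunctor.d₁_eq K L F _ (i₁ := 1) (i₁' := 0) rfl 0 0 rfl,
    mapBifunctor.d₂_eq_zero K L F _ _ _ _ (by simp), h₁, one_smul, add_zero]

theorem ι_zero_one_d : ιMapBifunctor K L F (ComplexShape.down ℕ) 0 1 1 rfl ≫
    (mapBifunctor K L F (ComplexShape.down ℕ)).d 1 0 =
      (F.obj (K.X 0)).map (L.d 1 0) ≫ ιZeroDown F K L := by
  have h₂ : ComplexShape.ε₂ (ComplexShape.down ℕ) (ComplexShape.down ℕ) (ComplexShape.down ℕ)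
    (0, 1) = 1 := rfl
  rw [ι_mapBifunctor_d, mapBifunctor.d₂_eq K L F _ 0 (i₂ := 1) (i₂' := 0) rfl 0 rfl,
    mapBifunctor.d₁_eq_zero K L F _ _ _ _ (by simp), h₂, one_smul, zero_add]

/-- A morphism from the total complex in degree `0` vanishes on boundaries if and only if it does so
in each variable. -/
theorem d_comp_eq_zero_iff {W : 𝒟}
    (x : (mapBifunctor K L F (ComplexShape.down ℕ)).X 0 ⟶ W) :
    (mapBifunctor K L F (ComplexShape.down ℕ)).d 1 0 ≫ x = 0 ↔
      (F.map (K.d 1 0)).app (L.X 0) ≫ ιZeroDown F K L ≫ x = 0 ∧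
        (F.obj (K.X 0)).map (L.d 1 0) ≫ ιZeroDown F K L ≫ x = 0 := by
  rw [← Category.assoc, ← Category.assoc, ← ι_one_zero_d, ← ι_zero_one_d, Category.assoc,
    Category.assoc]
  constructor
  · intro h
    rw [h, comp_zero, comp_zero]
    exact ⟨rfl, rfl⟩
  · rintro ⟨h₁, h₂⟩
    refine mapBifunctor.hom_ext fun i j (h : i + j = 1) => ?_
    obtain ⟨rfl, rfl⟩ | ⟨rfl, rfl⟩ : i = 1 ∧ j = 0 ∨ i = 0 ∧ j = 1 := by omega
    · exact h₁.trans comp_zero.symm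
    · exact h₂.trans comp_zero.symm

/-- Augmentations `a : K₀ ⟶ A` and `b : L₀ ⟶ B` induce a map to `F(A, B)` from the cokernel of the
differential of the total complex of `F(K, L)` in degree `0`. -/
def totalCoaugmentation (a : K.X 0 ⟶ A) (ha : K.d 1 0 ≫ a = 0) (b : L.X 0 ⟶ B)
    (hb : L.d 1 0 ≫ b = 0) :
    (mapBifunctor K L F (ComplexShape.down ℕ)).opcycles 0 ⟶ (F.obj A).obj B :=
  descOpcycles _ (inv (ιZeroDown F K L) ≫ bimap F a b) 1
    (ChainComplex.prev ℕ 0) (by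
      rw [d_comp_eq_zero_iff, IsIso.hom_inv_id_assoc, ← bimap_id_right, ← bimap_id_left,
        bimap_comp_bimap, bimap_comp_bimap, ha, hb]
      simp [bimap])

theorem pOpcycles_totalCoaugmentation (a : K.X 0 ⟶ A) (ha : K.d 1 0 ≫ a = 0) (b : L.X 0 ⟶ B)
    (hb : L.d 1 0 ≫ b = 0) :
    pOpcycles _ 0 ≫ totalCoaugmentation F a ha b hb = inv (ιZeroDown F K L) ≫ bimap F a b :=
  p_descOpcycles _ _ _ _ _

theorem totalCoaugmentation_naturality {a : K.X 0 ⟶ A} {ha : K.d 1 0 ≫ a = 0} {b : L.X 0 ⟶ B}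
    {hb : L.d 1 0 ≫ b = 0} {a' : K'.X 0 ⟶ A'} {ha' : K'.d 1 0 ≫ a' = 0} {b' : L'.X 0 ⟶ B'}
    {hb' : L'.d 1 0 ≫ b' = 0} (f : A ⟶ A') (g : B ⟶ B') (φ : K ⟶ K') (ψ : L ⟶ L')
    (hφ : φ.f 0 ≫ a' = a ≫ f) (hψ : ψ.f 0 ≫ b' = b ≫ g) :
    totalCoaugmentation F a ha b hb ≫ bimap F f g =
      opcyclesMap (mapBifunctorMap φ ψ F (ComplexShape.down ℕ)) 0 ≫
        totalCoaugmentation F a' ha' b' hb' := by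
  have h : inv (ιZeroDown F K L) ≫ bimap F (φ.f 0) (ψ.f 0) =
      (mapBifunctorMap φ ψ F (ComplexShape.down ℕ)).f 0 ≫ inv (ιZeroDown F K' L') := by
    rw [IsIso.inv_comp_eq, ← Category.assoc, IsIso.eq_comp_inv]
    exact (Category.assoc _ _ _).trans (ι_mapBifunctorMap _ _ _ _ _ _ _ _).symm
  rw [← cancel_epi (pOpcycles _ 0), ← Category.assoc, pOpcycles_totalCoaugmentation,
    p_opcyclesMap_assoc, pOpcycles_totalCoaugmentation, ← Category.assoc, ← h, Category.assoc,
    Category.assoc, bimap_comp_bimap, bimap_comp_bimap, hφ, hψ]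

end ChainZero

end Total

section TotalZero

open HomologicalComplex

/-- Left exactness in the second variable. -/
theorem IsLeftExact.flip_exact {𝒜 : Type*} [Category* 𝒜] [Preadditive 𝒜]
    {ℬ : Type*} [Category* ℬ] [Abelian ℬ] {𝒟 : Type*} [Category* 𝒟] [Abelian 𝒟]
    {F : 𝒜 ⥤ ℬ ⥤ 𝒟} [∀ A, (F.obj A).Additive]
    (h : IsLeftExact F.flip) (A : 𝒜) {S : ShortComplex ℬ}
    (hS : S.Exact) (hf : Mono S.f) : (S.map (F.obj A)).Exact ∧ Mono ((F.obj A).map S.f) := by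
  have h' : ∀ S : ShortComplex ℬ, S.Exact ∧ Mono S.f →
      (S.map (F.obj A)).Exact ∧ Mono ((F.obj A).map S.f) := by
    refine ((F.obj A).preservesFiniteLimits_tfae.out 0 1).1 fun T hT => ?_
    obtain ⟨h₁, h₂⟩ := h T ((conflation_iff_shortExact T).2 hT)
    exact ⟨(exact_iff_forall_evaluation _).1 h₂ A, (NatTrans.mono_iff_mono_app _).1 h₁ A⟩
  exact h' S ⟨hS, hf⟩

/-- Left exactness in the first variable. -/
theorem IsLeftExact.exact_obj {𝒜 : Type*} [Category* 𝒜] [Abelian 𝒜]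
    {ℬ : Type*} [Category* ℬ] [Preadditive ℬ] {𝒟 : Type*} [Category* 𝒟] [Abelian 𝒟]
    {F : 𝒜 ⥤ ℬ ⥤ 𝒟} [F.Additive]
    (h : IsLeftExact F) (B : ℬ) {S : ShortComplex 𝒜}
    (hS : S.Exact) (hf : Mono S.f) :
    (S.map (F.flip.obj B)).Exact ∧ Mono ((F.map S.f).app B) := by
  have h' : ∀ S : ShortComplex 𝒜, S.Exact ∧ Mono S.f →
      (S.map (F.flip.obj B)).Exact ∧ Mono ((F.flip.obj B).map S.f) := by
    refine ((F.flip.obj B).preservesFiniteLimits_tfae.out 0 1).1 fun T hT => ?_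
    obtain ⟨h₁, h₂⟩ := h T ((conflation_iff_shortExact T).2 hT)
    exact ⟨(exact_iff_forall_evaluation _).1 h₂ B, (NatTrans.mono_iff_mono_app _).1 h₁ B⟩
  exact h' S ⟨hS, hf⟩

/-- Right exactness in the second variable. -/
theorem IsRightExact.flip_exact {𝒜 : Type*} [Category* 𝒜] [Preadditive 𝒜]
    {ℬ : Type*} [Category* ℬ] [Abelian ℬ] {𝒟 : Type*} [Category* 𝒟] [Abelian 𝒟]
    {F : 𝒜 ⥤ ℬ ⥤ 𝒟} [∀ A, (F.obj A).Additive]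
    (h : IsRightExact F.flip) (A : 𝒜) {S : ShortComplex ℬ}
    (hS : S.Exact) (hg : Epi S.g) : (S.map (F.obj A)).Exact ∧ Epi ((F.obj A).map S.g) := by
  have h' : ∀ S : ShortComplex ℬ, S.Exact ∧ Epi S.g →
      (S.map (F.obj A)).Exact ∧ Epi ((F.obj A).map S.g) := by
    refine ((F.obj A).preservesFiniteColimits_tfae.out 0 1).1 fun T hT => ?_
    obtain ⟨h₁, h₂⟩ := h T ((conflation_iff_shortExact T).2 hT)
    exact ⟨(exact_iff_forall_evaluation _).1 h₁ A, (NatTrans.epi_iff_epi_app _).1 h₂ A⟩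
  exact h' S ⟨hS, hg⟩

/-- Right exactness in the first variable. -/
theorem IsRightExact.exact_obj {𝒜 : Type*} [Category* 𝒜] [Abelian 𝒜]
    {ℬ : Type*} [Category* ℬ] [Preadditive ℬ] {𝒟 : Type*} [Category* 𝒟] [Abelian 𝒟]
    {F : 𝒜 ⥤ ℬ ⥤ 𝒟} [F.Additive]
    (h : IsRightExact F) (B : ℬ) {S : ShortComplex 𝒜}
    (hS : S.Exact) (hg : Epi S.g) :
    (S.map (F.flip.obj B)).Exact ∧ Epi ((F.map S.g).app B) := by
  have h' : ∀ S : ShortComplex 𝒜, S.Exact ∧ Epi S.g →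
      (S.map (F.flip.obj B)).Exact ∧ Epi ((F.flip.obj B).map S.g) := by
    refine ((F.flip.obj B).preservesFiniteColimits_tfae.out 0 1).1 fun T hT => ?_
    obtain ⟨h₁, h₂⟩ := h T ((conflation_iff_shortExact T).2 hT)
    exact ⟨(exact_iff_forall_evaluation _).1 h₁ B, (NatTrans.epi_iff_epi_app _).1 h₂ B⟩
  exact h' S ⟨hS, hg⟩

variable {𝒜 : Type*} [Category* 𝒜] [Abelian 𝒜] {ℬ : Type*} [Category* ℬ] [Abelian ℬ]
variable {𝒟 : Type*} [Category* 𝒟] [Abelian 𝒟]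
variable (F : 𝒜 ⥤ ℬ ⥤ 𝒟) [F.Additive] [∀ A, (F.obj A).Additive]

/-- If `0 ⟶ A ⟶ K⁰ ⟶ K¹` and `0 ⟶ B ⟶ L⁰ ⟶ L¹` are exact, then `F(A, B)` is the intersection of the
kernels of `F(K⁰, L⁰) ⟶ F(K¹, L⁰)` and of `F(K⁰, L⁰) ⟶ F(K⁰, L¹)`. -/
theorem isIso_totalAugmentation [∀ (K : CochainComplex 𝒜 ℕ) (L : CochainComplex ℬ ℕ),
    HasMapBifunctor K L F (ComplexShape.up ℕ)] (h₁ : IsLeftExact F) (h₂ : IsLeftExact F.flip)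
    {A : 𝒜} {B : ℬ} {K : CochainComplex 𝒜 ℕ} {L : CochainComplex ℬ ℕ}
    (a : A ⟶ K.X 0) (ha : a ≫ K.d 0 1 = 0) (b : B ⟶ L.X 0) (hb : b ≫ L.d 0 1 = 0)
    [Mono a] [Mono b] (hae : (ShortComplex.mk a _ ha).Exact)
    (hbe : (ShortComplex.mk b _ hb).Exact) : IsIso (totalAugmentation F a ha b hb) := by
  obtain ⟨ea, ma⟩ := h₁.exact_obj B hae ‹_›
  obtain ⟨eb, mb⟩ := h₂.flip_exact (K.X 0) hbe ‹_›
  obtain ⟨-, mb'⟩ := h₂.flip_exact (K.X 1) hbe ‹_›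
  change Mono ((F.map a).app B) at ma
  change Mono ((F.obj (K.X 0)).map b) at mb
  change Mono ((F.obj (K.X 1)).map b) at mb'
  have la : ∀ {W : 𝒟} (z : W ⟶ (F.obj (K.X 0)).obj B), z ≫ (F.map (K.d 0 1)).app B = 0 →
      ∃ w : W ⟶ (F.obj A).obj B, w ≫ (F.map a).app B = z := fun z hz =>
    haveI : Mono ((ShortComplex.mk a _ ha).map (F.flip.obj B)).f := ma
    ⟨ea.lift z hz, ea.lift_f z hz⟩
  have lb : ∀ {W : 𝒟} (z : W ⟶ (F.obj (K.X 0)).obj (L.X 0)),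
      z ≫ (F.obj (K.X 0)).map (L.d 0 1) = 0 →
        ∃ w : W ⟶ (F.obj (K.X 0)).obj B, w ≫ (F.obj (K.X 0)).map b = z := fun z hz =>
    haveI : Mono ((ShortComplex.mk b _ hb).map (F.obj (K.X 0))).f := mb
    ⟨eb.lift z hz, eb.lift_f z hz⟩
  have hm : Mono (bimap F a b ≫ ιZero F K L) := by
    rw [bimap]
    infer_instance
  refine (CochainComplex.isIso_liftCycles_iff _ _ _).2
    ⟨ShortComplex.exact_of_f_is_kernel _ (KernelFork.IsLimit.ofι' _ _ fun {W} x hx =>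
      Classical.indefiniteDescription _ ?_), hm⟩
  change (x : W ⟶ (mapBifunctor K L F (ComplexShape.up ℕ)).X 0) ≫
    (mapBifunctor K L F (ComplexShape.up ℕ)).d 0 1 = 0 at hx
  let y : W ⟶ (F.obj (K.X 0)).obj (L.X 0) := x ≫ inv (ιZero F K L)
  have hy : y ≫ ιZero F K L = x := by simp [y]
  rw [← hy, Category.assoc, comp_ιZero_d_eq_zero_iff] at hx
  obtain ⟨z, hz⟩ := lb y hx.2
  have hz' : z ≫ (F.map (K.d 0 1)).app B = 0 := by
    rw [← cancel_mono ((F.obj (K.X 1)).map b), Category.assoc, ← NatTrans.naturality,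
      reassoc_of% hz, hx.1, zero_comp]
  obtain ⟨w, hw⟩ := la z hz'
  have h : w ≫ bimap F a b ≫ ιZero F K L = x := by
    rw [bimap, Category.assoc, reassoc_of% hw, reassoc_of% hz, hy]
  exact ⟨w, h⟩

/-- If `K₁ ⟶ K₀ ⟶ A ⟶ 0` and `L₁ ⟶ L₀ ⟶ B ⟶ 0` are exact, then `F(A, B)` is the quotient of
`F(K₀, L₀)` by the images of `F(K₁, L₀)` and `F(K₀, L₁)`. -/
theorem isIso_totalCoaugmentation [∀ (K : ChainComplex 𝒜 ℕ) (L : ChainComplex ℬ ℕ),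
    HasMapBifunctor K L F (ComplexShape.down ℕ)] (h₁ : IsRightExact F) (h₂ : IsRightExact F.flip)
    {A : 𝒜} {B : ℬ} {K : ChainComplex 𝒜 ℕ} {L : ChainComplex ℬ ℕ}
    (a : K.X 0 ⟶ A) (ha : K.d 1 0 ≫ a = 0) (b : L.X 0 ⟶ B) (hb : L.d 1 0 ≫ b = 0)
    [Epi a] [Epi b] (hae : (ShortComplex.mk _ a ha).Exact)
    (hbe : (ShortComplex.mk _ b hb).Exact) : IsIso (totalCoaugmentation F a ha b hb) := by
  obtain ⟨ea, ma⟩ := h₁.exact_obj (L.X 0) hae ‹_›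
  obtain ⟨-, ma'⟩ := h₁.exact_obj (L.X 1) hae ‹_›
  obtain ⟨eb, mb⟩ := h₂.flip_exact A hbe ‹_›
  change Epi ((F.map a).app (L.X 0)) at ma
  change Epi ((F.map a).app (L.X 1)) at ma'
  change Epi ((F.obj A).map b) at mb
  have la : ∀ {W : 𝒟} (z : (F.obj (K.X 0)).obj (L.X 0) ⟶ W),
      (F.map (K.d 1 0)).app (L.X 0) ≫ z = 0 →
        ∃ w : (F.obj A).obj (L.X 0) ⟶ W, (F.map a).app (L.X 0) ≫ w = z := fun z hz =>
    haveI : Epi ((ShortComplex.mk _ a ha).map (F.flip.obj (L.X 0))).g := ma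
    ⟨ea.desc z hz, ea.g_desc z hz⟩
  have lb : ∀ {W : 𝒟} (z : (F.obj A).obj (L.X 0) ⟶ W), (F.obj A).map (L.d 1 0) ≫ z = 0 →
      ∃ w : (F.obj A).obj B ⟶ W, (F.obj A).map b ≫ w = z := fun z hz =>
    haveI : Epi ((ShortComplex.mk _ b hb).map (F.obj A)).g := mb
    ⟨eb.desc z hz, eb.g_desc z hz⟩
  have hm : Epi (inv (ιZeroDown F K L) ≫ bimap F a b) := by
    rw [bimap]
    infer_instance
  refine (ChainComplex.isIso_descOpcycles_iff _ _ _).2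
    ⟨ShortComplex.exact_of_g_is_cokernel _
      (CokernelCofork.IsColimit.ofπ' _ _ fun {W} x hx =>
      Classical.indefiniteDescription _ ?_), hm⟩
  change (mapBifunctor K L F (ComplexShape.down ℕ)).d 1 0 ≫
    (x : (mapBifunctor K L F (ComplexShape.down ℕ)).X 0 ⟶ W) = 0 at hx
  rw [d_comp_eq_zero_iff] at hx
  obtain ⟨z, hz⟩ := la (ιZeroDown F K L ≫ x) hx.1
  have hz' : (F.obj A).map (L.d 1 0) ≫ z = 0 := by
    rw [← cancel_epi ((F.map a).app (L.X 1)), ← NatTrans.naturality_assoc, hz, hx.2, comp_zero]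
  obtain ⟨w, hw⟩ := lb z hz'
  have h : (inv (ιZeroDown F K L) ≫ bimap F a b) ≫ w = x := by
    rw [bimap, Category.assoc, Category.assoc, hw, hz, IsIso.inv_hom_id_assoc]
  exact ⟨w, h⟩

end TotalZero

/-! ### Total derived bifunctors -/

section TotalDerived

open HomologicalComplex

variable {𝒜 : Type*} [Category* 𝒜] [Preadditive 𝒜] {ℬ : Type*} [Category* ℬ] [Preadditive ℬ]
variable {𝒟 : Type*} [Category* 𝒟] [Abelian 𝒟]

/-- The homology of the total complex of `F` applied to functorial resolutions in both variables. -/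
def totalDerived {c : ComplexShape ℕ} [c.TensorSigns] (F : 𝒜 ⥤ ℬ ⥤ 𝒟) [F.Additive]
    [∀ A, (F.obj A).Additive]
    [∀ (K : HomologicalComplex 𝒜 c) (L : HomologicalComplex ℬ c), HasMapBifunctor K L F c]
    (r₁ : 𝒜 ⥤ HomotopyCategory 𝒜 c) (r₂ : ℬ ⥤ HomotopyCategory ℬ c) (n : ℕ) : 𝒜 ⥤ ℬ ⥤ 𝒟 :=
  r₁ ⋙ totalHomology c F n ⋙ (Functor.whiskeringLeft _ _ _).obj r₂

variable {c : ComplexShape ℕ} [c.TensorSigns] (F : 𝒜 ⥤ ℬ ⥤ 𝒟) [F.Additive]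
  [∀ A, (F.obj A).Additive]
  [∀ (K : HomologicalComplex 𝒜 c) (L : HomologicalComplex ℬ c), HasMapBifunctor K L F c]
  (r₁ : 𝒜 ⥤ HomotopyCategory 𝒜 c) (r₂ : ℬ ⥤ HomotopyCategory ℬ c) (n : ℕ) {A A' : 𝒜} {B B' : ℬ}
  {K K' : HomologicalComplex 𝒜 c} {L L' : HomologicalComplex ℬ c}

/-- The resolutions may be replaced by complexes that are homotopy equivalent to them. -/
def totalDerivedIso (e : r₁.obj A ≅ (HomotopyCategory.quotient 𝒜 c).obj K)
    (i : r₂.obj B ≅ (HomotopyCategory.quotient ℬ c).obj L) :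
    ((totalDerived F r₁ r₂ n).obj A).obj B ≅ (mapBifunctor K L F c).homology n :=
  let t : ((totalHomology c F n).obj (r₁.obj A)).obj (r₂.obj B) ≅ ((totalHomology c F n).obj
    ((HomotopyCategory.quotient 𝒜 c).obj K)).obj ((HomotopyCategory.quotient ℬ c).obj L) :=
    bimapIso (totalHomology c F n) e i
  t

theorem totalDerivedIso_naturality
    (f : A ⟶ A') (g : B ⟶ B') (φ : K ⟶ K') (ψ : L ⟶ L')
    (e : r₁.obj A ≅ (HomotopyCategory.quotient 𝒜 c).obj K)
    (e' : r₁.obj A' ≅ (HomotopyCategory.quotient 𝒜 c).obj K')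
    (i : r₂.obj B ≅ (HomotopyCategory.quotient ℬ c).obj L)
    (i' : r₂.obj B' ≅ (HomotopyCategory.quotient ℬ c).obj L')
    (hf : r₁.map f ≫ e'.hom = e.hom ≫ (HomotopyCategory.quotient 𝒜 c).map φ)
    (hg : r₂.map g ≫ i'.hom = i.hom ≫ (HomotopyCategory.quotient ℬ c).map ψ) :
    bimap (totalDerived F r₁ r₂ n) f g ≫ (totalDerivedIso F r₁ r₂ n e' i').hom =
      (totalDerivedIso F r₁ r₂ n e i).hom ≫ homologyMap (mapBifunctorMap φ ψ F c) n := by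
  have h : bimap (totalHomology c F n) (r₁.map f) (r₂.map g) ≫
      bimap (totalHomology c F n) e'.hom i'.hom = bimap (totalHomology c F n) e.hom i.hom ≫
        bimap (totalHomology c F n) ((HomotopyCategory.quotient 𝒜 c).map φ)
          ((HomotopyCategory.quotient ℬ c).map ψ) := by
    rw [bimap_comp_bimap, bimap_comp_bimap, hf, hg]
  exact h.trans (congrArg (bimap (totalHomology c F n) e.hom i.hom ≫ ·)
    (totalHomology_map_app F n φ ψ))

end TotalDerived

section TotalRightDerived

open HomologicalComplex

variable {𝒜 : Type*} [Category* 𝒜] [Abelian 𝒜] {ℬ : Type*} [Category* ℬ] [Abelian ℬ]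
variable [EnoughInjectives 𝒜] [EnoughInjectives ℬ]
variable (F : 𝒜 ⥤ ℬ ⥤ AddCommGrpCat.{u}) [F.Additive] [∀ A, (F.obj A).Additive]

/-- The total right derived bifunctors. -/
def totalRightDerived (n : ℕ) : 𝒜 ⥤ ℬ ⥤ AddCommGrpCat.{u} :=
  totalDerived F (injectiveResolutions 𝒜) (injectiveResolutions ℬ) n

/-- The connecting morphisms in the first variable. -/
def totalRightDerivedDelta : CohomologicalDelta (totalRightDerived F) :=
  (injectiveSequenceResolution 𝒜).cohomologicalDelta
    ((totalHomologyDelta (c := ComplexShape.up ℕ) F).comp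
      ((Functor.whiskeringLeft _ _ _).obj (injectiveResolutions ℬ)))

theorem totalRightDerivedDelta_isExact : (totalRightDerivedDelta F).IsExact :=
  (injectiveSequenceResolution 𝒜).cohomologicalDelta_isExact _

/-- The connecting morphisms in the second variable. -/
def totalRightDerivedFlipDelta : CohomologicalDelta (fun n => (totalRightDerived F n).flip) :=
  (injectiveSequenceResolution ℬ).cohomologicalDelta
    ((totalHomologyFlipDelta (c := ComplexShape.up ℕ) F).comp
      ((Functor.whiskeringLeft _ _ _).obj (injectiveResolutions 𝒜)))

theorem totalRightDerivedFlipDelta_isExact : (totalRightDerivedFlipDelta F).IsExact :=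
  (injectiveSequenceResolution ℬ).cohomologicalDelta_isExact _

/-- The total right derived bifunctor in terms of arbitrary injective resolutions. -/
def totalRightDerivedIso {A : 𝒜} {B : ℬ} (I : InjectiveRes A) (J : InjectiveRes B) (n : ℕ) :
    ((totalRightDerived F n).obj A).obj B ≅
      (mapBifunctor I.I J.I F (ComplexShape.up ℕ)).homology n :=
  totalDerivedIso F (injectiveResolutions 𝒜) (injectiveResolutions ℬ) n I.iso J.iso

theorem totalRightDerivedIso_naturality {A A' : 𝒜} {B B' : ℬ} (f : A ⟶ A') (g : B ⟶ B')
    (I : InjectiveRes A) (I' : InjectiveRes A') (J : InjectiveRes B) (J' : InjectiveRes B')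
    (φ : I.I ⟶ I'.I) (ψ : J.I ⟶ J'.I) (hφ : I.Lifts f I' φ) (hψ : J.Lifts g J' ψ) (n : ℕ) :
    bimap (totalRightDerived F n) f g ≫ (totalRightDerivedIso F I' J' n).hom =
      (totalRightDerivedIso F I J n).hom ≫
        homologyMap (mapBifunctorMap φ ψ F (ComplexShape.up ℕ)) n :=
  totalDerivedIso_naturality F (injectiveResolutions 𝒜) (injectiveResolutions ℬ) n f g φ ψ
    I.iso I'.iso J.iso J'.iso (I.iso_hom_naturality f I' φ hφ) (J.iso_hom_naturality g J' ψ hψ)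

theorem computedByTotalInjectives_totalRightDerived :
    ComputedByTotalInjectives F (totalRightDerived F) :=
  ⟨InjectiveRes.nonempty, InjectiveRes.nonempty, fun _ _ I J n => totalRightDerivedIso F I J n,
    fun _ _ _ _ f g I I' J J' φ ψ hφ hψ n =>
      totalRightDerivedIso_naturality F f g I I' J J' φ ψ hφ hψ n⟩

variable {F} in
theorem nonempty_totalRightDerived_zero_iso (h₁ : IsLeftExact F) (h₂ : IsLeftExact F.flip) :
    Nonempty (totalRightDerived F 0 ≅ F) := by
  let I : ∀ A : 𝒜, InjectiveRes A := fun A => (InjectiveRes.nonempty A).some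
  let J : ∀ B : ℬ, InjectiveRes B := fun B => (InjectiveRes.nonempty B).some
  have hi : ∀ A B, IsIso (totalAugmentation F (I A).η (I A).η_d (J B).η (J B).η_d) := fun A B =>
    isIso_totalAugmentation F h₁ h₂ _ _ _ _ (I A).exact_η (J B).exact_η
  let e : ∀ A B, (F.obj A).obj B ≅ ((totalRightDerived F 0).obj A).obj B := fun A B =>
    (@asIso _ _ _ _ (totalAugmentation F (I A).η (I A).η_d (J B).η (J B).η_d) (hi A B)) ≪≫
      CochainComplex.isoHomologyπ₀ _ ≪≫ (totalRightDerivedIso F (I A) (J B) 0).symm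
  refine ⟨(bifunctorIso e fun {A A' B B'} f g => ?_).symm⟩
  obtain ⟨φ, hφ⟩ := (I A).exists_lift f (I A')
  obtain ⟨ψ, hψ⟩ := (J B).exists_lift g (J B')
  have h := totalRightDerivedIso_naturality F f g (I A) (I A') (J B) (J B') φ ψ hφ hψ 0
  have h' : homologyMap (mapBifunctorMap φ ψ F (ComplexShape.up ℕ)) 0 ≫
      (totalRightDerivedIso F (I A') (J B') 0).inv =
        (totalRightDerivedIso F (I A) (J B) 0).inv ≫ bimap (totalRightDerived F 0) f g := by
    rw [Iso.comp_inv_eq, Category.assoc, h, Iso.inv_hom_id_assoc]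
  have ha := totalAugmentation_naturality F (ha := (I A).η_d) (hb := (J B).η_d)
    (ha' := (I A').η_d) (hb' := (J B').η_d) f g φ ψ hφ hψ
  change bimap F f g ≫ totalAugmentation F _ (I A').η_d _ (J B').η_d ≫ homologyπ _ 0 ≫
    (totalRightDerivedIso F (I A') (J B') 0).inv = (totalAugmentation F _ (I A).η_d _ (J B).η_d ≫
      homologyπ _ 0 ≫ (totalRightDerivedIso F (I A) (J B) 0).inv) ≫
        bimap (totalRightDerived F 0) f g
  rw [reassoc_of% ha, Category.assoc, Category.assoc, ← h', homologyπ_naturality_assoc]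

/-- An injective object is its own resolution, so that the total complex is `F(A, J)` for an
injective resolution `J` of `B`, which is exact in positive degrees if `F(A, -)` is exact. -/
theorem isZero_totalRightDerived_left (A : 𝒜) [Injective A]
    (h : ∀ I : 𝒜, AdmissibleInjective I → IsExactFunctor (F.obj I)) (n : ℕ) :
    IsZero ((totalRightDerived F (n + 1)).obj A) := by
  rw [Functor.isZero_iff]
  intro B
  let K := (InjectiveResolution.self A).cocomplex
  let L := (injectiveResolution B).cocomplex
  have hK : ∀ i, i ≠ 0 → IsZero (K.X i) := fun i hi => isZero_single_obj_X _ _ _ _ hi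
  have hd : ∀ i, K.d 0 i = 0 := fun i => single_obj_d _ _ _ _ _
  have hG : IsExactFunctor (F.obj (K.X 0)) :=
    h _ ((admissibleInjective_iff _).2 ((InjectiveResolution.self A).injective 0))
  have hz := (hG.exactAt ((injectiveResolution B).cocomplex_exactAt_succ n)).isZero_homology
  refine hz.of_iso ?_
  exact (totalDerivedIso F (injectiveResolutions 𝒜) (injectiveResolutions ℬ) (n + 1)
    (InjectiveResolution.self A).iso (Iso.refl ((HomotopyCategory.quotient _ _).obj L))) ≪≫
      (homologyMapIso (totalIsoLeft F K L hK hd) (n + 1)).symm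

theorem isZero_totalRightDerived_right (B : ℬ) [Injective B]
    (h : ∀ J : ℬ, AdmissibleInjective J → IsExactFunctor (F.flip.obj J)) (n : ℕ) :
    IsZero ((totalRightDerived F (n + 1)).flip.obj B) := by
  rw [Functor.isZero_iff]
  intro A
  let K := (injectiveResolution A).cocomplex
  let L := (InjectiveResolution.self B).cocomplex
  have hL : ∀ i, i ≠ 0 → IsZero (L.X i) := fun i hi => isZero_single_obj_X _ _ _ _ hi
  have hd : ∀ i, L.d 0 i = 0 := fun i => single_obj_d _ _ _ _ _
  have hG : IsExactFunctor (F.flip.obj (L.X 0)) :=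
    h _ ((admissibleInjective_iff _).2 ((InjectiveResolution.self B).injective 0))
  have hz := (hG.exactAt ((injectiveResolution A).cocomplex_exactAt_succ n)).isZero_homology
  refine hz.of_iso ?_
  exact (totalDerivedIso F (injectiveResolutions 𝒜) (injectiveResolutions ℬ) (n + 1)
    (Iso.refl ((HomotopyCategory.quotient _ _).obj K)) (InjectiveResolution.self B).iso) ≪≫
      (homologyMapIso (totalIsoRight F K L hL hd) (n + 1)).symm

variable {F} in
theorem isTotalRightDerived_totalRightDerived (h₁ : IsLeftExact F) (h₂ : IsLeftExact F.flip) :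
    IsTotalRightDerived F (totalRightDerived F) :=
  ⟨nonempty_totalRightDerived_zero_iso h₁ h₂,
    ⟨totalRightDerivedDelta F, totalRightDerivedDelta_isExact F, fun h =>
      CohomologicalDelta.isUniversal (totalRightDerivedDelta_isExact F)
        fun n A _ => isZero_totalRightDerived_left F A h n⟩,
    ⟨totalRightDerivedFlipDelta F, totalRightDerivedFlipDelta_isExact F, fun h =>
      CohomologicalDelta.isUniversal (totalRightDerivedFlipDelta_isExact F)
        fun n B _ => isZero_totalRightDerived_right F B h n⟩,
    computedByTotalInjectives_totalRightDerived F⟩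

variable {F} in
theorem hasRightDerivedBifunctors (h₁ : IsLeftExact F) (h₂ : IsLeftExact F.flip) :
    HasRightDerivedBifunctors F :=
  ⟨⟨_, isRightDerived_rightDerived h₁, additive_rightDerived_obj F⟩,
    ⟨_, isRightDerived_rightDerived h₂, additive_rightDerived_obj F.flip⟩,
    ⟨_, isTotalRightDerived_totalRightDerived h₁ h₂⟩⟩

end TotalRightDerived

section TotalLeftDerived

open HomologicalComplex

variable {𝒜 : Type*} [Category* 𝒜] [Abelian 𝒜] {ℬ : Type*} [Category* ℬ] [Abelian ℬ]
variable [EnoughProjectives 𝒜] [EnoughProjectives ℬ]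
variable (F : 𝒜 ⥤ ℬ ⥤ AddCommGrpCat.{u}) [F.Additive] [∀ A, (F.obj A).Additive]

/-- The total left derived bifunctors. -/
def totalLeftDerived (n : ℕ) : 𝒜 ⥤ ℬ ⥤ AddCommGrpCat.{u} :=
  totalDerived F (projectiveResolutions 𝒜) (projectiveResolutions ℬ) n

/-- The connecting morphisms in the first variable. -/
def totalLeftDerivedDelta : HomologicalDelta (totalLeftDerived F) :=
  (projectiveSequenceResolution 𝒜).homologicalDelta
    ((totalHomologyDelta (c := ComplexShape.down ℕ) F).comp
      ((Functor.whiskeringLeft _ _ _).obj (projectiveResolutions ℬ)))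

theorem totalLeftDerivedDelta_isExact : (totalLeftDerivedDelta F).IsExact :=
  (projectiveSequenceResolution 𝒜).homologicalDelta_isExact _

/-- The connecting morphisms in the second variable. -/
def totalLeftDerivedFlipDelta : HomologicalDelta (fun n => (totalLeftDerived F n).flip) :=
  (projectiveSequenceResolution ℬ).homologicalDelta
    ((totalHomologyFlipDelta (c := ComplexShape.down ℕ) F).comp
      ((Functor.whiskeringLeft _ _ _).obj (projectiveResolutions 𝒜)))

theorem totalLeftDerivedFlipDelta_isExact : (totalLeftDerivedFlipDelta F).IsExact :=
  (projectiveSequenceResolution ℬ).homologicalDelta_isExact _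

/-- The total left derived bifunctor in terms of arbitrary projective resolutions. -/
def totalLeftDerivedIso {A : 𝒜} {B : ℬ} (P : ProjectiveRes A) (Q : ProjectiveRes B) (n : ℕ) :
    ((totalLeftDerived F n).obj A).obj B ≅
      (mapBifunctor P.P Q.P F (ComplexShape.down ℕ)).homology n :=
  totalDerivedIso F (projectiveResolutions 𝒜) (projectiveResolutions ℬ) n P.iso Q.iso

theorem totalLeftDerivedIso_naturality {A A' : 𝒜} {B B' : ℬ} (f : A ⟶ A') (g : B ⟶ B')
    (P : ProjectiveRes A) (P' : ProjectiveRes A') (Q : ProjectiveRes B) (Q' : ProjectiveRes B')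
    (φ : P.P ⟶ P'.P) (ψ : Q.P ⟶ Q'.P) (hφ : P.Lifts f P' φ) (hψ : Q.Lifts g Q' ψ) (n : ℕ) :
    bimap (totalLeftDerived F n) f g ≫ (totalLeftDerivedIso F P' Q' n).hom =
      (totalLeftDerivedIso F P Q n).hom ≫
        homologyMap (mapBifunctorMap φ ψ F (ComplexShape.down ℕ)) n :=
  totalDerivedIso_naturality F (projectiveResolutions 𝒜) (projectiveResolutions ℬ) n f g φ ψ
    P.iso P'.iso Q.iso Q'.iso (P.iso_hom_naturality f P' φ hφ) (Q.iso_hom_naturality g Q' ψ hψ)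

theorem computedByTotalProjectives_totalLeftDerived :
    ComputedByTotalProjectives F (totalLeftDerived F) :=
  ⟨ProjectiveRes.nonempty, ProjectiveRes.nonempty, fun _ _ P Q n => totalLeftDerivedIso F P Q n,
    fun _ _ _ _ f g P P' Q Q' φ ψ hφ hψ n =>
      totalLeftDerivedIso_naturality F f g P P' Q Q' φ ψ hφ hψ n⟩

variable {F} in
theorem nonempty_totalLeftDerived_zero_iso (h₁ : IsRightExact F) (h₂ : IsRightExact F.flip) :
    Nonempty (totalLeftDerived F 0 ≅ F) := by
  let P : ∀ A : 𝒜, ProjectiveRes A := fun A => (ProjectiveRes.nonempty A).some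
  let Q : ∀ B : ℬ, ProjectiveRes B := fun B => (ProjectiveRes.nonempty B).some
  have hi : ∀ A B, IsIso (totalCoaugmentation F (P A).ε (P A).d_ε (Q B).ε (Q B).d_ε) := fun A B =>
    isIso_totalCoaugmentation F h₁ h₂ _ _ _ _ (P A).exact_ε (Q B).exact_ε
  let e : ∀ A B, ((totalLeftDerived F 0).obj A).obj B ≅ (F.obj A).obj B := fun A B =>
    totalLeftDerivedIso F (P A) (Q B) 0 ≪≫ ChainComplex.isoHomologyι₀ _ ≪≫
      (@asIso _ _ _ _ (totalCoaugmentation F (P A).ε (P A).d_ε (Q B).ε (Q B).d_ε) (hi A B))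
  refine ⟨bifunctorIso e fun {A A' B B'} f g => ?_⟩
  obtain ⟨φ, hφ⟩ := (P A).exists_lift f (P A')
  obtain ⟨ψ, hψ⟩ := (Q B).exists_lift g (Q B')
  have h := totalLeftDerivedIso_naturality F f g (P A) (P A') (Q B) (Q B') φ ψ hφ hψ 0
  have ha := totalCoaugmentation_naturality F (ha := (P A).d_ε) (hb := (Q B).d_ε)
    (ha' := (P A').d_ε) (hb' := (Q B').d_ε) f g φ ψ hφ hψ
  change bimap (totalLeftDerived F 0) f g ≫ (totalLeftDerivedIso F (P A') (Q B') 0).hom ≫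
    homologyι _ 0 ≫ totalCoaugmentation F _ (P A').d_ε _ (Q B').d_ε =
      ((totalLeftDerivedIso F (P A) (Q B) 0).hom ≫ homologyι _ 0 ≫
        totalCoaugmentation F _ (P A).d_ε _ (Q B).d_ε) ≫ bimap F f g
  rw [reassoc_of% h, Category.assoc, Category.assoc, ha, homologyι_naturality_assoc]

/-- A projective object is its own resolution, so that the total complex is `F(A, Q)` for a
projective resolution `Q` of `B`, which is exact in positive degrees if `F(A, -)` is exact. -/
theorem isZero_totalLeftDerived_left (A : 𝒜) [Projective A]
    (h : ∀ P : 𝒜, AdmissibleProjective P → IsExactFunctor (F.obj P)) (n : ℕ) :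
    IsZero ((totalLeftDerived F (n + 1)).obj A) := by
  rw [Functor.isZero_iff]
  intro B
  let K := (ProjectiveResolution.self A).complex
  let L := (projectiveResolution B).complex
  have hK : ∀ i, i ≠ 0 → IsZero (K.X i) := fun i hi => isZero_single_obj_X _ _ _ _ hi
  have hd : ∀ i, K.d 0 i = 0 := fun i => single_obj_d _ _ _ _ _
  have hG : IsExactFunctor (F.obj (K.X 0)) :=
    h _ ((admissibleProjective_iff _).2 ((ProjectiveResolution.self A).projective 0))
  have hz := (hG.exactAt ((projectiveResolution B).complex_exactAt_succ n)).isZero_homology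
  refine hz.of_iso ?_
  exact (totalDerivedIso F (projectiveResolutions 𝒜) (projectiveResolutions ℬ) (n + 1)
    (ProjectiveResolution.self A).iso (Iso.refl ((HomotopyCategory.quotient _ _).obj L))) ≪≫
      (homologyMapIso (totalIsoLeft F K L hK hd) (n + 1)).symm

theorem isZero_totalLeftDerived_right (B : ℬ) [Projective B]
    (h : ∀ Q : ℬ, AdmissibleProjective Q → IsExactFunctor (F.flip.obj Q)) (n : ℕ) :
    IsZero ((totalLeftDerived F (n + 1)).flip.obj B) := by
  rw [Functor.isZero_iff]
  intro A
  let K := (projectiveResolution A).complex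
  let L := (ProjectiveResolution.self B).complex
  have hL : ∀ i, i ≠ 0 → IsZero (L.X i) := fun i hi => isZero_single_obj_X _ _ _ _ hi
  have hd : ∀ i, L.d 0 i = 0 := fun i => single_obj_d _ _ _ _ _
  have hG : IsExactFunctor (F.flip.obj (L.X 0)) :=
    h _ ((admissibleProjective_iff _).2 ((ProjectiveResolution.self B).projective 0))
  have hz := (hG.exactAt ((projectiveResolution A).complex_exactAt_succ n)).isZero_homology
  refine hz.of_iso ?_
  exact (totalDerivedIso F (projectiveResolutions 𝒜) (projectiveResolutions ℬ) (n + 1)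
    (Iso.refl ((HomotopyCategory.quotient _ _).obj K)) (ProjectiveResolution.self B).iso) ≪≫
      (homologyMapIso (totalIsoRight F K L hL hd) (n + 1)).symm

variable {F} in
theorem isTotalLeftDerived_totalLeftDerived (h₁ : IsRightExact F) (h₂ : IsRightExact F.flip) :
    IsTotalLeftDerived F (totalLeftDerived F) :=
  ⟨nonempty_totalLeftDerived_zero_iso h₁ h₂,
    ⟨totalLeftDerivedDelta F, totalLeftDerivedDelta_isExact F, fun h =>
      HomologicalDelta.isUniversal (totalLeftDerivedDelta_isExact F)
        fun n A _ => isZero_totalLeftDerived_left F A h n⟩,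
    ⟨totalLeftDerivedFlipDelta F, totalLeftDerivedFlipDelta_isExact F, fun h =>
      HomologicalDelta.isUniversal (totalLeftDerivedFlipDelta_isExact F)
        fun n B _ => isZero_totalLeftDerived_right F B h n⟩,
    computedByTotalProjectives_totalLeftDerived F⟩

variable {F} in
theorem hasLeftDerivedBifunctors (h₁ : IsRightExact F) (h₂ : IsRightExact F.flip) :
    HasLeftDerivedBifunctors F :=
  ⟨⟨_, isLeftDerived_leftDerived h₁, additive_leftDerived_obj F⟩,
    ⟨_, isLeftDerived_leftDerived h₂, additive_leftDerived_obj F.flip⟩,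
    ⟨_, isTotalLeftDerived_totalLeftDerived h₁ h₂⟩⟩

end TotalLeftDerived

section Existence

theorem derivedBifunctorsExist (𝒜 ℬ : Type*) [Category* 𝒜] [Category* ℬ] [Abelian 𝒜] [Abelian ℬ]
    [EnoughInjectives 𝒜] [EnoughInjectives ℬ] [EnoughProjectives 𝒜] [EnoughProjectives ℬ] :
    DerivedBifunctorsExist.{u} 𝒜 ℬ :=
  ⟨fun _ _ _ h₁ h₂ => hasRightDerivedBifunctors h₁ h₂,
    fun _ _ _ h₁ h₂ => hasLeftDerivedBifunctors h₁ h₂⟩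

/-- If `F(I, -)` and `F(-, J)` are exact for injective `I` and `J`, then the derived functors in
each of the two variables agree with the total ones. -/
theorem isRightDerived_totalRightDerived {𝒜 ℬ : Type*} [Category* 𝒜] [Category* ℬ] [Abelian 𝒜]
    [Abelian ℬ] [EnoughInjectives 𝒜] [EnoughInjectives ℬ] (F : 𝒜 ⥤ ℬ ⥤ AddCommGrpCat.{u})
    [F.Additive] [∀ A, (F.obj A).Additive] (h₁ : IsLeftExact F) (h₂ : IsLeftExact F.flip)
    (e₁ : ∀ I : 𝒜, AdmissibleInjective I → IsExactFunctor (F.obj I))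
    (e₂ : ∀ J : ℬ, AdmissibleInjective J → IsExactFunctor (F.flip.obj J)) :
    IsRightDerived F (totalRightDerived F) ∧
      IsRightDerived F.flip (fun n => (totalRightDerived F n).flip) := by
  obtain ⟨⟨i⟩, ⟨d, hd, hu⟩, ⟨d', hd', hu'⟩, -⟩ := isTotalRightDerived_totalRightDerived h₁ h₂
  obtain ⟨⟨j⟩, ⟨D, -, hU⟩, hc⟩ := isRightDerived_rightDerived h₁
  obtain ⟨⟨j'⟩, ⟨D', -, hU'⟩, hc'⟩ := isRightDerived_rightDerived h₂
  refine ⟨⟨⟨i⟩, ⟨d, hd, hu e₁⟩, hc.of_iso fun n =>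
    ((hu e₁).nonempty_iso hU (i ≪≫ j.symm) n).some⟩, ⟨⟨?_⟩, ⟨d', hd', hu' e₂⟩,
      hc'.of_iso fun n => ((hu' e₂).nonempty_iso hU' (?_ ≪≫ j'.symm) n).some⟩⟩
  · exact (flipFunctor _ _ _).mapIso i
  · exact (flipFunctor _ _ _).mapIso i

end Existence

/-! ### Bi-`Γ`-modules as modules over a ring -/

namespace BiModule

variable {m : ℕ} {T Γ : Type u} [AddCommMonoid T] [AddCommSemigroup Γ]
variable {A : NaryGammaSemiring m T Γ} {Λ : Set (Fin (m + 1))}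

variable (m T Γ) in
/-- Formal symbols for the positional actions `w ↦ [t₁, …, w, …, t_m]_γ`. -/
abbrev ActionSymbol : Type u := Fin (m + 1) × (Fin m → T) × (Fin m → Γ)

/-- The symbol of an action in the free ring on all symbols. -/
abbrev actionGenerator (j : Fin (m + 1)) (t : Fin m → T) (γ : Fin m → Γ) :
    FreeAlgebra ℤ (ActionSymbol m T Γ) :=
  FreeAlgebra.ι ℤ (j, t, γ)

variable (A) in
/-- The element of the free ring that acts as the bracketing at `i` of a word with the module
element in position `s`. -/
def bracketElement (i : Fin (m + 1)) (s : Fin (2 * m + 1)) (x : Fin (2 * m + 1) → T)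
    (γ : Fin (2 * m) → Γ) : FreeAlgebra ℤ (ActionSymbol m T Γ) :=
  actionGenerator (outerSlot i s)
    ((outerSlot i s).removeNth (outerWord i x (A.mul (innerWord i x) (innerParams i γ))))
    (outerParams i γ) *
  if h : Inside i s then
    actionGenerator (innerSlot i s h) ((innerSlot i s h).removeNth (innerWord i x))
      (innerParams i γ)
  else 1

variable (A Λ) in
/-- The axioms of bi-`Γ`-modules, as relations between elements of the free ring.  The symbols of
actions in slots outside `Λ` are zero. -/
inductive ActionRel : FreeAlgebra ℤ (ActionSymbol m T Γ) → FreeAlgebra ℤ (ActionSymbol m T Γ) → Prop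
  | notMem (j : Fin (m + 1)) (hj : j ∉ Λ) (t : Fin m → T) (γ : Fin m → Γ) :
      ActionRel (actionGenerator j t γ) 0
  | add (j : Fin (m + 1)) (t : Fin m → T) (γ : Fin m → Γ) (p : Fin m) (a b : T) :
      ActionRel (actionGenerator j (Function.update t p (a + b)) γ)
        (actionGenerator j (Function.update t p a) γ + actionGenerator j (Function.update t p b) γ)
  | add_param (j : Fin (m + 1)) (t : Fin m → T) (γ : Fin m → Γ) (q : Fin m) (α β : Γ) :
      ActionRel (actionGenerator j t (Function.update γ q (α + β)))
        (actionGenerator j t (Function.update γ q α) + actionGenerator j t (Function.update γ q β))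
  | assoc (s : Fin (2 * m + 1)) (i i' : Fin (m + 1)) (hi : SlotsIn Λ i s) (hi' : SlotsIn Λ i' s)
      (x : Fin (2 * m + 1) → T) (γ : Fin (2 * m) → Γ) :
      ActionRel (bracketElement A i s x γ) (bracketElement A i' s x γ)

variable (A Λ) in
/-- The enveloping ring of bi-`Γ`-modules: the free ring on the symbols of all actions, modulo the
relations that express the axioms. -/
abbrev EnvelopingRing : Type u := RingQuot (ActionRel A Λ)

variable (A Λ) in
/-- The image of a symbol in the enveloping ring. -/
def actionElement (j : Fin (m + 1)) (t : Fin m → T) (γ : Fin m → Γ) : EnvelopingRing A Λ :=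
  RingQuot.mkAlgHom ℤ (ActionRel A Λ) (actionGenerator j t γ)

/-- A property of elements of the enveloping ring that is stable under the ring operations holds
everywhere if it holds for the symbols. -/
theorem envelopingRing_induction {P : EnvelopingRing A Λ → Prop}
    (hι : ∀ j t γ, P (actionElement A Λ j t γ)) (hz : ∀ z : ℤ, P z)
    (ha : ∀ a b, P a → P b → P (a + b)) (hm : ∀ a b, P a → P b → P (a * b)) (r) : P r := by
  obtain ⟨r, rfl⟩ := RingQuot.mkAlgHom_surjective ℤ (ActionRel A Λ) r
  induction r using FreeAlgebra.induction with
  | grade0 z => simpa using hz z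
  | grade1 x => exact hι x.1 x.2.1 x.2.2
  | mul a b iha ihb => simpa using hm _ _ iha ihb
  | add a b iha ihb => simpa using ha _ _ iha ihb

section ToModule

variable (M N : BiModule A Λ)

/-- The action of the free ring on a bi-`Γ`-module. -/
def freeAction : FreeAlgebra ℤ (ActionSymbol m T Γ) →ₐ[ℤ] AddMonoid.End M.carrier :=
  FreeAlgebra.lift ℤ fun x => M.act x.1 x.2.1 x.2.2

theorem freeAction_generator (j : Fin (m + 1)) (t : Fin m → T) (γ : Fin m → Γ) :
    M.freeAction (actionGenerator j t γ) = M.act j t γ :=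
  FreeAlgebra.lift_ι_apply _ _

theorem freeAction_bracketElement (i : Fin (m + 1)) (s : Fin (2 * m + 1))
    (x : Fin (2 * m + 1) → T) (γ : Fin (2 * m) → Γ) (w : M.carrier) :
    M.freeAction (bracketElement A i s x γ) w = bracketAct A M.act i s x γ w := by
  rw [bracketElement, map_mul, freeAction_generator, bracketAct]
  split_ifs
  · rw [freeAction_generator]
    rfl
  · rw [map_one]
    rfl

/-- The action of the enveloping ring on a bi-`Γ`-module. -/
def ringAction : EnvelopingRing A Λ →ₐ[ℤ] AddMonoid.End M.carrier :=
  RingQuot.liftAlgHom ℤ ⟨M.freeAction, fun x y h => by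
    cases h with
    | notMem j hj t γ =>
      rw [freeAction_generator, M.act_of_notMem j hj, map_zero]
      rfl
    | add j t γ p a b =>
      rw [map_add, freeAction_generator, freeAction_generator, freeAction_generator, M.act_add]
      rfl
    | add_param j t γ p a b =>
      rw [map_add, freeAction_generator, freeAction_generator, freeAction_generator,
        M.act_add_param]
      rfl
    | assoc s i i' hi hi' x γ =>
      ext w
      rw [freeAction_bracketElement, freeAction_bracketElement]
      exact M.assoc s i i' hi hi' x γ w⟩

instance : Module (EnvelopingRing A Λ) M.carrier :=
  Module.compHom M.carrier M.ringAction.toRingHom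

theorem actionElement_smul (j : Fin (m + 1)) (t : Fin m → T) (γ : Fin m → Γ) (w : M.carrier) :
    actionElement A Λ j t γ • w = M.act j t γ w := by
  change M.ringAction (RingQuot.mkAlgHom ℤ _ (actionGenerator j t γ)) w = _
  rw [ringAction, RingQuot.liftAlgHom_mkAlgHom_apply, freeAction_generator]
  rfl

end ToModule

/-- An additive map that commutes with the symbols is linear over the enveloping ring. -/
theorem map_smul_of_map_actionElement_smul {M N : Type*} [AddCommGroup M] [AddCommGroup N]
    [Module (EnvelopingRing A Λ) M] [Module (EnvelopingRing A Λ) N] (f : M →+ N)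
    (h : ∀ j t γ w, f (actionElement A Λ j t γ • w) = actionElement A Λ j t γ • f w)
    (r : EnvelopingRing A Λ) (w : M) : f (r • w) = r • f w := by
  induction r using envelopingRing_induction generalizing w with
  | hι j t γ => exact h j t γ w
  | hz z => rw [Int.cast_smul_eq_zsmul, Int.cast_smul_eq_zsmul, map_zsmul]
  | ha a b iha ihb => rw [add_smul, add_smul, map_add, iha, ihb]
  | hm a b iha ihb => rw [mul_smul, mul_smul, iha, ihb]

variable (A Λ) in
/-- Bi-`Γ`-modules as modules over the enveloping ring.  This is an equivalence of categories. -/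
def toModule : BiModule A Λ ⥤ ModuleCat.{u} (EnvelopingRing A Λ) where
  obj M := ModuleCat.of _ M.carrier
  map {M N} f := ModuleCat.ofHom
    { f.toAddMonoidHom with
      map_smul' := map_smul_of_map_actionElement_smul f.toAddMonoidHom fun j t γ w => by
        rw [actionElement_smul, actionElement_smul, f.map_act] }

/-- A module over the enveloping ring as a bi-`Γ`-module. -/
def ofModule (N : Type u) [AddCommGroup N] [Module (EnvelopingRing A Λ) N] : BiModule A Λ where
  carrier := N
  act j t γ := DistribSMul.toAddMonoidHom N (actionElement A Λ j t γ)
  act_of_notMem j hj t γ := by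
    ext w
    have h : actionElement A Λ j t γ = 0 :=
      (RingQuot.mkAlgHom_rel ℤ (.notMem j hj t γ)).trans (map_zero _)
    simp [h]
  act_add j t γ p a b := by
    ext w
    have h := (RingQuot.mkAlgHom_rel ℤ (ActionRel.add (A := A) (Λ := Λ) j t γ p a b)).trans
      (map_add _ _ _)
    exact (congrArg (· • w) h).trans (add_smul _ _ _)
  act_add_param j t γ p a b := by
    ext w
    have h := (RingQuot.mkAlgHom_rel ℤ (ActionRel.add_param (A := A) (Λ := Λ) j t γ p a b)).trans
      (map_add _ _ _)
    exact (congrArg (· • w) h).trans (add_smul _ _ _)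
  assoc s i i' hi hi' x γ w := by
    have h := RingQuot.mkAlgHom_rel ℤ (ActionRel.assoc (A := A) (Λ := Λ) s i i' hi hi' x γ)
    have e : ∀ i, RingQuot.mkAlgHom ℤ (ActionRel A Λ) (bracketElement A i s x γ) • w =
        bracketAct A (fun j t γ => DistribSMul.toAddMonoidHom N (actionElement A Λ j t γ))
          i s x γ w := by
      intro i
      rw [bracketElement, map_mul, mul_smul, bracketAct]
      split_ifs
      · rfl
      · rw [map_one, one_smul]
        rfl
    exact (e i).symm.trans ((congrArg (· • w) h).trans (e i'))

instance : (toModule A Λ).Faithful where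
  map_injective h := hom_ext (AddMonoidHom.ext fun w =>
    LinearMap.congr_fun (congrArg ModuleCat.Hom.hom h) w)

instance : (toModule A Λ).Full where
  map_surjective {M N} f := ⟨⟨f.hom.toAddMonoidHom, fun j t γ w => by
    have h : f.hom (actionElement A Λ j t γ • w) = actionElement A Λ j t γ • f.hom w :=
      f.hom.map_smul _ _
    exact ((congrArg f.hom (actionElement_smul M j t γ w)).symm.trans h).trans
      (actionElement_smul N j t γ _)⟩, rfl⟩

instance : (toModule A Λ).EssSurj where
  mem_essImage N := by
    let f : (ofModule N : BiModule A Λ).carrier ≃+ N := AddEquiv.refl N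
    refine ⟨ofModule N, ⟨LinearEquiv.toModuleIso { f with
      map_smul' := map_smul_of_map_actionElement_smul f.toAddMonoidHom fun j t γ w => ?_ }⟩⟩
    exact congrArg f (actionElement_smul (ofModule N : BiModule A Λ) j t γ w)

instance : (toModule A Λ).IsEquivalence where

instance : (toModule A Λ).Additive where

instance : HasFiniteProducts (BiModule A Λ) :=
  ⟨fun _ => Adjunction.hasLimitsOfShape_of_equivalence (toModule A Λ)⟩

/-- Bi-`Γ`-modules are an abelian category, with the addition of morphisms already defined. -/
instance : Abelian (BiModule A Λ) :=
  { abelianOfEquivalence (toModule A Λ) with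
    toPreadditive := inferInstance }

instance : EnoughInjectives (BiModule A Λ) :=
  have := ModuleCat.enoughInjectives.{u} (EnvelopingRing A Λ)
  EnoughInjectives.of_equivalence (toModule A Λ)

instance : EnoughProjectives (BiModule A Λ) :=
  (Equivalence.enoughProjectives_iff (toModule A Λ).asEquivalence).2 inferInstance

/-- Admissible short exact sequences of bi-`Γ`-modules are exact on underlying abelian groups. -/
theorem _root_.NaryGamma.Conflation.exact_and_surjective {S : ShortComplex (BiModule A Λ)}
    (hS : Conflation S) : Function.Exact S.f.toAddMonoidHom S.g.toAddMonoidHom ∧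
      Function.Surjective S.g.toAddMonoidHom := by
  have h := hS.map (toModule A Λ)
  have h' := (conflation_iff_shortExact _).1 h
  exact ⟨(ShortComplex.ShortExact.moduleCat_exact_iff_function_exact _).1 h'.exact,
    (ModuleCat.epi_iff_surjective _).1 h'.epi_g⟩

end BiModule

/-! ### Exactness of `Hom` -/

section Hom

universe v w

variable (𝒞 : Type w) [Category.{v} 𝒞] [Abelian 𝒞]

theorem isLeftExact_homBifunctor : IsLeftExact (homBifunctor 𝒞) := by
  intro S hS
  have h : ∀ N : 𝒞, ∀ S : ShortComplex 𝒞ᵒᵖ, S.ShortExact →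
      (S.map (preadditiveYoneda.obj N)).Exact ∧ Mono ((preadditiveYoneda.obj N).map S.f) :=
    fun N => (preadditiveYoneda.obj N).preservesFiniteLimits_iff_forall_exact_map_and_mono.1
      inferInstance
  have h' := fun N => h N S ((conflation_iff_shortExact S).1 hS)
  exact ⟨(NatTrans.mono_iff_mono_app _).2 fun N => (h' N).2,
    (exact_iff_forall_evaluation _).2 fun N => (h' N).1⟩

theorem isLeftExact_homBifunctor_flip : IsLeftExact (homBifunctor 𝒞).flip := by
  intro S hS
  have h : ∀ M : 𝒞ᵒᵖ, ∀ S : ShortComplex 𝒞, S.ShortExact →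
      (S.map (preadditiveCoyoneda.obj M)).Exact ∧ Mono ((preadditiveCoyoneda.obj M).map S.f) :=
    fun M => (preadditiveCoyoneda.obj M).preservesFiniteLimits_iff_forall_exact_map_and_mono.1
      inferInstance
  have h' := fun M => h M S ((conflation_iff_shortExact S).1 hS)
  exact ⟨(NatTrans.mono_iff_mono_app _).2 fun M => (h' M).2,
    (exact_iff_forall_evaluation _).2 fun M => (h' M).1⟩

variable {𝒞}

/-- `Hom(I, -)` is exact for injective `I` in the opposite category, as `I` is projective in `𝒞`. -/
theorem isExactFunctor_homBifunctor_obj (I : 𝒞ᵒᵖ) (hI : AdmissibleInjective I) :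
    IsExactFunctor ((homBifunctor 𝒞).obj I) := by
  intro S hS
  have hS' := (conflation_iff_shortExact S).1 hS
  have : Injective I := (admissibleInjective_iff I).1 hI
  have : Projective I.unop := inferInstance
  have h := (isLeftExact_homBifunctor_flip 𝒞) S hS
  have he : (S.map ((homBifunctor 𝒞).obj I)).Exact :=
    (exact_iff_forall_evaluation _).1 h.2 I
  have hm : Mono (((homBifunctor 𝒞).obj I).map S.f) := (NatTrans.mono_iff_mono_app _).1 h.1 I
  refine .mk' he hm ((AddCommGrpCat.epi_iff_surjective _).2 fun g => ?_)
  have := hS'.epi_g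
  exact ⟨Projective.factorThru g S.g, Projective.factorThru_comp g S.g⟩

theorem isExactFunctor_homBifunctor_flip_obj (J : 𝒞) (hJ : AdmissibleInjective J) :
    IsExactFunctor ((homBifunctor 𝒞).flip.obj J) := by
  intro S hS
  have hS' := (conflation_iff_shortExact S).1 hS
  have : Injective J := (admissibleInjective_iff J).1 hJ
  have h := (isLeftExact_homBifunctor 𝒞) S hS
  have he : (S.map ((homBifunctor 𝒞).flip.obj J)).Exact :=
    (exact_iff_forall_evaluation _).1 h.2 J
  have hm : Mono (((homBifunctor 𝒞).flip.obj J).map S.f) :=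
    (NatTrans.mono_iff_mono_app _).1 h.1 J
  refine .mk' he hm ((AddCommGrpCat.epi_iff_surjective _).2 fun g => ?_)
  have := hS'.epi_g
  exact ⟨Injective.factorThru g S.g.unop, Injective.comp_factorThru g S.g.unop⟩

end Hom

/-! ### Right exactness of the positional tensor product -/

section QuotientMaps

variable {G₁ G₂ G₃ : Type*} [AddCommGroup G₁] [AddCommGroup G₂] [AddCommGroup G₃]

/-- Exactness of `G₁ → G₂ → G₃ → 0` passes to quotients, provided that the subgroup of `G₃` is the
image of the one of `G₂`. -/
theorem function_exact_quotientMap {f : G₁ →+ G₂} {g : G₂ →+ G₃} (h : Function.Exact f g)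
    {R₁ : AddSubgroup G₁} {R₂ : AddSubgroup G₂} {R₃ : AddSubgroup G₃} (hf : R₁ ≤ R₂.comap f)
    (hg : R₂ ≤ R₃.comap g) (hR : R₃ ≤ R₂.map g) :
    Function.Exact (QuotientAddGroup.map R₁ R₂ f hf) (QuotientAddGroup.map R₂ R₃ g hg) := by
  intro z
  obtain ⟨y, rfl⟩ := QuotientAddGroup.mk_surjective z
  constructor
  · intro hy
    obtain ⟨y', hy', e⟩ := hR ((QuotientAddGroup.eq_zero_iff _).1 hy)
    obtain ⟨x, hx⟩ := (h (y - y')).1 (by rw [map_sub, e, sub_self])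
    refine ⟨QuotientAddGroup.mk x, ?_⟩
    rw [QuotientAddGroup.map_mk, hx, QuotientAddGroup.mk_sub,
      (QuotientAddGroup.eq_zero_iff y').2 hy', sub_zero]
  · rintro ⟨x, hx⟩
    obtain ⟨x, rfl⟩ := QuotientAddGroup.mk_surjective x
    rw [← hx]
    exact congrArg QuotientAddGroup.mk (h.apply_apply_eq_zero x)

end QuotientMaps

namespace BiModule

open TensorProduct

variable {m : ℕ} {T Γ : Type u} [AddCommMonoid T] [AddCommSemigroup Γ]
variable {A : NaryGammaSemiring m T Γ} {Λ : Set (Fin (m + 1))} (j k : Fin (m + 1))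

theorem tensorRel_le_comap {M M' N N' : BiModule A Λ} (f : M ⟶ M') (g : N ⟶ N') :
    tensorRel M N j k ≤ (tensorRel M' N' j k).comap
      (TensorProduct.map f.toAddMonoidHom.toIntLinearMap
        g.toAddMonoidHom.toIntLinearMap).toAddMonoidHom := by
  refine (AddSubgroup.closure_le _).2 ?_
  rintro _ ⟨t, γ, a, b, rfl⟩
  refine AddSubgroup.subset_closure ⟨t, γ, f.toAddMonoidHom a, g.toAddMonoidHom b, ?_⟩
  simp [f.map_act, g.map_act]

/-- The defining relations of the tensor product lift along surjections. -/
theorem tensorRel_le_map {M M' N N' : BiModule A Λ} (f : M ⟶ M') (g : N ⟶ N')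
    (hf : Function.Surjective f.toAddMonoidHom) (hg : Function.Surjective g.toAddMonoidHom) :
    tensorRel M' N' j k ≤ (tensorRel M N j k).map
      (TensorProduct.map f.toAddMonoidHom.toIntLinearMap
        g.toAddMonoidHom.toIntLinearMap).toAddMonoidHom := by
  refine (AddSubgroup.closure_le _).2 ?_
  rintro _ ⟨t, γ, a, b, rfl⟩
  obtain ⟨a, rfl⟩ := hf a
  obtain ⟨b, rfl⟩ := hg b
  refine ⟨_, AddSubgroup.subset_closure ⟨t, γ, a, b, rfl⟩, ?_⟩
  simp [f.map_act, g.map_act]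

theorem tensorMap_surjective {M M' N N' : BiModule A Λ} (f : M ⟶ M') (g : N ⟶ N')
    (hf : Function.Surjective f.toAddMonoidHom) (hg : Function.Surjective g.toAddMonoidHom) :
    Function.Surjective (tensorMap j k f g) := by
  intro z
  obtain ⟨y, rfl⟩ := QuotientAddGroup.mk_surjective z
  obtain ⟨x, rfl⟩ := TensorProduct.map_surjective (g := f.toAddMonoidHom.toIntLinearMap)
    (g' := g.toAddMonoidHom.toIntLinearMap) hf hg y
  exact ⟨QuotientAddGroup.mk x, rfl⟩

/-- The usual tensor product is right exact, and the relations of the quotient lift along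
`S.g ⊗ N`. -/
theorem isRightExact_tensor : IsRightExact (tensor (A := A) (Λ := Λ) j k) := by
  intro S hS
  obtain ⟨he, hs⟩ := hS.exact_and_surjective
  refine ⟨(exact_iff_forall_evaluation _).2 fun N =>
    (ShortComplex.ab_exact_iff_function_exact _).2 ?_,
    (NatTrans.epi_iff_epi_app _).2 fun N => (AddCommGrpCat.epi_iff_surjective _).2 ?_⟩
  · exact function_exact_quotientMap
      (_root_.rTensor_exact N.carrier (f := S.f.toAddMonoidHom.toIntLinearMap)
        (g := S.g.toAddMonoidHom.toIntLinearMap) he hs)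
      (tensorRel_le_comap j k S.f (𝟙 N)) (tensorRel_le_comap j k S.g (𝟙 N))
      (tensorRel_le_map j k S.g (𝟙 N) hs Function.surjective_id)
  · exact tensorMap_surjective j k S.g (𝟙 N) hs Function.surjective_id

theorem isRightExact_tensor_flip : IsRightExact (tensor (A := A) (Λ := Λ) j k).flip := by
  intro S hS
  obtain ⟨he, hs⟩ := hS.exact_and_surjective
  refine ⟨(exact_iff_forall_evaluation _).2 fun M =>
    (ShortComplex.ab_exact_iff_function_exact _).2 ?_,
    (NatTrans.epi_iff_epi_app _).2 fun M => (AddCommGrpCat.epi_iff_surjective _).2 ?_⟩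
  · exact function_exact_quotientMap
      (_root_.lTensor_exact M.carrier (f := S.f.toAddMonoidHom.toIntLinearMap)
        (g := S.g.toAddMonoidHom.toIntLinearMap) he hs)
      (tensorRel_le_comap j k (𝟙 M) S.f) (tensorRel_le_comap j k (𝟙 M) S.g)
      (tensorRel_le_map j k (𝟙 M) S.g Function.surjective_id hs)
  · exact tensorMap_surjective j k (𝟙 M) S.g Function.surjective_id hs

end BiModule

end NaryGamma

end

theorem mainTheorem2 {m : ℕ} (hm : 1 ≤ m) {T Γ : Type u} [AddCommMonoid T] [AddCommSemigroup Γ]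
    (A : NaryGamma.NaryGammaSemiring m T Γ) (Λ : Set (Fin (m + 1))) :
    NaryGamma.DerivedBifunctorsExist.{u}
      (NaryGamma.BiModule A Λ) (NaryGamma.BiModule A Λ) ∧
    NaryGamma.DerivedBifunctorsExist.{u}
      (NaryGamma.BiModule A Λ)ᵒᵖ (NaryGamma.BiModule A Λ) ∧
    (∃ Ext : ℕ → (NaryGamma.BiModule A Λ)ᵒᵖ ⥤ NaryGamma.BiModule A Λ ⥤ AddCommGrpCat.{u},
      NaryGamma.IsRightDerived (NaryGamma.homBifunctor (NaryGamma.BiModule A Λ)) Ext ∧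
      NaryGamma.IsRightDerived (NaryGamma.homBifunctor (NaryGamma.BiModule A Λ)).flip
        (fun r => (Ext r).flip) ∧
      NaryGamma.IsTotalRightDerived (NaryGamma.homBifunctor (NaryGamma.BiModule A Λ)) Ext) ∧
    (∀ j ∈ Λ, ∀ k ∈ Λ, NaryGamma.HasLeftDerivedBifunctors
      (NaryGamma.BiModule.tensor (A := A) (Λ := Λ) j k)) := by
  have h₁ := NaryGamma.isLeftExact_homBifunctor (NaryGamma.BiModule A Λ)
  have h₂ := NaryGamma.isLeftExact_homBifunctor_flip (NaryGamma.BiModule A Λ)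
  have h := NaryGamma.isRightDerived_totalRightDerived _ h₁ h₂
    NaryGamma.isExactFunctor_homBifunctor_obj NaryGamma.isExactFunctor_homBifunctor_flip_obj
  exact ⟨NaryGamma.derivedBifunctorsExist _ _, NaryGamma.derivedBifunctorsExist _ _,
    ⟨_, h.1, h.2, NaryGamma.isTotalRightDerived_totalRightDerived h₁ h₂⟩,
    fun j _ k _ => NaryGamma.hasLeftDerivedBifunctors (NaryGamma.BiModule.isRightExact_tensor j k)
      (NaryGamma.BiModule.isRightExact_tensor_flip j k)⟩
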